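/- Let $\alpha>0$ be irrational with continued fraction $[a_0;a_1,a_2,\dots]$ and convergents $p_m/q_m$ (so $q_0=1$, $q_1=a_1$), and let $\{y\}$ denote the fractional part of $y$. Suppose that $n_1<n_2<\cdots$ are positive integers such that: 1. all $n_k$ are even; 2. $\sum_{k\ge1}2\{q_{n_k}\alpha\}<\min(\frac\alpha4,1-\frac\alpha4)$; 3. $1+\sum_{k=1}^{\ell}2q_{n_k}<q_{n_\ell+1}$ for all $\ell\ge1$; 4. $a_{n_\ell+1}\to\infty$ as $\ell\to\infty$; 5. $a_m=o(\log\log q_m)$ and $a_{m+1}=o(\log\log q_m)$ as $m\to\infty$; 6. $\sum_{k\ge1}a_{n_k+1}^{-1}=\infty$; 7. $\sum_{i=1}^{m+1}a_i=O(\log q_m)$ as $m\to\infty$; 8. $\log q_{n_{k-1}+1}=o(\log q_{n_k})$ as $k\to\infty$; 9. $a_{n_k}=a_{n_k-1}=2$ for all $k$. Let $S^1=\mathbb R/\mathbb Z$ with its usual distance $d$, let $\lambda$ be Lebesgue probability measure on $S^1\times\mathbb Z_2$, put $|J|=\sum_{k\ge1}2\{q_{n_k}\alpha\}$ and $J=[0,|J|)\subset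 S^1$, and define $$T(x,j)=(x+\alpha,\;j+\chi_J(x+\alpha)),$$ $$f(x,j)=1+|\log d(x,-\alpha)|+|\log d(x,|J|-\alpha)|+\chi_{\{1\}}(j)\,|\log d(x,0)|$$ on $S^1\times\mathbb Z_2$. Let $f'$ and $f''$ be the derivatives of $f$ in the variable $x$. By an interval we mean an interval in one of the two circles $S^1\times\{j\}$, its length being measured in $S^1$ (a circle having length $1$). Then for every sufficiently large real $M$ there is a set $G(M)\subset S^1\times\mathbb Z_2$ such that the following hold, where all $o(\cdot)$ are as $M\to\infty$ and are uniform in $p$, $N$ and $k$. 1. $G(M)$ is the union of pairwise disjoint intervals of length at least $\frac{2}{M\sqrt{\log M}}$. 2. $\lambda(G(M))\to1$ as $M\to\infty$. 3. If $N\in[\frac M2,2M]$ is an integer and $p\in G(M)$, then $\sum_{i=0}^{N-1}f'(T^ip)=\pm N\log N+o(N\log N)$, where the sign is constant on each of the intervals that make up $G(M)$ (and does not depend on $N$). 4. If $N\in[\frac M2,2M]$ is an integer and $p\in G(M)$, then $\left|\sum_{i=0}^{N-1}f''(T^ip)\right|=o\big((\log N)^{1/3}N^2\big)$. 5. If $0\le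 k<2M$ is an integer and $p\in G(M)$, then $\sum_{k\le i\le k+5\sqrt{\log M}}|f'(T^ip)|=o\big(M\sqrt{\log M}\big)$. 6. $T^i$ is continuous on each of the intervals that make up $G(M)$, for all integers $0\le i\le 2M+5\sqrt{\log M}$. In particular all the derivatives above exist: for $p\in G(M)$ and $0\le i\le 2M+5\sqrt{\log M}$, $f$ and $f'$ are differentiable at $T^ip$ in the variable $x$. -/

import Mathlib

open MeasureTheory Filter Topology Asymptotics

namespace SkewFlow

noncomputable section

/-- The `m`-th term `a_m` of the continued fraction expansion of `α`. -/
def cfTerm (α : ℝ) : ℕ → ℝ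
  | 0 => ⌊α⌋
  | m + 1 => ((GenContFract.of α).partDens.get? m).getD 0

/-- The denominator `q_m` of the `m`-th convergent of `α`, with `q_0 = 1` and `q_1 = a_1`. -/
def cfDen (α : ℝ) (m : ℕ) : ℝ := (GenContFract.of α).dens m

/-- The standing assumptions on the rotation number `α` and on the subsequence `n` of the positive
integers. The sequence `n_1 < n_2 < ⋯` is indexed from `0` here: `n k` is `n_{k+1}`. -/
structure Admissible (α : ℝ) (n : ℕ → ℕ) : Prop where
  pos : 0 < α
  irrational : Irrational α
  strictMono : StrictMono n
  n_pos : ∀ k, 0 < n k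
  even : ∀ k, Even (n k)
  summable : Summable fun k => 2 * Int.fract (cfDen α (n k) * α)
  tsum_lt : ∑' k, 2 * Int.fract (cfDen α (n k) * α) < min (α / 4) (1 - α / 4)
  sum_lt : ∀ l, 1 + ∑ k ∈ Finset.range (l + 1), 2 * cfDen α (n k) < cfDen α (n l + 1)
  tendsto : Tendsto (fun l => cfTerm α (n l + 1)) atTop atTop
  isLittleO : (fun m => cfTerm α m) =o[atTop] fun m => Real.log (Real.log (cfDen α m))
  isLittleO_succ :
    (fun m => cfTerm α (m + 1)) =o[atTop] fun m => Real.log (Real.log (cfDen α m))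
  not_summable : ¬ Summable fun k => (cfTerm α (n k + 1))⁻¹
  isBigO :
    (fun m => ∑ i ∈ Finset.Icc 1 (m + 1), cfTerm α i) =O[atTop] fun m => Real.log (cfDen α m)
  log_isLittleO :
    (fun k => Real.log (cfDen α (n k + 1))) =o[atTop] fun k => Real.log (cfDen α (n (k + 1)))
  term_eq_two : ∀ k, cfTerm α (n k) = 2 ∧ cfTerm α (n k - 1) = 2

/-- The space `S¹ × ℤ₂`, where `S¹ = ℝ / ℤ`. -/
abbrev Space : Type := UnitAddCircle × ZMod 2

/-- The length `|J| = ∑ 2 {q_{n_k} α}` of the interval `J`. -/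
def lenJ (α : ℝ) (n : ℕ → ℕ) : ℝ := ∑' k, 2 * Int.fract (cfDen α (n k) * α)

/-- The interval `J = [0, |J|)` in the circle. -/
def arcJ (α : ℝ) (n : ℕ → ℕ) : Set UnitAddCircle :=
  (fun t : ℝ => (t : UnitAddCircle)) '' Set.Ico 0 (lenJ α n)

/-- The skew product `T (x, j) = (x + α, j + χ_J (x + α))`. -/
def skew (α : ℝ) (n : ℕ → ℕ) (p : Space) : Space :=
  (p.1 + (α : UnitAddCircle), p.2 + (arcJ α n).indicator 1 (p.1 + (α : UnitAddCircle)))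

/-- The roof function, with logarithmic singularities over `-α`, over `|J| - α`, and, on the sheet
`j = 1` only, over `0`. Only its values away from these singularities are meaningful. -/
def roof (α : ℝ) (n : ℕ → ℕ) (p : Space) : ℝ :=
  1 + |Real.log (dist p.1 (-(α : UnitAddCircle)))|
    + |Real.log (dist p.1 ((lenJ α n : UnitAddCircle) - (α : UnitAddCircle)))|
    + Set.indicator {(1 : ZMod 2)} 1 p.2 * |Real.log (dist p.1 0)|

/-- The function `g` read along the circle direction, centred at `p`. -/
def alongCircle (g : Space → ℝ) (p : Space) (t : ℝ) : ℝ := g (p.1 + (t : UnitAddCircle), p.2)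

/-- The derivative of `g` in the circle direction. -/
def circleDeriv (g : Space → ℝ) (p : Space) : ℝ := deriv (alongCircle g p) 0

/-- `g` is differentiable at `p` in the circle direction. -/
def CircleDifferentiableAt (g : Space → ℝ) (p : Space) : Prop :=
  DifferentiableAt ℝ (alongCircle g p) 0

/-- Lebesgue probability measure on `S¹ × ℤ₂`: each of the two sheets has mass `1 / 2`. -/
def lebesgue : Measure Space :=
  (2 : ENNReal)⁻¹ • ∑ j : ZMod 2, (volume : Measure UnitAddCircle).map fun x => (x, j)

/-- `I` is an interval of length at least `L` in one of the two circles `S¹ × {j}`: it is the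
injective image of a (not necessarily open or closed) interval of the real line. -/
def IsIntervalOfLengthGE (L : ℝ) (I : Set Space) : Prop :=
  ∃ (s : Set ℝ) (j : ZMod 2), s.OrdConnected ∧ Set.InjOn (fun t : ℝ => (t : UnitAddCircle)) s ∧
    ENNReal.ofReal L ≤ volume s ∧ I = (fun t : ℝ => ((t : UnitAddCircle), j)) '' s

end

end SkewFlow

/-! The derivative of `|log ‖t‖|` equals `1 / (1 - {t}) - 1 / {t}` up to a bounded error. Along an
orbit of the rotation of length `N`, each one-sided sum `∑ 1 / {x + iα}` and `∑ 1 / (1 - {x + iα})`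
is `N log N + o(M log M)`, provided the orbit keeps a distance `1 / (M * slow M)` from `0`
(`eventually_oneSided`). The singularities over `-α` and `|J| - α` are two-sided on both sheets, so
their main terms cancel. The singularity over `0` counts only when the orbit is on sheet `1`, and
everything depends on how the sheet correlates with the side of `0` on which the orbit passes.

Modulo `2` the arc `[0, 2{qα})` is a coboundary: it consists of `[0, {qα})` and its translate by
`qα`, and the sum of the two indicators telescopes. Adding such arcs for `q = q_{n_l}`, the
indicator of each partial arc `[0, partialLen k)` is the coboundary of `transfer k`
(`transfer_add`). If `k` is chosen according to `M`, the remaining part of `J` is so short that most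
orbits avoid it up to time `3M`. Then the sheet at time `i` is `j + transfer x + transfer (x + iα)`,
a function of the position `x + iα` once the starting point is fixed.

All discontinuities of `transfer` are at points `tα` with `t ≥ 0`. Hence it is continuous near `-α`,
and the coboundary equation makes it jump by exactly `1` at `0` and stay constant on either side
(`exists_transfer_near_zero`). So sheet `1` is met on precisely one side of `0`: only one of the two
one-sided sums survives, which produces `± N log N`. The sign depends on `j + transfer x`, which is
constant on the intervals of the good set.

The constancy holds on a neighbourhood of radius `δ = 1 / (2 q_{n_k + 1})`. It costs `M log (1 /
δ)`, which is negligible because `log q_{n_k + 1} = o(log q_{n_{k+1}})`. This concerns the levels up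
to `k`; the one further level `k + 1` that has to be included varies at a finer scale, but the orbit
visits its support so rarely that the visits contribute `o(M log M)` (`sum_support_le`,
`support_error_le`).

The second derivative and the short windows need only separation of the orbit. The good set consists
of the cells of a partition of the circle into about `M √(log M) / 2` pieces that keep away from all
preimages of the singularities up to time `3M`; the discarded cells have small total measure
(`lebesgue_compl_le`). -/

/-! ### Continued fractions and best approximation -/

/-- The convergents `P m / Q m` of a number `α` with continued fraction digits `a`. -/
structure IsConvergentSeq (α : ℝ) (a : ℕ → ℝ) (Q : ℕ → ℕ) (P : ℕ → ℤ) : Prop where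
  pos : ∀ m, 0 < Q m
  mono : ∀ m, Q m ≤ Q (m + 1)
  two_mul_le : ∀ m, 2 * Q m ≤ Q (m + 2)
  mul_le : ∀ m, a (m + 1) * Q m ≤ Q (m + 1)
  le_mul : ∀ m, (Q (m + 1) : ℝ) ≤ (a (m + 1) + 1) * Q m
  one_le : ∀ m, 1 ≤ a (m + 1)
  sign : ∀ m, 0 < (-1) ^ m * (Q m * α - P m)
  det : ∀ m, P m * Q (m + 1) - Q m * P (m + 1) = (-1) ^ (m + 1)

theorem not_terminatedAt_of_irrational {α : ℝ} (h : Irrational α) (m : ℕ) :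
    ¬ (GenContFract.of α).TerminatedAt m := fun ht => by
  obtain ⟨q, hq⟩ := GenContFract.exists_rat_eq_of_terminates ⟨m, ht⟩
  exact h ⟨q, hq.symm⟩

-- This extracts integer convergents from the continued fraction over `ℝ`; later arguments use only
-- the properties bundled in `IsConvergentSeq`. Irrationality makes every digit exist, so both
-- recurrences never stop and preserve integrality.
open GenContFract in
theorem exists_isConvergentSeq {α : ℝ} (h : Irrational α) :
    ∃ Q P, IsConvergentSeq α (SkewFlow.cfTerm α) Q P ∧ ∀ m, SkewFlow.cfDen α m = (Q m : ℝ) := by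
  have hget : ∀ m, ∃ z : ℤ, (GenContFract.of α).s.get? m = some ⟨1, (z : ℝ)⟩ := by
    intro m
    obtain ⟨gp, hgp⟩ := Option.ne_none_iff_exists'.1 (not_terminatedAt_of_irrational h m)
    obtain ⟨h1, z, hz⟩ := of_partNum_eq_one_and_exists_int_partDen_eq hgp
    exact ⟨z, by rw [hgp]; cases gp; simp_all⟩
  choose z hz using hget
  have hterm : ∀ m, SkewFlow.cfTerm α (m + 1) = z m := by
    intro m
    simp [SkewFlow.cfTerm, partDen_eq_s_b (hz m)]
  have hone : ∀ m, 1 ≤ z m := by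
    intro m
    have : (1 : ℝ) ≤ z m := of_one_le_get?_partDen (partDen_eq_s_b (hz m))
    exact_mod_cast this
  have hrec : ∀ m, (GenContFract.of α).dens (m + 2)
      = z (m + 1) * (GenContFract.of α).dens (m + 1) + (GenContFract.of α).dens m := by
    intro m
    simpa using dens_recurrence (hz (m + 1)) rfl rfl
  have hrecN : ∀ m, (GenContFract.of α).nums (m + 2)
      = z (m + 1) * (GenContFract.of α).nums (m + 1) + (GenContFract.of α).nums m := by
    intro m
    simpa using nums_recurrence (hz (m + 1)) rfl rfl
  have hd0 : (GenContFract.of α).dens 0 = 1 := zeroth_den_eq_one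
  have hd1 : (GenContFract.of α).dens 1 = z 0 := first_den_eq (hz 0)
  have hn0 : (GenContFract.of α).nums 0 = (⌊α⌋ : ℤ) := by
    rw [zeroth_num_eq_h]; exact of_h_eq_floor
  have hn1 : (GenContFract.of α).nums 1 = ((z 0 * ⌊α⌋ + 1 : ℤ) : ℝ) := by
    rw [first_num_eq (hz 0), of_h_eq_floor]; push_cast; ring
  have hint : ∀ m, (∃ q : ℕ, 0 < q ∧ (GenContFract.of α).dens m = q) ∧
      (∃ q : ℕ, 0 < q ∧ (GenContFract.of α).dens (m + 1) = q) ∧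
      (∃ p : ℤ, (GenContFract.of α).nums m = p) ∧
      (∃ p : ℤ, (GenContFract.of α).nums (m + 1) = p) := by
    intro m
    induction m with
    | zero =>
      refine ⟨⟨1, one_pos, by simp [hd0]⟩, ⟨(z 0).toNat, ?_, ?_⟩, ⟨_, hn0⟩, ⟨_, hn1⟩⟩
      · have := hone 0; omega
      · rw [zero_add, hd1]
        have : ((z 0).toNat : ℤ) = z 0 := Int.toNat_of_nonneg (by have := hone 0; omega)
        exact_mod_cast this.symm
    | succ m ih =>
      obtain ⟨⟨q, hq, hq'⟩, ⟨r, hr, hr'⟩, ⟨p, hp⟩, ⟨t, ht⟩⟩ := ih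
      refine ⟨⟨r, hr, hr'⟩, ⟨(z (m + 1)).toNat * r + q, by omega, ?_⟩, ⟨t, ht⟩,
        ⟨z (m + 1) * t + p, ?_⟩⟩
      · rw [hrec, hr', hq']
        have : ((z (m + 1)).toNat : ℤ) = z (m + 1) :=
          Int.toNat_of_nonneg (by have := hone (m + 1); omega)
        have h2 : ((z (m + 1)).toNat : ℝ) = z (m + 1) := by exact_mod_cast this
        push_cast
        rw [h2]
      · rw [hrecN, hp, ht]; push_cast; ring
  choose Q hQ using fun m => (hint m).1
  choose P hP using fun m => (hint m).2.2.1
  have hrec' : ∀ m, (Q (m + 2) : ℝ) = z (m + 1) * Q (m + 1) + Q m := fun m => by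
    rw [← (hQ _).2, hrec, (hQ _).2, (hQ _).2]
  have hone' : ∀ m, (1 : ℝ) ≤ z m := fun m => by exact_mod_cast hone m
  have hQ0 : Q 0 = 1 := by
    have := hd0; rw [(hQ 0).2] at this; exact_mod_cast this
  have hQ1 : (Q 1 : ℝ) = z 0 := by
    rw [← hd1, (hQ 1).2]
  have hmono : ∀ m, Q m ≤ Q (m + 1) := by
    intro m
    have := of_den_mono (v := α) (n := m)
    rw [(hQ _).2, (hQ _).2] at this
    exact_mod_cast this
  refine ⟨Q, P, ⟨fun m => (hQ m).1, hmono, ?_, ?_, ?_, ?_, ?_, ?_⟩, fun m => (hQ m).2⟩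
  · intro m
    have h1 := hrec' m
    have h2 : (Q m : ℝ) ≤ Q (m + 1) := by exact_mod_cast hmono m
    have h3 := hone' (m + 1)
    have : (2 * Q m : ℝ) ≤ Q (m + 2) := by nlinarith [(Nat.cast_nonneg (Q m) : (0:ℝ) ≤ Q m)]
    exact_mod_cast this
  · intro m
    rw [hterm]
    rcases m with _ | m
    · simp [hQ0, hQ1]
    · rw [hrec' m]; simp
  · intro m
    rw [hterm]
    rcases m with _ | m
    · simp [hQ0, hQ1]
    · rw [hrec' m]
      have h2 : (Q m : ℝ) ≤ Q (m + 1) := by exact_mod_cast hmono m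
      linarith
  · intro m; rw [hterm]; exact hone' m
  · intro m
    obtain ⟨ifp, hifp, -⟩ := IntFractPair.exists_succ_get?_stream_of_gcf_of_get?_eq_some (hz m)
    obtain ⟨ifp', hifp', hne, -⟩ := IntFractPair.succ_nth_stream_eq_some_iff.1 hifp
    have hs := sub_convs_eq hifp'
    simp only [hne, if_false] at hs
    have hB : ((GenContFract.of α).contsAux (m + 1)).b = Q m := by
      rw [← (hQ m).2]; rfl
    have hpB : 0 ≤ ((GenContFract.of α).contsAux m).b := zero_le_of_contsAux_b
    rw [hB] at hs
    have hc : (GenContFract.of α).convs m = P m / Q m := by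
      rw [conv_eq_num_div_den, hP, (hQ m).2]
    have hq0 : (0 : ℝ) < Q m := by exact_mod_cast (hQ m).1
    have hfr : 0 < ifp'.fr := lt_of_le_of_ne (IntFractPair.nth_stream_fr_nonneg hifp') hne.symm
    have e : (Q m * α - P m : ℝ) = Q m * (α - P m / Q m) := by field_simp
    rw [e, ← hc, hs]
    have : (0 : ℝ) < ifp'.fr⁻¹ * Q m + ((GenContFract.of α).contsAux m).b := by positivity
    have e2 : (-1 : ℝ) ^ m * (Q m * ((-1) ^ m / (Q m * (ifp'.fr⁻¹ * Q m +
        ((GenContFract.of α).contsAux m).b)))) = ((-1) ^ m * (-1) ^ m) * (1 / (ifp'.fr⁻¹ * Q m +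
        ((GenContFract.of α).contsAux m).b)) := by field_simp
    rw [e2, ← mul_pow]
    simpa using this
  · intro m
    have := SimpContFract.determinant (s := SimpContFract.of α) (n := m)
      (not_terminatedAt_of_irrational h m)
    change (GenContFract.of α).nums m * (GenContFract.of α).dens (m + 1) -
      (GenContFract.of α).dens m * (GenContFract.of α).nums (m + 1) = _ at this
    rw [hP, hP, (hQ _).2, (hQ _).2] at this
    exact_mod_cast this

namespace IsConvergentSeq

variable {α : ℝ} {a : ℕ → ℝ} {Q : ℕ → ℕ} {P : ℕ → ℤ}

theorem monotone (h : IsConvergentSeq α a Q P) : Monotone Q := monotone_nat_of_le_succ h.mono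

theorem cast_pos (h : IsConvergentSeq α a Q P) (m : ℕ) : (0 : ℝ) < Q m := by
  exact_mod_cast h.pos m

theorem abs_eq (h : IsConvergentSeq α a Q P) (m : ℕ) :
    |Q m * α - P m| = (-1) ^ m * (Q m * α - P m) := by
  rw [← abs_of_pos (h.sign m), abs_mul, abs_pow]; simp

theorem abs_pos (h : IsConvergentSeq α a Q P) (m : ℕ) : 0 < |Q m * α - P m| := by
  rw [h.abs_eq]; exact h.sign m

/-- The errors of consecutive convergents have opposite signs, so the determinant identity turns
into a sum of absolute values. Both bounds on `|Q m * α - P m|` follow from it, the lower one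
because `2 * Q m ≤ Q (m + 2)` makes the second summand at most `1 / 2`. -/
theorem abs_add_abs (h : IsConvergentSeq α a Q P) (m : ℕ) :
    Q (m + 1) * |Q m * α - P m| + Q m * |Q (m + 1) * α - P (m + 1)| = 1 := by
  rw [h.abs_eq, h.abs_eq]
  have hd : (P m * Q (m + 1) - Q m * P (m + 1) : ℝ) = (-1) ^ (m + 1) := by
    exact_mod_cast h.det m
  have e : (Q (m + 1) * ((-1) ^ m * (Q m * α - P m))
      + Q m * ((-1) ^ (m + 1) * (Q (m + 1) * α - P (m + 1))) : ℝ)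
      = (-1) ^ (m + 1) * (P m * Q (m + 1) - Q m * P (m + 1)) := by
    rw [pow_succ]; ring
  rw [e, hd, ← mul_pow]; simp

theorem abs_le (h : IsConvergentSeq α a Q P) (m : ℕ) : |Q m * α - P m| ≤ 1 / Q (m + 1) := by
  rw [le_div_iff₀ (h.cast_pos _)]
  nlinarith [h.abs_add_abs m, mul_pos (h.cast_pos m) (h.abs_pos (m + 1))]

theorem le_abs (h : IsConvergentSeq α a Q P) (m : ℕ) :
    1 / (2 * Q (m + 1)) ≤ |Q m * α - P m| := by
  have h1 := h.abs_le (m + 1)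
  have h2 : (2 * Q m : ℝ) ≤ Q (m + 2) := by exact_mod_cast h.two_mul_le m
  rw [le_div_iff₀ (h.cast_pos _)] at h1
  rw [div_le_iff₀ (by have := h.cast_pos (m + 1); positivity)]
  nlinarith [h.abs_add_abs m, h.abs_pos (m + 1)]

theorem abs_lt_one_half (h : IsConvergentSeq α a Q P) {m : ℕ} (hm : 2 ≤ m) :
    |Q m * α - P m| ≤ 1 / 2 := by
  refine (h.abs_le m).trans ?_
  have h1 : 2 * Q 0 ≤ Q 2 := h.two_mul_le 0
  have h2 : Q 2 ≤ Q (m + 1) := h.monotone (by omega)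
  have h3 : 2 ≤ Q (m + 1) := by have := h.pos 0; omega
  have h4 : (2 : ℝ) ≤ Q (m + 1) := by exact_mod_cast h3
  exact one_div_le_one_div_of_le (by norm_num) h4

theorem coprime (h : IsConvergentSeq α a Q P) (m : ℕ) : IsCoprime (Q m : ℤ) (P m) := by
  refine ⟨-(-1) ^ (m + 1) * P (m + 1), (-1) ^ (m + 1) * Q (m + 1), ?_⟩
  have := h.det m
  calc _ = (-1) ^ (m + 1) * (P m * Q (m + 1) - Q m * P (m + 1)) := by ring
    _ = 1 := by rw [this, ← mul_pow]; simp

/-- Convergents are best approximations. -/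
theorem best_approx (h : IsConvergentSeq α a Q P) (m : ℕ) {i : ℕ} (hi : 0 < i)
    (hiQ : i < Q (m + 1)) (j : ℤ) : |Q m * α - P m| ≤ |i * α - j| := by
  set e : ℤ := (-1) ^ (m + 1) with he
  have hee : e * e = 1 := by rw [he, ← mul_pow]; simp
  have hdet := h.det m
  rw [← he] at hdet
  -- Cramer's rule: `u`, `v` are the coordinates of `(i, j)` in the basis of `ℤ²` formed by two
  -- consecutive convergents, whose determinant is `± 1`.
  set u : ℤ := e * (j * Q (m + 1) - i * P (m + 1)) with hu
  set v : ℤ := e * (P m * i - Q m * j) with hv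
  have hi' : (i : ℤ) = u * Q m + v * Q (m + 1) := by
    rw [hu, hv]
    linear_combination (-(e * i) : ℤ) * hdet - (i : ℤ) * hee
  have hj' : j = u * P m + v * P (m + 1) := by
    rw [hu, hv]
    linear_combination (-(e * j) : ℤ) * hdet - j * hee
  have hQm : (0 : ℤ) < Q m := by exact_mod_cast h.pos m
  have hQm1 : (0 : ℤ) < Q (m + 1) := by exact_mod_cast h.pos (m + 1)
  have hiQ' : (i : ℤ) < Q (m + 1) := by exact_mod_cast hiQ
  have hi0 : (0 : ℤ) < i := by exact_mod_cast hi
  have hu0 : u ≠ 0 := by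
    intro hu0
    rw [hu0, zero_mul, zero_add] at hi'
    have : 0 < v := by
      by_contra hc
      nlinarith
    nlinarith
  -- Coordinates of the same strict sign would contradict `0 < i < Q (m + 1)`. Since the errors of
  -- the two convergents also alternate in sign, the two contributions to `i * α - j` add up instead
  -- of cancelling.
  have huv : u * v ≤ 0 := by
    by_contra hc
    push Not at hc
    rcases lt_or_gt_of_ne hu0 with hneg | hpos
    · have : v < 0 := by nlinarith
      nlinarith
    · have : 0 < v := by nlinarith
      nlinarith
  have key : (i * α - j : ℝ) = u * (Q m * α - P m) + v * (Q (m + 1) * α - P (m + 1)) := by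
    have h1 : (i : ℝ) = u * Q m + v * Q (m + 1) := by exact_mod_cast hi'
    have h2 : (j : ℝ) = u * P m + v * P (m + 1) := by exact_mod_cast hj'
    rw [h1, h2]; ring
  set x := (-1 : ℝ) ^ m * (Q m * α - P m) with hx
  set y := (-1 : ℝ) ^ (m + 1) * (Q (m + 1) * α - P (m + 1)) with hy
  have hx0 : 0 < x := h.sign m
  have hy0 : 0 < y := h.sign (m + 1)
  have hs : |(i * α - j : ℝ)| = |u * x - v * y| := by
    have : (-1 : ℝ) ^ m * (i * α - j) = u * x - v * y := by
      rw [key, hx, hy, pow_succ]; ring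
    rw [← this, abs_mul, abs_pow]; simp
  rw [h.abs_eq, hs]
  rcases lt_or_gt_of_ne hu0 with hneg | hpos
  · have hv0 : 0 ≤ v := by nlinarith
    have h1 : (u : ℝ) ≤ -1 := by exact_mod_cast (by omega : u ≤ -1)
    have h2 : (0 : ℝ) ≤ v := by exact_mod_cast hv0
    refine le_trans ?_ (neg_le_abs _)
    nlinarith
  · have hv0 : v ≤ 0 := by nlinarith
    have h1 : (1 : ℝ) ≤ u := by exact_mod_cast (by omega : 1 ≤ u)
    have h2 : (v : ℝ) ≤ 0 := by exact_mod_cast hv0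
    refine le_trans ?_ (le_abs_self _)
    nlinarith

theorem exists_le_lt (h : IsConvergentSeq α a Q P) {x : ℝ} (hx : Q 0 ≤ x) :
    ∃ m, Q m ≤ x ∧ x < Q (m + 1) := by
  have hlarge : ∀ m : ℕ, (m : ℝ) ≤ Q (2 * m) := by
    intro m
    induction m with
    | zero => simp
    | succ m ih =>
      have h1 : (2 * Q (2 * m) : ℝ) ≤ Q (2 * m + 2) := by exact_mod_cast h.two_mul_le (2 * m)
      have h2 : (1 : ℝ) ≤ Q (2 * m) := by exact_mod_cast h.pos (2 * m)
      rw [show 2 * (m + 1) = 2 * m + 2 by ring]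
      push_cast; linarith
  obtain ⟨N, hN⟩ := exists_nat_gt x
  have hex : ∃ m, x < Q m := ⟨2 * N, hN.trans_le (hlarge N)⟩
  classical
  obtain ⟨hm, hmin⟩ := And.intro (Nat.find_spec hex) (fun k => Nat.find_min (m := k) hex)
  rcases hk : Nat.find hex with _ | k
  · rw [hk] at hm; linarith
  · refine ⟨k, ?_, hk ▸ hm⟩
    have := hmin k (by omega)
    linarith

end IsConvergentSeq

/-! ### Sums of reciprocals through ranks -/

section Rank

variable {ι : Type*} {s : Finset ι} {f : ι → ℝ}

/-- The rank is a bijection from `s` onto `{1, …, s.card}`. Thus any bound of `1 / f i` in terms of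
the rank of `f i` bounds the sum by a harmonic-type sum. -/
theorem sum_rank [DecidableEq ι] (hf : Set.InjOn f s) (F : ℕ → ℝ) :
    ∑ i ∈ s, F (s.filter fun j => f j ≤ f i).card = ∑ r ∈ Finset.Icc 1 s.card, F r := by
  have hinj : Set.InjOn (fun i => (s.filter fun j => f j ≤ f i).card) s := by
    have aux : ∀ i ∈ s, ∀ k ∈ s, f i < f k →
        (s.filter fun j => f j ≤ f i).card < (s.filter fun j => f j ≤ f k).card := by
      intro i hi k hk hik
      refine Finset.card_lt_card ⟨?_, ?_⟩
      · intro j hj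
        simp only [Finset.mem_filter] at hj ⊢
        exact ⟨hj.1, hj.2.trans hik.le⟩
      · intro hsub
        have : k ∈ s.filter fun j => f j ≤ f i := hsub (by simp [hk])
        simp only [Finset.mem_filter] at this
        linarith [this.2]
    intro i hi k hk hik
    by_contra hne
    rcases lt_or_gt_of_ne (fun h => hne (hf hi hk h)) with h | h
    · have := aux i hi k hk h
      simp only at hik; omega
    · have := aux k hk i hi h
      simp only at hik; omega
  have himg : s.image (fun i => (s.filter fun j => f j ≤ f i).card) = Finset.Icc 1 s.card := by
    refine Finset.eq_of_subset_of_card_le ?_ ?_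
    · intro r hr
      obtain ⟨i, hi, rfl⟩ := Finset.mem_image.1 hr
      refine Finset.mem_Icc.2 ⟨Finset.card_pos.2 ⟨i, by simp [hi]⟩, Finset.card_filter_le _ _⟩
    · rw [Finset.card_image_of_injOn hinj]; simp
  rw [← himg, Finset.sum_image hinj]

/-- Values that are `ρ`-separated fall into different bins `⌊f j / ρ⌋`, and bin `0` is empty. -/
theorem rank_mul_le {ρ : ℝ} (hρ : 0 < ρ) (hf : ∀ i ∈ s, ρ ≤ f i)
    (hsep : ∀ i ∈ s, ∀ j ∈ s, i ≠ j → ρ ≤ |f i - f j|) {i : ι} (hi : i ∈ s) :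
    (s.filter fun j => f j ≤ f i).card * ρ ≤ f i := by
  have hcard : (s.filter fun j => f j ≤ f i).card ≤ (Finset.Icc 1 ⌊f i / ρ⌋₊).card := by
    refine Finset.card_le_card_of_injOn (fun j => ⌊f j / ρ⌋₊) ?_ ?_
    · intro j hj
      simp only [Finset.coe_filter, Set.mem_ofPred_eq] at hj
      simp only [Finset.coe_Icc, Set.mem_Icc]
      refine ⟨Nat.le_floor ?_, Nat.floor_le_floor ?_⟩
      · rw [le_div_iff₀ hρ]; simpa using hf j hj.1
      · exact div_le_div_of_nonneg_right hj.2 hρ.le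
    · intro j hj k hk hjk
      simp only [Finset.coe_filter, Set.mem_ofPred_eq] at hj hk
      by_contra hne
      have h1 := hsep j hj.1 k hk.1 hne
      simp only at hjk
      have a1 := Nat.floor_le (div_nonneg (hρ.le.trans (hf j hj.1)) hρ.le)
      have a2 := Nat.lt_floor_add_one (f j / ρ)
      have b1 := Nat.floor_le (div_nonneg (hρ.le.trans (hf k hk.1)) hρ.le)
      have b2 := Nat.lt_floor_add_one (f k / ρ)
      rw [hjk] at a1 a2
      have : |f j / ρ - f k / ρ| < 1 := by rw [abs_lt]; constructor <;> linarith
      rw [← sub_div, abs_div, abs_of_pos hρ, div_lt_one hρ] at this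
      linarith
  rw [Nat.card_Icc, Nat.add_sub_cancel] at hcard
  have h2 : ((s.filter fun j => f j ≤ f i).card : ℝ) ≤ f i / ρ :=
    (Nat.cast_le.2 hcard).trans (Nat.floor_le (div_nonneg (hρ.le.trans (hf i hi)) hρ.le))
  rwa [le_div_iff₀ hρ] at h2

theorem injOn_of_separated {ρ : ℝ} (hρ : 0 < ρ)
    (hsep : ∀ i ∈ s, ∀ j ∈ s, i ≠ j → ρ ≤ |f i - f j|) : Set.InjOn f s := by
  intro i hi j hj hij
  by_contra hne
  have := hsep i hi j hj hne
  rw [hij] at this; simp at this; linarith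

theorem one_le_rank {i : ι} (hi : i ∈ s) : 1 ≤ (s.filter fun j => f j ≤ f i).card :=
  Finset.card_pos.2 ⟨i, by simp [hi]⟩

theorem sum_Icc_inv_le (m : ℕ) : ∑ r ∈ Finset.Icc 1 m, (1 : ℝ) / r ≤ 1 + Real.log m := by
  have := harmonic_le_one_add_log m
  rw [harmonic_eq_sum_Icc] at this
  push_cast at this
  simpa [one_div] using this

theorem sum_Icc_inv_sq_le (m : ℕ) : ∑ r ∈ Finset.Icc 1 m, (1 : ℝ) / (r : ℝ) ^ 2 ≤ 2 := by
  rcases m with _ | m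
  · simp
  have key : ∑ r ∈ Finset.Icc 1 (m + 1), (1 : ℝ) / (r : ℝ) ^ 2 ≤ 2 - 1 / (m + 1) := by
    induction m with
    | zero => norm_num
    | succ k ih =>
      rw [Finset.sum_Icc_succ_top (by omega)]
      have hk : (0 : ℝ) ≤ k := Nat.cast_nonneg k
      push_cast
      have : (1 : ℝ) / (k + 1 + 1) ^ 2 ≤ 1 / (k + 1) - 1 / (k + 1 + 1) := by
        rw [div_sub_div _ _ (by positivity) (by positivity),
          div_le_div_iff₀ (by positivity) (by positivity)]
        nlinarith
      linarith
  refine key.trans ?_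
  have : (0 : ℝ) ≤ 1 / (m + 1) := by positivity
  linarith

theorem sum_inv_le_of_separated {ρ : ℝ} (hρ : 0 < ρ) (hf : ∀ i ∈ s, ρ ≤ f i)
    (hsep : ∀ i ∈ s, ∀ j ∈ s, i ≠ j → ρ ≤ |f i - f j|) :
    ∑ i ∈ s, 1 / f i ≤ 1 / ρ * (1 + Real.log s.card) := by
  classical
  calc ∑ i ∈ s, 1 / f i
      ≤ ∑ i ∈ s, 1 / ρ * (1 / ((s.filter fun j => f j ≤ f i).card : ℝ)) := by
        refine Finset.sum_le_sum fun i hi => ?_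
        rw [div_mul_div_comm, one_mul, mul_comm ρ]
        have : (0 : ℝ) < (s.filter fun j => f j ≤ f i).card := by exact_mod_cast one_le_rank hi
        exact one_div_le_one_div_of_le (by positivity) (rank_mul_le hρ hf hsep hi)
    _ = ∑ r ∈ Finset.Icc 1 s.card, 1 / ρ * (1 / (r : ℝ)) :=
        sum_rank (injOn_of_separated hρ hsep) fun r => 1 / ρ * (1 / (r : ℝ))
    _ ≤ _ := by
        rw [← Finset.mul_sum]
        exact mul_le_mul_of_nonneg_left (sum_Icc_inv_le _) (by positivity)

theorem sum_inv_sq_le_of_separated {ρ : ℝ} (hρ : 0 < ρ) (hf : ∀ i ∈ s, ρ ≤ f i)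
    (hsep : ∀ i ∈ s, ∀ j ∈ s, i ≠ j → ρ ≤ |f i - f j|) :
    ∑ i ∈ s, 1 / f i ^ 2 ≤ 2 / ρ ^ 2 := by
  classical
  calc ∑ i ∈ s, 1 / f i ^ 2
      ≤ ∑ i ∈ s, 1 / ρ ^ 2 * (1 / ((s.filter fun j => f j ≤ f i).card : ℝ) ^ 2) := by
        refine Finset.sum_le_sum fun i hi => ?_
        rw [div_mul_div_comm, one_mul, ← mul_pow, mul_comm ρ]
        have : (0 : ℝ) < (s.filter fun j => f j ≤ f i).card := by exact_mod_cast one_le_rank hi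
        exact one_div_le_one_div_of_le (by positivity)
          (pow_le_pow_left₀ (by positivity) (rank_mul_le hρ hf hsep hi) 2)
    _ = ∑ r ∈ Finset.Icc 1 s.card, 1 / ρ ^ 2 * (1 / (r : ℝ) ^ 2) :=
        sum_rank (injOn_of_separated hρ hsep) fun r => 1 / ρ ^ 2 * (1 / (r : ℝ) ^ 2)
    _ ≤ _ := by
        rw [← Finset.mul_sum]
        calc _ ≤ 1 / ρ ^ 2 * 2 := mul_le_mul_of_nonneg_left (sum_Icc_inv_sq_le _) (by positivity)
          _ = _ := by ring

/-- The counting bound says nothing about the first `E` ranks, where only separation is available;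
they cost `log E / ρ`. Beyond them `f` is at least `(rank - E) / A`. The point is that the large
factor `1 / ρ` meets `log E` and not `log s.card`. -/
theorem sum_inv_le_of_rank_le {ρ A : ℝ} {E : ℕ} (hρ : 0 < ρ) (hA : 0 < A)
    (hf : ∀ i ∈ s, ρ ≤ f i) (hsep : ∀ i ∈ s, ∀ j ∈ s, i ≠ j → ρ ≤ |f i - f j|)
    (hrank : ∀ i ∈ s, ((s.filter fun j => f j ≤ f i).card : ℝ) ≤ A * f i + E) :
    ∑ i ∈ s, 1 / f i ≤ 1 / ρ * (1 + Real.log E) + A * (1 + Real.log s.card) := by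
  classical
  set F : ℕ → ℝ := fun r => if r ≤ E then 1 / ρ * (1 / (r : ℝ)) else A * (1 / ((r - E : ℕ) : ℝ))
    with hF
  calc ∑ i ∈ s, 1 / f i
      ≤ ∑ i ∈ s, F (s.filter fun j => f j ≤ f i).card := by
        refine Finset.sum_le_sum fun i hi => ?_
        simp only [hF]
        split_ifs with h
        · rw [div_mul_div_comm, one_mul, mul_comm ρ]
          have : (0 : ℝ) < (s.filter fun j => f j ≤ f i).card := by exact_mod_cast one_le_rank hi
          exact one_div_le_one_div_of_le (by positivity) (rank_mul_le hρ hf hsep hi)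
        · push Not at h
          have h1 := hrank i hi
          have h2 : (0 : ℝ) < ((s.filter fun j => f j ≤ f i).card - E : ℕ) := by
            exact_mod_cast Nat.sub_pos_of_lt h
          rw [mul_one_div, div_le_div_iff₀ (hρ.trans_le (hf i hi)) h2, Nat.cast_sub h.le]
          linarith
    _ = ∑ r ∈ Finset.Icc 1 s.card, F r := sum_rank (injOn_of_separated hρ hsep) F
    _ = ∑ r ∈ (Finset.Icc 1 s.card).filter (· ≤ E), 1 / ρ * (1 / (r : ℝ))
        + ∑ r ∈ (Finset.Icc 1 s.card).filter (¬ · ≤ E), A * (1 / ((r - E : ℕ) : ℝ)) := by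
        rw [← Finset.sum_filter_add_sum_filter_not (Finset.Icc 1 s.card) (· ≤ E)]
        congr 1
        · exact Finset.sum_congr rfl fun r hr => by simp [hF, (Finset.mem_filter.1 hr).2]
        · refine Finset.sum_congr rfl fun r hr => ?_
          simp only [hF]
          rw [if_neg (Finset.mem_filter.1 hr).2]
    _ ≤ ∑ r ∈ Finset.Icc 1 E, 1 / ρ * (1 / (r : ℝ))
        + ∑ r ∈ Finset.Icc 1 s.card, A * (1 / (r : ℝ)) := by
        refine add_le_add ?_ ?_
        · refine Finset.sum_le_sum_of_subset_of_nonneg ?_ fun _ _ _ => by positivity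
          intro r hr
          simp only [Finset.mem_filter, Finset.mem_Icc] at hr ⊢
          omega
        · rw [← Finset.sum_image (s := (Finset.Icc 1 s.card).filter (¬ · ≤ E))
            (g := fun r => r - E) (f := fun r : ℕ => A * (1 / (r : ℝ)))]
          · refine Finset.sum_le_sum_of_subset_of_nonneg ?_ fun _ _ _ => by positivity
            intro r hr
            simp only [Finset.mem_image, Finset.mem_filter, Finset.mem_Icc] at hr ⊢
            omega
          · intro r hr r' hr' h
            simp only [Finset.coe_filter, Finset.mem_Icc, Set.mem_ofPred_eq] at hr hr' h
            omega
    _ ≤ _ := by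
        rw [← Finset.mul_sum, ← Finset.mul_sum]
        refine add_le_add ?_ ?_
        · exact mul_le_mul_of_nonneg_left (sum_Icc_inv_le _) (by positivity)
        · exact mul_le_mul_of_nonneg_left (sum_Icc_inv_le _) hA.le

theorem log_le_sum_Icc_inv {E : ℝ} (hE : 0 ≤ E) (m : ℕ) :
    Real.log ((m + 1 + E) / (1 + E)) ≤ ∑ r ∈ Finset.Icc 1 m, 1 / (r + E) := by
  induction m with
  | zero => simp [div_self (by positivity : (1 + E) ≠ 0)]
  | succ m ih =>
    rw [Finset.sum_Icc_succ_top (by omega)]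
    have hm : (0 : ℝ) ≤ m := Nat.cast_nonneg m
    have h1 := Real.log_le_sub_one_of_pos (x := (m + 1 + 1 + E) / (m + 1 + E)) (by positivity)
    have h2 : (m + 1 + 1 + E) / (m + 1 + E) - 1 = 1 / (m + 1 + E) := by field_simp; ring
    have h3 : Real.log ((m + 1 + 1 + E) / (1 + E)) = Real.log ((m + 1 + E) / (1 + E)) +
        Real.log ((m + 1 + 1 + E) / (m + 1 + E)) := by
      rw [← Real.log_mul (by positivity) (by positivity)]
      congr 1; field_simp
    push_cast
    rw [h3]; linarith

/-- The counting bound gives `1 / f i ≥ A / (rank + E)`. No separation is needed, since small values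
only help. -/
theorem le_sum_inv_of_le_rank {A E : ℝ} (hA : 0 < A) (hE : 0 ≤ E) (hf : ∀ i ∈ s, 0 < f i)
    (hinj : Set.InjOn f s)
    (hrank : ∀ i ∈ s, A * f i - E ≤ ((s.filter fun j => f j ≤ f i).card : ℝ)) :
    A * Real.log ((s.card + 1 + E) / (1 + E)) ≤ ∑ i ∈ s, 1 / f i := by
  classical
  calc A * Real.log ((s.card + 1 + E) / (1 + E))
      ≤ A * ∑ r ∈ Finset.Icc 1 s.card, 1 / (r + E) :=
        mul_le_mul_of_nonneg_left (log_le_sum_Icc_inv hE _) hA.le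
    _ = ∑ r ∈ Finset.Icc 1 s.card, A * (1 / (r + E)) := Finset.mul_sum _ _ _
    _ = ∑ i ∈ s, A * (1 / ((s.filter fun j => f j ≤ f i).card + E)) :=
        (sum_rank hinj fun r => A * (1 / (r + E))).symm
    _ ≤ _ := by
        refine Finset.sum_le_sum fun i hi => ?_
        have h1 := hrank i hi
        have h2 : (0 : ℝ) < (s.filter fun j => f j ≤ f i).card := by exact_mod_cast one_le_rank hi
        rw [mul_one_div, div_le_div_iff₀ (by positivity) (hf i hi)]
        linarith

end Rank

/-! ### Equidistribution of an orbit over blocks of length `q` -/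

section Count

/-- The numerator of the position, to precision `1 / q`, of the `i`-th point of an orbit. -/
def residue (q : ℕ) (p n₀ : ℤ) (i : ℕ) : ℕ := ((n₀ + i * p) % q).toNat

theorem residue_cast {q : ℕ} (hq : 0 < q) (p n₀ : ℤ) (i : ℕ) :
    (residue q p n₀ i : ℤ) = (n₀ + i * p) % q :=
  Int.toNat_of_nonneg (Int.emod_nonneg _ (by exact_mod_cast hq.ne'))

theorem residue_lt {q : ℕ} (hq : 0 < q) (p n₀ : ℤ) (i : ℕ) : residue q p n₀ i < q := by
  have := Int.emod_lt_of_pos (n₀ + i * p) (by exact_mod_cast hq : (0 : ℤ) < q)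
  rw [← residue_cast hq] at this
  exact_mod_cast this

theorem residue_injOn {q : ℕ} (hq : 0 < q) {p : ℤ} (hp : IsCoprime (q : ℤ) p) (n₀ : ℤ) :
    Set.InjOn (residue q p n₀) (Finset.range q) := by
  intro i hi j hj hij
  have h1 : (n₀ + i * p) % q = (n₀ + j * p) % q := by
    rw [← residue_cast hq, ← residue_cast hq, hij]
  have h2 : (q : ℤ) ∣ (j - i) * p := by
    have := Int.ModEq.dvd (show n₀ + i * p ≡ n₀ + j * p [ZMOD q] from h1)
    have e : n₀ + j * p - (n₀ + i * p) = (j - i) * p := by ring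
    rwa [e] at this
  have h3 := hp.dvd_of_dvd_mul_right h2
  simp only [Finset.coe_range, Set.mem_Iio] at hi hj
  have h4 : (j - i : ℤ) = 0 := Int.eq_zero_of_abs_lt_dvd h3 (by rw [abs_lt]; omega)
  omega

theorem image_residue {q : ℕ} (hq : 0 < q) {p : ℤ} (hp : IsCoprime (q : ℤ) p) (n₀ : ℤ) :
    (Finset.range q).image (residue q p n₀) = Finset.range q := by
  refine Finset.eq_of_subset_of_card_le ?_ ?_
  · intro r hr
    obtain ⟨i, -, rfl⟩ := Finset.mem_image.1 hr
    exact Finset.mem_range.2 (residue_lt hq p n₀ i)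
  · rw [Finset.card_image_of_injOn (residue_injOn hq hp n₀)]

/-- For `i < q` the drift `i * (q * α - p)` is less than `1` in absolute value, and rounding `x * q`
down loses less than `1`. The conditions on the residue exclude a wrap around `0`. -/
theorem fract_near_residue {α : ℝ} {q : ℕ} {p : ℤ} (hq : 0 < q) (hα : |q * α - p| ≤ 1 / q)
    (x : ℝ) {i : ℕ} (hi : i < q) (h1 : 1 ≤ residue q p ⌊x * q⌋ i)
    (h2 : residue q p ⌊x * q⌋ i + 2 ≤ q) :
    residue q p ⌊x * q⌋ i - 1 < q * Int.fract (x + i * α) ∧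
      q * Int.fract (x + i * α) < residue q p ⌊x * q⌋ i + 2 := by
  set v := residue q p ⌊x * q⌋ i with hv
  have hq0 : (0 : ℝ) < q := by exact_mod_cast hq
  set d : ℤ := (⌊x * q⌋ + i * p) / q with hd
  have hvd : (⌊x * q⌋ + i * p : ℝ) = q * d + v := by
    have := Int.mul_ediv_add_emod (⌊x * q⌋ + i * p) q
    rw [← residue_cast hq, ← hv, ← hd] at this
    exact_mod_cast this.symm
  have hdev : |i * (q * α - p)| < 1 := by
    rw [abs_mul, Nat.abs_cast]
    have hi' : (i : ℝ) < q := by exact_mod_cast hi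
    rw [le_div_iff₀ hq0] at hα
    nlinarith [abs_nonneg (q * α - p)]
  rw [abs_lt] at hdev
  have hfl := Int.floor_le (x * q)
  have hfl' := Int.lt_floor_add_one (x * q)
  have e : q * (x + i * α - d) = v + (x * q - ⌊x * q⌋) + i * (q * α - p) := by
    linear_combination hvd
  have h1' : (1 : ℝ) ≤ v := by exact_mod_cast h1
  have h2' : (v : ℝ) + 2 ≤ q := by exact_mod_cast h2
  have hfr : Int.fract (x + i * α) = x + i * α - d := by
    rw [Int.fract_eq_iff]
    refine ⟨?_, ?_, d, by ring⟩
    · by_contra hc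
      push Not at hc
      nlinarith
    · by_contra hc
      push Not at hc
      nlinarith
  rw [hfr, e]
  constructor <;> linarith

theorem count_block_le {α : ℝ} {q : ℕ} {p : ℤ} (hq : 0 < q) (hp : IsCoprime (q : ℤ) p)
    (hα : |q * α - p| ≤ 1 / q) (x : ℝ) {t : ℝ} (ht : 0 ≤ t) :
    (Nat.count (fun i => Int.fract (x + i * α) ≤ t) q : ℝ) ≤ q * t + 4 := by
  classical
  rw [Nat.count_eq_card_filter_range]
  have hq0 : (0 : ℝ) < q := by exact_mod_cast hq
  -- Coprimality makes the residues distinct. The residues `0` and `q - 1`, where the position may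
  -- wrap around, are counted unconditionally.
  have hcard : ((Finset.range q).filter fun i : ℕ => Int.fract (x + i * α) ≤ t).card ≤
      (insert 0 (insert (q - 1) (Finset.Icc 1 ⌊q * t + 1⌋₊))).card := by
    refine Finset.card_le_card_of_injOn (residue q p ⌊x * q⌋) ?_ ?_
    · intro i hi
      simp only [Finset.coe_filter, Set.mem_ofPred_eq, Finset.mem_range] at hi
      simp only [Finset.coe_insert, Finset.coe_Icc, Set.mem_insert_iff, Set.mem_Icc]
      by_cases h1 : residue q p ⌊x * q⌋ i = 0
      · exact Or.inl h1
      by_cases h2 : residue q p ⌊x * q⌋ i = q - 1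
      · exact Or.inr (Or.inl h2)
      right; right
      have h3 := residue_lt hq p ⌊x * q⌋ i
      refine ⟨by omega, Nat.le_floor ?_⟩
      have h4 := (fract_near_residue hq hα x hi.1 (by omega) (by omega)).1
      nlinarith [hi.2]
    · refine (residue_injOn hq hp _).mono ?_
      intro i hi
      simp only [Finset.coe_filter, Set.mem_ofPred_eq] at hi
      exact_mod_cast hi.1
  have h5 : (insert 0 (insert (q - 1) (Finset.Icc 1 ⌊q * t + 1⌋₊))).card ≤ ⌊q * t + 1⌋₊ + 2 := by
    refine (Finset.card_insert_le _ _).trans ?_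
    have := Finset.card_insert_le (q - 1) (Finset.Icc 1 ⌊q * t + 1⌋₊)
    simp only [Nat.card_Icc] at this
    omega
  have h6 : (((Finset.range q).filter fun i : ℕ => Int.fract (x + i * α) ≤ t).card : ℝ) ≤
      ⌊q * t + 1⌋₊ + 2 := by exact_mod_cast hcard.trans h5
  have h7 := Nat.floor_le (by positivity : 0 ≤ q * t + 1)
  linarith

theorem le_count_block {α : ℝ} {q : ℕ} {p : ℤ} (hq : 0 < q) (hp : IsCoprime (q : ℤ) p)
    (hα : |q * α - p| ≤ 1 / q) (x : ℝ) {t : ℝ} (ht0 : 0 ≤ t) (ht : t ≤ 1) :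
    q * t - 4 ≤ (Nat.count (fun i => Int.fract (x + i * α) < t) q : ℝ) := by
  classical
  rw [Nat.count_eq_card_filter_range]
  have hq0 : (0 : ℝ) < q := by exact_mod_cast hq
  have hfl := Nat.floor_le (by positivity : 0 ≤ q * t)
  have hfl' := Nat.lt_floor_add_one (q * t)
  have hfq : ⌊q * t⌋₊ ≤ q := by
    have : (⌊q * t⌋₊ : ℝ) ≤ q := by nlinarith
    exact_mod_cast this
  have hsub : Finset.Icc 1 (⌊q * t⌋₊ - 2) ⊆
      ((Finset.range q).filter fun i : ℕ => Int.fract (x + i * α) < t).image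
        (residue q p ⌊x * q⌋) := by
    intro v hv
    rw [Finset.mem_Icc] at hv
    have hvq : v ∈ (Finset.range q).image (residue q p ⌊x * q⌋) := by
      rw [image_residue hq hp]; exact Finset.mem_range.2 (by omega)
    obtain ⟨i, hi, rfl⟩ := Finset.mem_image.1 hvq
    refine Finset.mem_image.2 ⟨i, Finset.mem_filter.2 ⟨hi, ?_⟩, rfl⟩
    have h4 := (fract_near_residue hq hα x (Finset.mem_range.1 hi) hv.1 (by omega)).2
    have h5 : (residue q p ⌊x * q⌋ i : ℝ) + 2 ≤ ⌊q * t⌋₊ := by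
      have : residue q p ⌊x * q⌋ i + 2 ≤ ⌊q * t⌋₊ := by omega
      exact_mod_cast this
    by_contra hc
    push Not at hc
    nlinarith
  have h6 := (Finset.card_le_card hsub).trans Finset.card_image_le
  rw [Nat.card_Icc] at h6
  have h7 : ⌊q * t⌋₊ ≤
      ((Finset.range q).filter fun i : ℕ => Int.fract (x + i * α) < t).card + 2 := by omega
  have h8 : (⌊q * t⌋₊ : ℝ) ≤
      ((Finset.range q).filter fun i : ℕ => Int.fract (x + i * α) < t).card + 2 := by
    exact_mod_cast h7
  linarith

theorem count_mul_le {α : ℝ} {q : ℕ} {p : ℤ} (hq : 0 < q) (hp : IsCoprime (q : ℤ) p)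
    (hα : |q * α - p| ≤ 1 / q) (x : ℝ) {t : ℝ} (ht : 0 ≤ t) (b : ℕ) :
    (Nat.count (fun i => Int.fract (x + i * α) ≤ t) (b * q) : ℝ) ≤ b * (q * t + 4) := by
  induction b with
  | zero => simp
  | succ b ih =>
    rw [Nat.succ_mul, Nat.count_add]
    have := count_block_le hq hp hα (x + (b * q : ℕ) * α) ht
    have e : ∀ k : ℕ, x + ((b * q + k : ℕ) : ℝ) * α = x + (b * q : ℕ) * α + k * α := by
      intro k; push_cast; ring
    simp only [e]
    push_cast at *
    linarith

theorem mul_le_count {α : ℝ} {q : ℕ} {p : ℤ} (hq : 0 < q) (hp : IsCoprime (q : ℤ) p)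
    (hα : |q * α - p| ≤ 1 / q) (x : ℝ) {t : ℝ} (ht0 : 0 ≤ t) (ht : t ≤ 1) (b : ℕ) :
    b * (q * t - 4) ≤ (Nat.count (fun i => Int.fract (x + i * α) < t) (b * q) : ℝ) := by
  induction b with
  | zero => simp
  | succ b ih =>
    rw [Nat.succ_mul, Nat.count_add]
    have := le_count_block hq hp hα (x + (b * q : ℕ) * α) ht0 ht
    have e : ∀ k : ℕ, x + ((b * q + k : ℕ) : ℝ) * α = x + (b * q : ℕ) * α + k * α := by
      intro k; push_cast; ring
    simp only [e]
    push_cast at *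
    linarith

/-- The orbit is covered by `N / q + 1` blocks of length `q`, each contributing an error of at most
`4`. This total error plays the role of `E` in `sum_inv_le_of_rank_le`. -/
theorem card_orbit_le {α : ℝ} {q : ℕ} {p : ℤ} (hq : 0 < q) (hp : IsCoprime (q : ℤ) p)
    (hα : |q * α - p| ≤ 1 / q) (x : ℝ) {t : ℝ} (ht : 0 ≤ t) (N : ℕ) :
    (((Finset.range N).filter fun i : ℕ => Int.fract (x + i * α) ≤ t).card : ℝ) ≤
      (N + q) * t + (4 * (N / q + 1) : ℕ) := by
  rw [← Nat.count_eq_card_filter_range]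
  have h1 : N ≤ (N / q + 1) * q := by
    have := Nat.lt_div_mul_add hq (a := N); linarith
  have h2 : (Nat.count (fun i : ℕ => Int.fract (x + i * α) ≤ t) N : ℝ) ≤
    Nat.count (fun i : ℕ => Int.fract (x + i * α) ≤ t) ((N / q + 1) * q) := by
    exact_mod_cast Nat.count_monotone _ h1
  have h3 := count_mul_le hq hp hα x ht (N / q + 1)
  have h4 : ((N / q : ℕ) * q : ℝ) ≤ N := by exact_mod_cast Nat.div_mul_le_self N q
  push_cast at *
  nlinarith

theorem le_card_orbit {α : ℝ} {q : ℕ} {p : ℤ} (hq : 0 < q) (hp : IsCoprime (q : ℤ) p)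
    (hα : |q * α - p| ≤ 1 / q) (x : ℝ) {t : ℝ} (ht0 : 0 ≤ t) (ht : t ≤ 1) (N : ℕ) :
    (N - q) * t - (4 * (N / q + 1) : ℕ) ≤
      (((Finset.range N).filter fun i : ℕ => Int.fract (x + i * α) < t).card : ℝ) := by
  rw [← Nat.count_eq_card_filter_range]
  have h1 : (N : ℝ) ≤ (N / q : ℕ) * q + q := by
    exact_mod_cast (Nat.lt_div_mul_add hq (a := N)).le
  have h2 : (Nat.count (fun i : ℕ => Int.fract (x + i * α) < t) (N / q * q) : ℝ) ≤
    Nat.count (fun i : ℕ => Int.fract (x + i * α) < t) N := by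
    exact_mod_cast Nat.count_monotone _ (Nat.div_mul_le_self N q)
  have h3 := mul_le_count hq hp hα x ht0 ht (N / q)
  push_cast at *
  nlinarith

end Count

/-! ### Distance on the circle and fractional parts -/

section CircleNorm

theorem norm_coe_circle_eq_min (t : ℝ) :
    ‖(t : UnitAddCircle)‖ = min (Int.fract t) (1 - Int.fract t) := by
  rw [UnitAddCircle.norm_eq, abs_sub_round_eq_min]

theorem norm_coe_circle_le_fract (t : ℝ) : ‖(t : UnitAddCircle)‖ ≤ Int.fract t := by
  rw [norm_coe_circle_eq_min]; exact min_le_left _ _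

theorem norm_coe_circle_le_one_sub_fract (t : ℝ) : ‖(t : UnitAddCircle)‖ ≤ 1 - Int.fract t := by
  rw [norm_coe_circle_eq_min]; exact min_le_right _ _

theorem norm_coe_circle_le_abs_sub (t : ℝ) (m : ℤ) : ‖(t : UnitAddCircle)‖ ≤ |t - m| := by
  rw [UnitAddCircle.norm_eq]; exact round_le t m

theorem norm_coe_circle_le_abs_fract_sub (t u : ℝ) :
    ‖((t - u : ℝ) : UnitAddCircle)‖ ≤ |Int.fract t - Int.fract u| := by
  have := norm_coe_circle_le_abs_sub (t - u) (⌊t⌋ - ⌊u⌋)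
  have e : t - u - ((⌊t⌋ - ⌊u⌋ : ℤ) : ℝ) = Int.fract t - Int.fract u := by
    push_cast; simp only [Int.fract]; ring
  rwa [e] at this

theorem norm_coe_circle_neg (t : ℝ) : ‖((-t : ℝ) : UnitAddCircle)‖ = ‖(t : UnitAddCircle)‖ := by
  rw [AddCircle.coe_neg, norm_neg]

theorem fract_neg_of_norm_pos {t : ℝ} (h : 0 < ‖(t : UnitAddCircle)‖) :
    Int.fract (-t) = 1 - Int.fract t :=
  Int.fract_neg (h.trans_le (norm_coe_circle_le_fract t)).ne'

theorem separated_fract {α ρ : ℝ} {N : ℕ} (x : ℝ)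
    (hsep : ∀ i : ℕ, 0 < i → i < N → ρ ≤ ‖((i * α : ℝ) : UnitAddCircle)‖) {i j : ℕ} (hi : i < N)
    (hj : j < N) (hij : i ≠ j) :
    ρ ≤ |Int.fract (x + i * α) - Int.fract (x + j * α)| := by
  have key : ∀ i j : ℕ, i < j → j < N →
      ρ ≤ |Int.fract (x + i * α) - Int.fract (x + j * α)| := by
    intro i j hij hj
    rw [abs_sub_comm]
    refine (hsep (j - i) (by omega) (by omega)).trans ?_
    refine le_trans (le_of_eq ?_) (norm_coe_circle_le_abs_fract_sub _ _)
    rw [Nat.cast_sub hij.le]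
    congr 2; ring
  rcases lt_or_gt_of_ne hij with h | h
  · exact key i j h hj
  · rw [abs_sub_comm]; exact key j i h hi

end CircleNorm

/-! ### One-sided reciprocal sums along an orbit -/

section OneSided

variable {α ρ : ℝ} {q N : ℕ} {p : ℤ}

theorem sum_inv_fract_le (hq : 0 < q) (hp : IsCoprime (q : ℤ) p) (hα : |q * α - p| ≤ 1 / q)
    (hN : 0 < N) (hρ : 0 < ρ) (hsep : ∀ i : ℕ, 0 < i → i < N → ρ ≤ ‖((i * α : ℝ) : UnitAddCircle)‖)
    {x : ℝ} (hx : ∀ i : ℕ, i < N → ρ ≤ ‖((x + i * α : ℝ) : UnitAddCircle)‖) :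
    ∑ i ∈ Finset.range N, 1 / Int.fract (x + i * α) ≤
      1 / ρ * (1 + Real.log (4 * (N / q + 1) : ℕ)) + (N + q) * (1 + Real.log N) := by
  have := sum_inv_le_of_rank_le (s := Finset.range N) (f := fun i : ℕ => Int.fract (x + i * α))
    (A := N + q) (E := 4 * (N / q + 1)) hρ (by positivity)
    (fun i hi => (hx i (Finset.mem_range.1 hi)).trans (norm_coe_circle_le_fract _))
    (fun i hi j hj hij =>
      separated_fract x hsep (Finset.mem_range.1 hi) (Finset.mem_range.1 hj) hij)
    (fun i hi => card_orbit_le hq hp hα x (Int.fract_nonneg _) N)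
  simpa using this

theorem le_sum_inv_fract (hq : 0 < q) (hp : IsCoprime (q : ℤ) p) (hα : |q * α - p| ≤ 1 / q)
    (hqN : q < N) (hρ : 0 < ρ)
    (hsep : ∀ i : ℕ, 0 < i → i < N → ρ ≤ ‖((i * α : ℝ) : UnitAddCircle)‖)
    {x : ℝ} (hx : ∀ i : ℕ, i < N → ρ ≤ ‖((x + i * α : ℝ) : UnitAddCircle)‖)
    {δ : ℝ} (hδ : 0 < δ) (hδ1 : δ ≤ 1) :
    (N - q) * Real.log ((N - q) * δ / (1 + (4 * (N / q + 1) : ℕ))) ≤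
      ∑ i ∈ (Finset.range N).filter (fun i : ℕ => Int.fract (x + i * α) < δ),
        1 / Int.fract (x + i * α) := by
  classical
  have hNq : (0 : ℝ) < N - q := by
    have : (q : ℝ) < N := by exact_mod_cast hqN
    linarith
  set E : ℝ := ((4 * (N / q + 1) : ℕ) : ℝ) with hE
  set s := (Finset.range N).filter (fun i : ℕ => Int.fract (x + i * α) < δ) with hs
  have hcard := le_card_orbit hq hp hα x hδ.le hδ1 N
  rw [← hs, ← hE] at hcard
  have hE0 : 0 ≤ E := Nat.cast_nonneg _
  have := le_sum_inv_of_le_rank (s := s) (f := fun i : ℕ => Int.fract (x + i * α)) (E := E) hNq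
    hE0
    (fun i hi => (hρ.trans_le (hx i (Finset.mem_range.1 (Finset.mem_filter.1 hi).1))).trans_le
      (norm_coe_circle_le_fract _))
    (fun i hi j hj hij => by
      by_contra hne
      rw [hs, Finset.coe_filter] at hi hj
      have := separated_fract x hsep (Finset.mem_range.1 hi.1) (Finset.mem_range.1 hj.1) hne
      simp only at hij
      rw [hij, sub_self, abs_zero] at this
      linarith)
    (fun i hi => by
      have h1 := le_card_orbit hq hp hα x (Int.fract_nonneg (x + i * α)) (Int.fract_lt_one _).le N
      refine h1.trans ?_
      -- Discarding the points beyond `δ` does not change the ranks of those that remain, so the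
      -- count over the whole orbit applies.
      have hsub : (Finset.range N).filter
          (fun j : ℕ => Int.fract (x + j * α) < Int.fract (x + i * α)) ⊆
          s.filter fun j : ℕ => Int.fract (x + j * α) ≤ Int.fract (x + i * α) := by
        intro j hj
        have hi2 := (Finset.mem_filter.1 hi).2
        simp only [hs, Finset.mem_filter] at hj ⊢
        exact ⟨⟨hj.1, hj.2.trans hi2⟩, hj.2.le⟩
      exact_mod_cast Finset.card_le_card hsub)
  refine le_trans (mul_le_mul_of_nonneg_left ?_ hNq.le) this
  refine Real.log_le_log (by positivity) (div_le_div_of_nonneg_right ?_ (by positivity))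
  linarith

end OneSided

/-! ### Scales between consecutive denominators -/

section Asymptotics

variable {α : ℝ} {a : ℕ → ℝ} {Q : ℕ → ℕ} {P : ℕ → ℤ}

theorem tendsto_log_log : Tendsto (fun x : ℝ => Real.log (Real.log x)) atTop atTop :=
  Real.tendsto_log_atTop.comp Real.tendsto_log_atTop

theorem IsConvergentSeq.tendsto (h : IsConvergentSeq α a Q P) :
    Tendsto (fun m => (Q m : ℝ)) atTop atTop := by
  refine tendsto_atTop.2 fun b => ?_
  obtain ⟨m, -, hm⟩ := h.exists_le_lt (x := max b (Q 0)) (le_max_right _ _)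
  filter_upwards [eventually_ge_atTop (m + 1)] with k hk
  have : (Q (m + 1) : ℝ) ≤ Q k := by exact_mod_cast h.monotone hk
  exact ((le_max_left _ _).trans hm.le).trans this

/-- Consecutive denominators have ratio at most `a (m + 1) + 1`, and the digits are `o(log log)`.
Any scale `X` therefore has a denominator within a factor `log log X + 1` below it. -/
theorem IsConvergentSeq.eventually_exists (h : IsConvergentSeq α a Q P)
    (ha : (fun m => a (m + 1)) =o[atTop] fun m => Real.log (Real.log (Q m))) :
    ∀ᶠ X : ℝ in atTop, ∃ m, Q m ≤ X ∧ X < Q (m + 1) ∧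
      (Q (m + 1) : ℝ) ≤ (Real.log (Real.log X) + 1) * Q m := by
  have h1 := ha.bound (c := 1) one_pos
  have h2 := h.tendsto.eventually (tendsto_log_log.eventually_ge_atTop 0)
  have h3 := h.tendsto.eventually (Real.tendsto_log_atTop.eventually_gt_atTop 0)
  obtain ⟨K, hK⟩ := eventually_atTop.1 (h1.and (h2.and h3))
  filter_upwards [eventually_ge_atTop (Q K : ℝ), eventually_ge_atTop (Q 0 : ℝ)] with X hXK hX0
  obtain ⟨m, hm1, hm2⟩ := h.exists_le_lt hX0
  have hKm : K ≤ m := by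
    by_contra hc
    have : Q (m + 1) ≤ Q K := h.monotone (by omega)
    have : (Q (m + 1) : ℝ) ≤ Q K := by exact_mod_cast this
    linarith
  obtain ⟨g1, g2, g3⟩ := hK m hKm
  refine ⟨m, hm1, hm2, (h.le_mul m).trans ?_⟩
  refine mul_le_mul_of_nonneg_right ?_ (h.cast_pos m).le
  rw [Real.norm_of_nonneg (zero_le_one.trans (h.one_le m)), Real.norm_of_nonneg g2, one_mul] at g1
  have g4 : Real.log (Real.log (Q m)) ≤ Real.log (Real.log X) :=
    Real.log_le_log g3 (Real.log_le_log (h.cast_pos m) hm1)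
  linarith

/-- The slowly growing function `(log M) ^ (1 / 8)`. -/
noncomputable def slow (M : ℝ) : ℝ := Real.log M ^ (1 / 8 : ℝ)

theorem eventually_log_le_rpow (C D : ℝ) {r e : ℝ} (hr : 0 < r) (he : 0 < e) :
    ∀ᶠ L : ℝ in atTop, C * Real.log L + D ≤ e * L ^ r := by
  have h1 := (isLittleO_log_rpow_atTop hr).const_mul_left C
  have h2 : (fun _ : ℝ => D) =o[atTop] fun L : ℝ => L ^ r :=
    isLittleO_const_left.2 (Or.inr (tendsto_norm_atTop_atTop.comp (tendsto_rpow_atTop hr)))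
  have h3 := (h1.add h2).bound he
  filter_upwards [h3, eventually_ge_atTop 0] with L hL hL0
  rw [Real.norm_of_nonneg (Real.rpow_nonneg hL0 r)] at hL
  exact (le_abs_self _).trans hL

/-- By best approximation the separation at times up to `3 * M` is of order at least `1 / (M log log
M)`, and `slow M` dominates `log log M`. The exponent `1 / 8` in `slow` is small enough for the
later bounds: `slow M ^ 2` stays below `(log M) ^ (1 / 3)`, and `slow M` below `√(log M)`. -/
theorem eventually_separated (h : IsConvergentSeq α a Q P)
    (ha : (fun m => a (m + 1)) =o[atTop] fun m => Real.log (Real.log (Q m))) :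
    ∀ᶠ M : ℝ in atTop, ∀ i : ℕ, 0 < i → (i : ℝ) ≤ 3 * M →
      1 / (M * slow M) ≤ ‖((i * α : ℝ) : UnitAddCircle)‖ := by
  have h1 := (tendsto_id.const_mul_atTop (by norm_num : (0 : ℝ) < 3)).eventually
    (h.eventually_exists ha)
  have h2 := Real.tendsto_log_atTop.eventually
    (eventually_log_le_rpow 6 12 (by norm_num : (0 : ℝ) < 1 / 8) one_pos)
  filter_upwards [h1, h2, eventually_ge_atTop 3] with M hM1 hM2 hM3 i hi hiM
  obtain ⟨m, hm1, hm2, hm3⟩ := hM1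
  simp only [id] at hm1 hm2 hm3
  have hM0 : 0 < M := by linarith
  have hL : 1 ≤ Real.log M := by
    rw [Real.le_log_iff_exp_le hM0]
    exact Real.exp_one_lt_three.le.trans hM3
  have hlog : Real.log (3 * M) ≤ 2 * Real.log M := by
    rw [Real.log_mul (by norm_num) hM0.ne']
    have := Real.log_le_log (by norm_num) hM3
    linarith
  have hloglog : Real.log (Real.log (3 * M)) ≤ 1 + Real.log (Real.log M) := by
    have hpos : 0 < Real.log (3 * M) := Real.log_pos (by linarith)
    refine (Real.log_le_log hpos hlog).trans ?_
    rw [Real.log_mul (by norm_num) (by linarith)]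
    have := Real.log_two_lt_d9
    linarith
  have hQ : (Q (m + 1) : ℝ) ≤ (Real.log (Real.log M) + 2) * (3 * M) := by
    have : 0 ≤ Real.log (Real.log M) := Real.log_nonneg hL
    refine (hm3.trans (mul_le_mul_of_nonneg_right (by linarith) (h.cast_pos m).le)).trans
      (mul_le_mul_of_nonneg_left hm1 (by linarith) :
        _ ≤ (Real.log (Real.log M) + 2) * (3 * M))
  have hbound : 1 / (M * slow M) ≤ |Q m * α - P m| := by
    refine le_trans ?_ (h.le_abs m)
    have := h.cast_pos (m + 1)
    refine one_div_le_one_div_of_le (by positivity) ?_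
    rw [slow]
    nlinarith
  refine hbound.trans ?_
  rw [UnitAddCircle.norm_eq]
  refine h.best_approx m hi ?_ _
  exact_mod_cast hiM.trans_lt hm2

end Asymptotics

/-! ### Each one-sided sum is asymptotically `N log N` -/

section OneSidedAsymptotics

variable {α : ℝ} {a : ℕ → ℝ} {Q : ℕ → ℕ} {P : ℕ → ℤ}

theorem oneSided_bounds {α M e : ℝ} {q N : ℕ} {p : ℤ} (hq : 0 < q) (hp : IsCoprime (q : ℤ) p)
    (hα : |q * α - p| ≤ 1 / q) (hM : 4 ≤ M) (hL : 16 ≤ Real.log M)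
    (hqM : q * √(Real.log M) ≤ M)
    (hE : ((4 * (N / q + 1) : ℕ) : ℝ) ≤ Real.log M)
    (h1 : slow M * (1 + Real.log (Real.log M)) + 2 + (1 + 2 * Real.log M) / √(Real.log M)
      ≤ e * Real.log M)
    (h2 : 2 * Real.log M / √(Real.log M) + 2 * (Real.log 2 + Real.log (1 + Real.log M))
      ≤ e * Real.log M)
    (hN1 : M / 2 ≤ N) (hN2 : N ≤ 2 * M)
    (hsep : ∀ i : ℕ, 0 < i → i < N → 1 / (M * slow M) ≤ ‖((i * α : ℝ) : UnitAddCircle)‖)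
    {x : ℝ} (hx : ∀ i : ℕ, i < N → 1 / (M * slow M) ≤ ‖((x + i * α : ℝ) : UnitAddCircle)‖) :
    ∑ i ∈ Finset.range N, 1 / Int.fract (x + i * α) ≤ N * Real.log N + e * (M * Real.log M) ∧
    ∀ δ : ℝ, 0 < δ → δ ≤ 1 →
      N * Real.log N - 2 * M * Real.log (1 / δ) - e * (M * Real.log M) ≤
        ∑ i ∈ (Finset.range N).filter (fun i : ℕ => Int.fract (x + i * α) < δ),
          1 / Int.fract (x + i * α) := by
  set L := Real.log M with hLdef
  have hM0 : 0 < M := by linarith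
  have hL0 : 0 < L := by linarith
  have hw : 0 < slow M := Real.rpow_pos_of_pos hL0 _
  have hρ : 0 < 1 / (M * slow M) := by positivity
  have hN0 : (0 : ℝ) < N := by linarith
  have hN : 0 < N := by exact_mod_cast hN0
  have hsq : 0 < √L := Real.sqrt_pos.2 hL0
  have hsq4 : 4 ≤ √L := Real.le_sqrt_of_sq_le (by linarith)
  have hq0 : (0 : ℝ) < q := by exact_mod_cast hq
  have hqM' : (q : ℝ) ≤ M / √L := by rwa [le_div_iff₀ hsq]
  have hqN2 : (q : ℝ) ≤ N / 2 := by nlinarith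
  have hqN : q < N := by
    have : (q : ℝ) < N := by linarith
    exact_mod_cast this
  have hlogN : Real.log N ≤ 2 * L := by
    have : Real.log N ≤ Real.log (M * M) := Real.log_le_log hN0 (by nlinarith)
    rw [Real.log_mul hM0.ne' hM0.ne'] at this
    linarith
  have hlogN0 : 0 ≤ Real.log N := Real.log_nonneg (by linarith)
  have hEpos : (0 : ℝ) < (4 * (N / q + 1) : ℕ) := by positivity
  constructor
  · refine (sum_inv_fract_le hq hp hα hN hρ hsep hx).trans ?_
    have hlogE : Real.log (4 * (N / q + 1) : ℕ) ≤ Real.log L := Real.log_le_log hEpos hE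
    rw [one_div_one_div]
    have e1 : M * slow M * (1 + Real.log (4 * (N / q + 1) : ℕ)) ≤
        M * slow M * (1 + Real.log L) :=
      mul_le_mul_of_nonneg_left (by linarith) (by positivity)
    have e2 : (q : ℝ) * (1 + Real.log N) ≤ M / √L * (1 + 2 * L) :=
      mul_le_mul hqM' (by linarith) (by linarith) (by positivity)
    have e3 : M / √L * (1 + 2 * L) = M * ((1 + 2 * L) / √L) := by ring
    have e4 := mul_le_mul_of_nonneg_left h1 hM0.le
    nlinarith
  · intro δ hδ hδ1
    refine le_trans ?_ (le_sum_inv_fract hq hp hα hqN hρ hsep hx hδ hδ1)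
    have hNq : (0 : ℝ) < N - q := by linarith
    have hlogδ : 0 ≤ Real.log (1 / δ) := Real.log_nonneg (by rw [le_div_iff₀ hδ]; linarith)
    set B := Real.log 2 + Real.log (1 / δ) + Real.log (1 + L) with hB
    have hlog2 : 0 < Real.log 2 := Real.log_pos (by norm_num)
    have hlogL : 0 ≤ Real.log (1 + L) := Real.log_nonneg (by linarith)
    have hlow : Real.log N - B ≤
        Real.log ((N - q) * δ / (1 + (4 * (N / q + 1) : ℕ))) := by
      have : Real.log N - B = Real.log (N / 2 * δ / (1 + L)) := by
        rw [Real.log_div (by positivity) (by positivity), Real.log_mul (by positivity) hδ.ne',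
          Real.log_div hN0.ne' (by norm_num), hB, one_div, Real.log_inv]
        ring
      rw [this]
      refine Real.log_le_log (by positivity) ?_
      refine div_le_div₀ (by positivity) ?_ (by positivity) (by linarith)
      exact mul_le_mul_of_nonneg_right (by linarith) hδ.le
    refine le_trans ?_ (mul_le_mul_of_nonneg_left hlow hNq.le)
    have e2 : (q : ℝ) * Real.log N ≤ M / √L * (2 * L) :=
      mul_le_mul hqM' hlogN hlogN0 (by positivity)
    have e3 : M / √L * (2 * L) = M * (2 * L / √L) := by ring
    have e4 := mul_le_mul_of_nonneg_left h2 hM0.le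
    have hB0 : 0 ≤ B := by positivity
    have e5 : (N - q : ℝ) * B ≤ 2 * M * B := mul_le_mul_of_nonneg_right (by linarith) hB0
    have e6 : 2 * M * B = 2 * M * Real.log (1 / δ) + M * (2 * (Real.log 2 + Real.log (1 + L))) := by
      rw [hB]; ring
    nlinarith

/-- Take the denominator `q` just below `M / √(log M)`. Then `q log N = o(M log M)`, while the
number of blocks is `O(√(log M) log log M)`, so that its logarithm times `M * slow M` is negligible
too. Points outside `[0, δ)` account for the loss of `2 * M * log (1 / δ)` in the lower bounds. -/
theorem eventually_oneSided (h : IsConvergentSeq α a Q P)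
    (ha : (fun m => a (m + 1)) =o[atTop] fun m => Real.log (Real.log (Q m))) {e : ℝ} (he : 0 < e) :
    ∀ᶠ M : ℝ in atTop, ∀ N : ℕ, M / 2 ≤ N → N ≤ 2 * M → ∀ x : ℝ,
      (∀ i : ℕ, i < N → 1 / (M * slow M) ≤ ‖((x + i * α : ℝ) : UnitAddCircle)‖) →
      (∑ i ∈ Finset.range N, 1 / Int.fract (x + i * α) ≤ N * Real.log N + e * (M * Real.log M) ∧
      ∀ δ : ℝ, 0 < δ → δ ≤ 1 →
        N * Real.log N - 2 * M * Real.log (1 / δ) - e * (M * Real.log M) ≤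
          ∑ i ∈ (Finset.range N).filter (fun i : ℕ => Int.fract (x + i * α) < δ),
            1 / Int.fract (x + i * α)) ∧
      (∑ i ∈ Finset.range N, 1 / (1 - Int.fract (x + i * α)) ≤
        N * Real.log N + e * (M * Real.log M) ∧
      ∀ δ : ℝ, 0 < δ → δ ≤ 1 →
        N * Real.log N - 2 * M * Real.log (1 / δ) - e * (M * Real.log M) ≤
          ∑ i ∈ (Finset.range N).filter (fun i : ℕ => 1 - Int.fract (x + i * α) < δ),
            1 / (1 - Int.fract (x + i * α))) := by
  have hX : Tendsto (fun M : ℝ => M / √(Real.log M)) atTop atTop := by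
    have h1 : Tendsto (fun M : ℝ => M ^ (1 / 2 : ℝ)) atTop atTop :=
      tendsto_rpow_atTop (by norm_num)
    refine tendsto_atTop_mono' _ ?_ h1
    filter_upwards [eventually_ge_atTop 3] with M hM
    have hM0 : 0 < M := by linarith
    have hL : 0 < Real.log M := Real.log_pos (by linarith)
    rw [← Real.sqrt_eq_rpow, le_div_iff₀ (Real.sqrt_pos.2 hL), ← Real.sqrt_mul hM0.le]
    refine Real.sqrt_le_iff.2 ⟨hM0.le, ?_⟩
    nlinarith [Real.log_le_self hM0.le]
  have t1 := hX.eventually (h.eventually_exists ha)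
  have t2 := eventually_separated h ha
  have hlog := Real.tendsto_log_atTop
  have l1 := eventually_log_le_rpow 8 12 (by norm_num : (0 : ℝ) < 1 / 2) one_pos
  have l2 := eventually_log_le_rpow 1 3 (by norm_num : (0 : ℝ) < 1 / 2) (half_pos he)
  have l3 := eventually_log_le_rpow 0 3 (by norm_num : (0 : ℝ) < 1 / 2) (half_pos he)
  have l4 := eventually_log_le_rpow 2 (4 * Real.log 2) (by norm_num : (0 : ℝ) < 1) (half_pos he)
  filter_upwards [t1, t2, hlog.eventually l1, hlog.eventually l2, hlog.eventually l3,
    hlog.eventually l4, hlog.eventually_ge_atTop 16, eventually_ge_atTop 4,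
    hX.eventually_ge_atTop 3] with M
    ⟨m, hm1, hm2, hm3⟩ hsep m1 m2 m3 m4 hL hM hX3 N hN1 hN2 x hx
  set L := Real.log M with hLdef
  have hM0 : 0 < M := by linarith
  have hL0 : 0 < L := by linarith
  rw [← Real.sqrt_eq_rpow] at m1 m2 m3
  rw [one_mul] at m1
  rw [Real.rpow_one] at m4
  have hsq : 0 < √L := Real.sqrt_pos.2 hL0
  have hss : √L * √L = L := Real.mul_self_sqrt hL0.le
  have hsq4 : 4 ≤ √L := Real.le_sqrt_of_sq_le (by linarith)
  have hq := h.pos m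
  have hq0 := h.cast_pos m
  have hlogL : 0 ≤ Real.log L := Real.log_nonneg (by linarith)
  have hloglog : Real.log (Real.log (M / √L)) ≤ Real.log L := by
    have : M / √L ≤ M := div_le_self hM0.le (by linarith)
    exact Real.log_le_log (Real.log_pos (by linarith)) (Real.log_le_log (by linarith) this)
  have hqM : Q m * √L ≤ M := by rwa [le_div_iff₀ hsq] at hm1
  have hqα : |Q m * α - P m| ≤ 1 / Q m :=
    (h.abs_le m).trans (one_div_le_one_div_of_le hq0 (by exact_mod_cast h.mono m))
  have hE : ((4 * (N / Q m + 1) : ℕ) : ℝ) ≤ L := by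
    have e1 : M / √L ≤ (Real.log L + 1) * Q m :=
      hm2.le.trans (hm3.trans (mul_le_mul_of_nonneg_right (by linarith) hq0.le))
    rw [div_le_iff₀ hsq] at e1
    have e2 : ((N / Q m : ℕ) : ℝ) ≤ N / Q m := Nat.cast_div_le
    have e3 : (N / Q m : ℝ) ≤ 2 * (Real.log L + 1) * √L := by
      rw [div_le_iff₀ hq0]; linarith
    push_cast
    nlinarith
  have hw : slow M ≤ √L := by
    rw [slow, Real.sqrt_eq_rpow]
    exact Real.rpow_le_rpow_of_exponent_le (by linarith) (by norm_num)
  have h1 : slow M * (1 + Real.log L) + 2 + (1 + 2 * L) / √L ≤ e * L := by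
    have e1 : slow M * (1 + Real.log L) ≤ √L * (1 + Real.log L) :=
      mul_le_mul_of_nonneg_right hw (by linarith)
    have e2 : (1 + 2 * L) / √L ≤ 3 * √L - 2 := by
      rw [div_le_iff₀ hsq]; nlinarith
    have e3 : √L * (1 * Real.log L + 3) ≤ √L * (e / 2 * √L) := mul_le_mul_of_nonneg_left m2 hsq.le
    have e4 : √L * (0 * Real.log L + 3) ≤ √L * (e / 2 * √L) := mul_le_mul_of_nonneg_left m3 hsq.le
    nlinarith
  have h2 : 2 * L / √L + 2 * (Real.log 2 + Real.log (1 + L)) ≤ e * L := by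
    have e1 : 2 * L / √L = 2 * √L := by
      rw [div_eq_iff hsq.ne']; linarith
    have e2 : Real.log (1 + L) ≤ Real.log 2 + Real.log L := by
      rw [← Real.log_mul (by norm_num) hL0.ne']
      exact Real.log_le_log (by linarith) (by linarith)
    have e4 : √L * (0 * Real.log L + 3) ≤ √L * (e / 2 * √L) := mul_le_mul_of_nonneg_left m3 hsq.le
    nlinarith
  have hsep' : ∀ i : ℕ, 0 < i → i < N → 1 / (M * slow M) ≤ ‖((i * α : ℝ) : UnitAddCircle)‖ := by
    intro i hi hiN
    have : (i : ℝ) < N := by exact_mod_cast hiN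
    exact hsep i hi (by linarith)
  refine ⟨oneSided_bounds hq (h.coprime m) hqα hM hL hqM hE h1 h2 hN1 hN2 hsep' hx, ?_⟩
  have hρ : 0 < 1 / (M * slow M) := by
    have : 0 < slow M := Real.rpow_pos_of_pos hL0 _
    positivity
  have hneg : ∀ i : ℕ, -(x + i * α) = -x + i * -α := fun i => by ring
  have hfr : ∀ i ∈ Finset.range N, Int.fract (-x + i * -α) = 1 - Int.fract (x + i * α) := by
    intro i hi
    rw [← hneg]
    exact fract_neg_of_norm_pos (hρ.trans_le (hx i (Finset.mem_range.1 hi)))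
  -- Reflection of the circle: for `-α` and `-x` the distance to `0` from the right becomes the
  -- distance from the left.
  have key := oneSided_bounds (α := -α) (p := -P m) (e := e) (x := -x) (N := N) hq
    (h.coprime m).neg_right
    (by
      have : (Q m * -α - (-P m : ℤ) : ℝ) = -(Q m * α - P m) := by push_cast; ring
      rwa [this, abs_neg]) hM hL hqM hE h1 h2 hN1 hN2
    (fun i hi hiN => by
      rw [mul_neg, norm_coe_circle_neg]; exact hsep' i hi hiN)
    (fun i hiN => by
      rw [← hneg, norm_coe_circle_neg]; exact hx i hiN)
  have hsum : ∀ s ⊆ Finset.range N, ∑ i ∈ s, 1 / Int.fract (-x + i * -α) =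
      ∑ i ∈ s, 1 / (1 - Int.fract (x + i * α)) :=
    fun s hs => Finset.sum_congr rfl fun i hi => by rw [hfr i (hs hi)]
  refine ⟨by rw [← hsum _ subset_rfl]; exact key.1, fun δ hδ hδ1 => ?_⟩
  have hfilter : (Finset.range N).filter (fun i : ℕ => 1 - Int.fract (x + i * α) < δ) =
      (Finset.range N).filter (fun i : ℕ => Int.fract (-x + i * -α) < δ) :=
    Finset.filter_congr fun i hi => by rw [hfr i hi]
  rw [hfilter, ← hsum _ (Finset.filter_subset _ _)]
  exact key.2 δ hδ hδ1

end OneSidedAsymptotics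

/-! ### Partial arcs are coboundaries modulo `2` -/

section Transfer

/-- The indicator, modulo `2`, of the arc `[0, β)` of the circle. -/
noncomputable def arcInd (β y : ℝ) : ZMod 2 := if Int.fract y < β then 1 else 0

theorem zmod_two_add_self (a : ZMod 2) : a + a = 0 := CharTwo.add_self_eq_zero a

theorem arcInd_sub_intCast (β y : ℝ) (m : ℤ) : arcInd β (y - m) = arcInd β y := by
  simp [arcInd]

theorem arcInd_add {c d : ℝ} (hc : 0 ≤ c) (hd : 0 ≤ d) (hcd : c + d ≤ 1) (y : ℝ) :
    arcInd (c + d) y = arcInd c y + arcInd d (y - c) := by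
  have h0 := Int.fract_nonneg y
  have h1 := Int.fract_lt_one y
  simp only [arcInd]
  by_cases hy : Int.fract y < c
  · have hf : Int.fract (y - c) = Int.fract y - c + 1 := by
      rw [Int.fract_eq_iff]
      refine ⟨by linarith, by linarith, ⌊y⌋ - 1, ?_⟩
      push_cast; simp only [Int.fract]; ring
    rw [if_pos (by linarith), if_pos hy, if_neg (by rw [hf]; linarith), add_zero]
  · have hf : Int.fract (y - c) = Int.fract y - c := by
      rw [Int.fract_eq_iff]
      refine ⟨by linarith, by linarith, ⌊y⌋, ?_⟩
      simp only [Int.fract]; ring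
    rw [if_neg hy, hf, zero_add]
    congr 1
    exact propext ⟨fun h => by linarith, fun h => by linarith⟩

/-- The indicator of the arc `[e, e + β)` can change only at a lift of one of its endpoints. -/
theorem arcInd_eq_of_no_jump {β e y y' : ℝ} (hy : y ≤ y')
    (h1 : ∀ m : ℤ, ¬ (y < e + m ∧ e + m ≤ y'))
    (h2 : ∀ m : ℤ, ¬ (y < e + β + m ∧ e + β + m ≤ y')) :
    arcInd β (y - e) = arcInd β (y' - e) := by
  have hfl : ⌊y' - e⌋ = ⌊y - e⌋ := by
    refine le_antisymm ?_ (Int.floor_le_floor (by linarith))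
    by_contra hc
    push Not at hc
    refine h1 ⌊y' - e⌋ ⟨?_, ?_⟩
    · have := Int.floor_lt.1 hc; linarith
    · have := Int.floor_le (y' - e); linarith
  have hf : Int.fract (y' - e) = Int.fract (y - e) + (y' - y) := by
    simp only [Int.fract, hfl]; ring
  simp only [arcInd]
  congr 1
  refine propext ⟨fun h => ?_, fun h => by linarith⟩
  by_contra hc
  push Not at hc
  refine h2 ⌊y - e⌋ ⟨?_, ?_⟩
  · simp only [Int.fract] at h; linarith
  · rw [← hfl]; simp only [Int.fract] at hc; linarith

variable (α : ℝ) (b : ℕ → ℕ)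

/-- The `l`-th increment of the length of the arc, halved. -/
noncomputable def gap (l : ℕ) : ℝ := Int.fract (b l * α)

/-- The sum of the first `k` increments. -/
noncomputable def partialLen (k : ℕ) : ℝ := ∑ l ∈ Finset.range k, 2 * gap α b l

/-- The time at which the orbit of `0` is at `partialLen α b k`. -/
def partialTime (k : ℕ) : ℕ := ∑ l ∈ Finset.range k, 2 * b l

/-- The transfer function of the arc between `partialLen α b l` and `partialLen α b (l + 1)`. -/
noncomputable def transferTerm (l : ℕ) (x : ℝ) : ZMod 2 :=
  ∑ u ∈ Finset.range (b l), arcInd (gap α b l) (x - partialTime b l * α - u * α)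

/-- The transfer function of the arc `[0, partialLen α b k)`. -/
noncomputable def transfer (k : ℕ) (x : ℝ) : ZMod 2 :=
  ∑ l ∈ Finset.range k, transferTerm α b l x

variable {α b}

theorem gap_nonneg (l : ℕ) : 0 ≤ gap α b l := Int.fract_nonneg _

theorem gap_eq (l : ℕ) : gap α b l = b l * α - (⌊b l * α⌋ : ℤ) := rfl

/-- In characteristic `2` the sum telescopes to its two extreme terms, the indicators of `[0, g)`
and of its translate by `b l * α`, which is `g` modulo `1` for `g = gap α b l`. These two arcs are
adjacent and form one arc of length `2 * g`. -/
theorem transferTerm_add {l : ℕ} (hl : gap α b l ≤ 1 / 2) (x : ℝ) :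
    transferTerm α b l x + transferTerm α b l (x - α) =
      arcInd (2 * gap α b l) (x - partialTime b l * α) := by
  set F : ℕ → ZMod 2 := fun u => arcInd (gap α b l) (x - partialTime b l * α - u * α) with hF
  have h1 : transferTerm α b l x = ∑ u ∈ Finset.range (b l), F u := rfl
  have h2 : transferTerm α b l (x - α) = ∑ u ∈ Finset.range (b l), F (u + 1) := by
    refine Finset.sum_congr rfl fun u _ => ?_
    simp only [hF]; congr 1; push_cast; ring
  have h3 : ∑ u ∈ Finset.range (b l), F u + F (b l) =
      ∑ u ∈ Finset.range (b l), F (u + 1) + F 0 := by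
    rw [← Finset.sum_range_succ, Finset.sum_range_succ']
  have h4 : F (b l) = arcInd (gap α b l) (x - partialTime b l * α - gap α b l) := by
    simp only [hF]
    rw [← arcInd_sub_intCast _ (x - partialTime b l * α - gap α b l) ⌊b l * α⌋]
    congr 1
    rw [gap_eq]; ring
  have h5 : F 0 = arcInd (gap α b l) (x - partialTime b l * α) := by simp [hF]
  rw [two_mul, arcInd_add (gap_nonneg l) (gap_nonneg l) (by linarith), ← h4, ← h5, h1, h2]
  have h6 : ∑ u ∈ Finset.range (b l), F u =
      ∑ u ∈ Finset.range (b l), F (u + 1) + F 0 + F (b l) := by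
    rw [← h3, add_assoc, zmod_two_add_self, add_zero]
  have h7 := zmod_two_add_self (∑ u ∈ Finset.range (b l), F (u + 1))
  rw [h6]
  linear_combination h7

theorem partialLen_nonneg (k : ℕ) : 0 ≤ partialLen α b k :=
  Finset.sum_nonneg fun l _ => by have := gap_nonneg (α := α) (b := b) l; positivity

theorem partialLen_succ (k : ℕ) :
    partialLen α b (k + 1) = partialLen α b k + 2 * gap α b k := Finset.sum_range_succ _ _

theorem partialTime_succ (k : ℕ) : partialTime b (k + 1) = partialTime b k + 2 * b k :=
  Finset.sum_range_succ _ _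

theorem partialTime_mono {k l : ℕ} (h : k ≤ l) : partialTime b k ≤ partialTime b l :=
  Finset.sum_le_sum_of_subset (Finset.range_mono h)

theorem exists_partialTime_mul (k : ℕ) :
    ∃ m : ℤ, partialTime b k * α = partialLen α b k + m := by
  induction k with
  | zero => exact ⟨0, by simp [partialTime, partialLen]⟩
  | succ k ih =>
    obtain ⟨m, hm⟩ := ih
    refine ⟨m + 2 * ⌊b k * α⌋, ?_⟩
    rw [partialTime_succ, partialLen_succ, gap_eq]
    push_cast
    linear_combination hm

/-- The arcs of the successive levels are laid end to end: the shift by `partialTime b k * α` in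
`transferTerm` moves the new arc to the end `partialLen α b k` of the previous ones. -/
theorem transfer_add {k : ℕ} (hk : partialLen α b k ≤ 1) (x : ℝ) :
    transfer α b k x + transfer α b k (x - α) = arcInd (partialLen α b k) x := by
  induction k with
  | zero => simp [transfer, partialLen, arcInd, (Int.fract_nonneg x).not_gt]
  | succ k ih =>
    have h0 := partialLen_nonneg (α := α) (b := b) k
    have h1 := gap_nonneg (α := α) (b := b) k
    rw [partialLen_succ] at hk ⊢
    rw [arcInd_add h0 (by linarith) hk, ← ih (by linarith)]
    have h2 := transferTerm_add (α := α) (b := b) (l := k) (by linarith) x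
    obtain ⟨m, hm⟩ := exists_partialTime_mul (α := α) (b := b) k
    have h3 : arcInd (2 * gap α b k) (x - partialTime b k * α) =
        arcInd (2 * gap α b k) (x - partialLen α b k) := by
      rw [hm, ← sub_sub, arcInd_sub_intCast]
    rw [← h3, ← h2]
    simp only [transfer, Finset.sum_range_succ]
    abel

/-- Every arc endpoint occurring in `transfer` is, modulo `1`, a multiple `t * α` with `0 ≤ t ≤
partialTime b k`: the left end of an arc is at time `partialTime b l + u`, its right end `b l`
later. -/
theorem transfer_eq_of_no_jump {k : ℕ} {y y' : ℝ} (hy : y ≤ y')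
    (h : ∀ t : ℕ, t ≤ partialTime b k → ∀ m : ℤ, ¬ (y < t * α + m ∧ t * α + m ≤ y')) :
    transfer α b k y = transfer α b k y' := by
  refine Finset.sum_congr rfl fun l hl => Finset.sum_congr rfl fun u hu => ?_
  have hl' : partialTime b (l + 1) ≤ partialTime b k :=
    partialTime_mono (Finset.mem_range.1 hl)
  rw [partialTime_succ] at hl'
  have hu' := Finset.mem_range.1 hu
  rw [sub_sub, sub_sub]
  refine arcInd_eq_of_no_jump hy ?_ ?_
  · intro m
    have := h (partialTime b l + u) (by omega) m
    push_cast at this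
    rwa [add_mul] at this
  · intro m
    have := h (partialTime b l + u + b l) (by omega) (m - ⌊b l * α⌋)
    rw [gap_eq]
    push_cast at this
    convert this using 3 <;> ring

theorem transfer_sub_intCast (k : ℕ) (y : ℝ) (m : ℤ) :
    transfer α b k (y - m) = transfer α b k y := by
  refine Finset.sum_congr rfl fun l _ => Finset.sum_congr rfl fun u _ => ?_
  rw [← arcInd_sub_intCast _ (y - partialTime b l * α - u * α) m]
  congr 1; ring

/-- The transfer function is constant on each side of `0`, and jumps at `0`. -/
theorem exists_transfer_near_zero {k : ℕ} {δ : ℝ} (hδ : δ ≤ partialLen α b k)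
    (hδ1 : partialLen α b k + δ ≤ 1)
    (h : ∀ t : ℕ, 1 ≤ t → t ≤ partialTime b k + 1 → δ ≤ ‖((t * α : ℝ) : UnitAddCircle)‖) :
    ∃ γ : ZMod 2, ∀ y : ℝ, (Int.fract y < δ → 0 < Int.fract y → transfer α b k y = γ + 1) ∧
      (1 - Int.fract y < δ → transfer α b k y = γ) := by
  by_cases hδ0 : δ ≤ 0
  · refine ⟨0, fun y => ⟨fun h1 h2 => by linarith, fun h1 => ?_⟩⟩
    have := Int.fract_lt_one y; linarith
  push Not at hδ0
  have hnorm : ∀ (t : ℕ) (m : ℤ), 1 ≤ t → t ≤ partialTime b k + 1 → δ ≤ |t * α + m| := by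
    intro t m h1 h2
    have := norm_coe_circle_le_abs_sub (t * α) (-m)
    push_cast at this
    rw [sub_neg_eq_add] at this
    exact (h t h1 h2).trans this
  -- Around `-α` there is no jump: a jump `t * α` there would put `(t + 1) * α` within `δ` of `0`.
  -- The coboundary equation then carries the constancy of `transfer` near `-α` to both sides of
  -- `0`, with a difference of `1` because `0` is the left end of the arc.
  have hshift : ∀ y y' : ℝ, -δ < y → y ≤ y' → y' < δ →
      transfer α b k (y - α) = transfer α b k (y' - α) := by
    intro y y' h1 h2 h3
    refine transfer_eq_of_no_jump (by linarith) fun t ht m hm => ?_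
    have := hnorm (t + 1) m (by omega) (by omega)
    push_cast at this
    rw [le_abs] at this
    rcases this with h | h <;> nlinarith [hm.1, hm.2]
  have hpos : ∀ y : ℝ, 0 < y → y < δ → transfer α b k y = transfer α b k (0 - α) + 1 := by
    intro y h1 h2
    have h3 := transfer_add (α := α) (b := b) (k := k) (by linarith) y
    have hf : Int.fract y = y := Int.fract_eq_self.2 ⟨h1.le, by linarith⟩
    rw [arcInd, if_pos (by rw [hf]; linarith), ← hshift 0 y (by linarith) h1.le h2] at h3
    rw [← h3, add_comm, add_assoc, zmod_two_add_self, add_zero]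
  have hneg : ∀ y : ℝ, -δ < y → y < 0 → transfer α b k y = transfer α b k (0 - α) := by
    intro y h1 h2
    have h3 := transfer_add (α := α) (b := b) (k := k) (by linarith) y
    have hf : Int.fract y = y + 1 := by
      rw [Int.fract_eq_iff]
      exact ⟨by linarith, by linarith, -1, by push_cast; ring⟩
    rw [arcInd, if_neg (by rw [hf]; linarith), hshift y 0 h1 h2.le hδ0] at h3
    exact (CharTwo.add_eq_zero).1 h3
  refine ⟨transfer α b k (0 - α), fun y => ⟨fun h1 h2 => ?_, fun h1 => ?_⟩⟩
  · rw [← transfer_sub_intCast k y ⌊y⌋]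
    exact hpos _ h2 h1
  · rw [← transfer_sub_intCast k y (⌊y⌋ + 1)]
    have := Int.fract_lt_one y
    simp only [Int.fract] at h1 this
    refine hneg _ ?_ ?_ <;> push_cast <;> linarith

end Transfer

/-! ### Iterates of the skew product -/

section Skew

theorem coe_circle_eq_iff {x y : ℝ} : (x : UnitAddCircle) = y ↔ ∃ m : ℤ, x = y + m := by
  rw [← sub_eq_zero, ← AddCircle.coe_sub, AddCircle.coe_eq_zero_iff]
  refine exists_congr fun m => ?_
  rw [zsmul_one]
  constructor <;> intro h <;> linarith

variable {α : ℝ} {n : ℕ → ℕ}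

theorem mem_arcJ_iff (hJ : SkewFlow.lenJ α n ≤ 1) (y : ℝ) :
    (y : UnitAddCircle) ∈ SkewFlow.arcJ α n ↔ Int.fract y < SkewFlow.lenJ α n := by
  constructor
  · rintro ⟨t, ht, hty⟩
    obtain ⟨m, rfl⟩ := coe_circle_eq_iff.1 hty
    have : Int.fract y = y + m := by
      rw [Int.fract_eq_iff]
      exact ⟨ht.1, ht.2.trans_le hJ, -m, by push_cast; ring⟩
    rw [this]; exact ht.2
  · intro h
    exact ⟨Int.fract y, ⟨Int.fract_nonneg y, h⟩,
      coe_circle_eq_iff.2 ⟨-⌊y⌋, by simp only [Int.fract]; push_cast; ring⟩⟩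

theorem indicator_arcJ (hJ : SkewFlow.lenJ α n ≤ 1) (y : ℝ) :
    (SkewFlow.arcJ α n).indicator (1 : UnitAddCircle → ZMod 2) y =
      arcInd (SkewFlow.lenJ α n) y := by
  classical
  rw [Set.indicator_apply, arcInd]
  simp only [mem_arcJ_iff hJ, Pi.one_apply]

theorem skew_iterate (hJ : SkewFlow.lenJ α n ≤ 1) (x : ℝ) (j : ZMod 2) (i : ℕ) :
    (SkewFlow.skew α n)^[i] ((x : UnitAddCircle), j) = (((x + i * α : ℝ) : UnitAddCircle),
      j + ∑ l ∈ Finset.range i, arcInd (SkewFlow.lenJ α n) (x + (l + 1 : ℕ) * α)) := by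
  induction i with
  | zero => simp
  | succ i ih =>
    have e : ((x + i * α : ℝ) : UnitAddCircle) + (α : UnitAddCircle) =
        ((x + (i + 1 : ℕ) * α : ℝ) : UnitAddCircle) := by
      rw [← AddCircle.coe_add]; congr 1; push_cast; ring
    rw [Function.iterate_succ_apply', ih, SkewFlow.skew]
    simp only [e]
    rw [indicator_arcJ hJ, Finset.sum_range_succ, add_assoc]

/-- An orbit avoiding `[partialLen α b k, c)` does not distinguish the arc `[0, c)` from the partial
arc, and for the latter the sum of a coboundary telescopes. -/
theorem sum_arcInd_eq_transfer {b : ℕ → ℕ} {k : ℕ} {c : ℝ} (hc : partialLen α b k ≤ c)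
    (hc1 : c ≤ 1) {x : ℝ} {i : ℕ}
    (h : ∀ l : ℕ, 1 ≤ l → l ≤ i →
      ¬ (partialLen α b k ≤ Int.fract (x + l * α) ∧ Int.fract (x + l * α) < c)) :
    ∑ l ∈ Finset.range i, arcInd c (x + (l + 1 : ℕ) * α) =
      transfer α b k (x + i * α) + transfer α b k x := by
  induction i with
  | zero => simp [zmod_two_add_self]
  | succ i ih =>
    rw [Finset.sum_range_succ, ih fun l h1 h2 => h l h1 (by omega)]
    have h1 := transfer_add (hc.trans hc1) (α := α) (b := b) (k := k) (x + (i + 1 : ℕ) * α)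
    have h2 : x + (i + 1 : ℕ) * α - α = x + i * α := by push_cast; ring
    have h3 : arcInd c (x + (i + 1 : ℕ) * α) =
        arcInd (partialLen α b k) (x + (i + 1 : ℕ) * α) := by
      simp only [arcInd]
      congr 1
      refine propext ⟨fun h' => ?_, fun h' => h'.trans_le hc⟩
      by_contra hcon
      push Not at hcon
      exact h (i + 1) (by omega) le_rfl ⟨hcon, h'⟩
    rw [h2] at h1
    rw [h3, ← h1]
    have h4 := zmod_two_add_self (transfer α b k (x + i * α))
    linear_combination h4

end Skew

/-! ### Derivatives of the roof function -/

section Roof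

/-- `t` is neither an integer nor a half-integer. -/
def IsDoublyNonintegral (t : ℝ) : Prop := ∃ m : ℤ, t ≠ m ∧ |t - m| < 1 / 2

/-- The derivative of `t ↦ |log ‖t‖|`. -/
noncomputable def logDistDeriv (t : ℝ) : ℝ := -1 / (t - round t)

theorem round_eq_of_abs_sub_lt {t : ℝ} {m : ℤ} (h : |t - m| < 1 / 2) : round t = m := by
  rw [round_eq, Int.floor_eq_iff]
  rw [abs_lt] at h
  constructor <;> linarith

theorem eventually_ne_and_abs_sub_lt {t : ℝ} {m : ℤ} (h1 : t ≠ (m : ℝ)) (h2 : |t - m| < 1 / 2) :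
    ∀ᶠ u in 𝓝 t, u ≠ (m : ℝ) ∧ |u - m| < 1 / 2 := by
  refine Filter.Eventually.and (isOpen_ne.mem_nhds h1) ?_
  exact (isOpen_lt (by fun_prop) continuous_const).mem_nhds (x := t)
    (s := {u : ℝ | |u - m| < 1 / 2}) h2

theorem IsDoublyNonintegral.eventually {t : ℝ} (h : IsDoublyNonintegral t) :
    ∀ᶠ u in 𝓝 t, IsDoublyNonintegral u := by
  obtain ⟨m, h1, h2⟩ := h
  exact (eventually_ne_and_abs_sub_lt h1 h2).mono fun u hu => ⟨m, hu⟩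

/-- Away from half-integers the nearest integer `m` is locally constant, so the function is `-log |u
- m|` near `t`; at a half-integer it has a corner. -/
theorem IsDoublyNonintegral.hasDerivAt {t : ℝ} (h : IsDoublyNonintegral t) :
    HasDerivAt (fun u : ℝ => |Real.log ‖(u : UnitAddCircle)‖|) (logDistDeriv t) t := by
  obtain ⟨m, h1, h2⟩ := h
  have h3 : t - m ≠ 0 := sub_ne_zero.2 h1
  have key : HasDerivAt (fun u : ℝ => -Real.log (u - m)) (logDistDeriv t) t := by
    rw [logDistDeriv, round_eq_of_abs_sub_lt h2, neg_div]
    exact (((hasDerivAt_id t).sub_const (m : ℝ)).log h3).neg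
  refine key.congr_of_eventuallyEq ?_
  filter_upwards [eventually_ne_and_abs_sub_lt h1 h2] with u hu
  rw [UnitAddCircle.norm_eq, round_eq_of_abs_sub_lt hu.2, Real.log_abs, abs_of_nonpos]
  rw [← Real.log_abs]
  exact Real.log_nonpos (abs_nonneg _) (by linarith [hu.2])

theorem IsDoublyNonintegral.hasDerivAt_logDistDeriv {t : ℝ} (h : IsDoublyNonintegral t) :
    HasDerivAt logDistDeriv (1 / ‖(t : UnitAddCircle)‖ ^ 2) t := by
  obtain ⟨m, h1, h2⟩ := h
  have h3 : t - m ≠ 0 := sub_ne_zero.2 h1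
  have key : HasDerivAt (fun u : ℝ => -1 / (u - m)) (1 / ‖(t : UnitAddCircle)‖ ^ 2) t := by
    rw [UnitAddCircle.norm_eq, round_eq_of_abs_sub_lt h2, sq_abs]
    have := (((hasDerivAt_id t).sub_const (m : ℝ)).inv h3).neg
    exact (this.congr_deriv (by simp [neg_div])).congr_of_eventuallyEq
      (Eventually.of_forall fun u => by simp [neg_div])
  refine key.congr_of_eventuallyEq ?_
  filter_upwards [eventually_ne_and_abs_sub_lt h1 h2] with u hu
  rw [logDistDeriv, round_eq_of_abs_sub_lt hu.2]

theorem isDoublyNonintegral_of_norm_pos {t : ℝ} (h1 : 0 < ‖(t : UnitAddCircle)‖)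
    (h2 : 0 < ‖((t - 1 / 2 : ℝ) : UnitAddCircle)‖) : IsDoublyNonintegral t := by
  rw [UnitAddCircle.norm_eq] at h1
  refine ⟨round t, fun h => ?_, lt_of_le_of_ne (abs_sub_round t) fun h => ?_⟩
  · rw [sub_eq_zero.2 h] at h1; simp at h1
  · rcases eq_or_eq_neg_of_abs_eq h with h | h
    · have := norm_coe_circle_le_abs_sub (t - 1 / 2) (round t)
      rw [show t - 1 / 2 - round t = 0 by linarith, abs_zero] at this
      linarith
    · have := norm_coe_circle_le_abs_sub (t - 1 / 2) (round t - 1)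
      rw [show t - 1 / 2 - ((round t - 1 : ℤ) : ℝ) = 0 by push_cast; linarith, abs_zero] at this
      linarith

theorem abs_logDistDeriv (t : ℝ) : |logDistDeriv t| = 1 / ‖(t : UnitAddCircle)‖ := by
  rw [logDistDeriv, UnitAddCircle.norm_eq, abs_div, abs_neg, abs_one]

theorem inv_norm_sq_le (t : ℝ) :
    1 / ‖(t : UnitAddCircle)‖ ^ 2 ≤ 1 / Int.fract t ^ 2 + 1 / (1 - Int.fract t) ^ 2 := by
  rw [norm_coe_circle_eq_min]
  rcases min_choice (Int.fract t) (1 - Int.fract t) with h | h <;> rw [h]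
  · have : 0 ≤ 1 / (1 - Int.fract t) ^ 2 := by positivity
    linarith
  · have : 0 ≤ 1 / Int.fract t ^ 2 := by positivity
    linarith

/-- One of the two one-sided terms is the derivative itself; the other one comes from the far side
of the circle and is at most `2`. -/
theorem IsDoublyNonintegral.abs_logDistDeriv_sub_le {t : ℝ} (h : IsDoublyNonintegral t) :
    |logDistDeriv t - (1 / (1 - Int.fract t) - 1 / Int.fract t)| ≤ 2 := by
  obtain ⟨m, h1, h2⟩ := h
  rw [logDistDeriv, round_eq_of_abs_sub_lt h2]
  rw [abs_lt] at h2
  rcases lt_or_gt_of_ne h1 with hlt | hgt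
  · have hf : Int.fract t = t - m + 1 := by
      rw [Int.fract_eq_iff]
      exact ⟨by linarith, by linarith, m - 1, by push_cast; ring⟩
    rw [hf, show 1 - (t - m + 1) = -(t - m) by ring, neg_div, one_div_neg_eq_neg_one_div]
    rw [show -(1 / (t - m)) - (-(1 / (t - m)) - 1 / (t - m + 1)) = 1 / (t - m + 1) by ring,
      abs_of_pos (by apply one_div_pos.2; linarith), div_le_iff₀ (by linarith)]
    linarith
  · have hf : Int.fract t = t - m := by
      rw [Int.fract_eq_iff]
      exact ⟨by linarith, by linarith, m, by ring⟩
    rw [hf, neg_div]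
    rw [show -(1 / (t - m)) - (1 / (1 - (t - m)) - 1 / (t - m)) = -(1 / (1 - (t - m))) by ring,
      abs_neg, abs_of_pos (by apply one_div_pos.2; linarith), div_le_iff₀ (by linarith)]
    linarith

variable {α : ℝ} {n : ℕ → ℕ}

/-- The real number `1` if `j = 1`, and `0` otherwise. -/
noncomputable def sheetWeight (j : ZMod 2) : ℝ := Set.indicator {(1 : ZMod 2)} 1 j

theorem sheetWeight_one : sheetWeight 1 = 1 := by simp [sheetWeight]

theorem sheetWeight_zero : sheetWeight 0 = 0 := by simp [sheetWeight]

theorem sheetWeight_eq (j : ZMod 2) : sheetWeight j = 0 ∨ sheetWeight j = 1 := by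
  fin_cases j
  · exact Or.inl sheetWeight_zero
  · exact Or.inr sheetWeight_one

theorem abs_sheetWeight_le (j : ZMod 2) : |sheetWeight j| ≤ 1 := by
  rcases sheetWeight_eq j with h | h <;> simp [h]

variable (α n) in
/-- The singularities of the roof function, and their antipodes, do not lie over `x`. -/
def IsRegularPoint (x : ℝ) : Prop :=
  IsDoublyNonintegral (x + α) ∧ IsDoublyNonintegral (x - SkewFlow.lenJ α n + α) ∧
    IsDoublyNonintegral x

theorem IsRegularPoint.eventually {x : ℝ} (h : IsRegularPoint α n x) :
    ∀ᶠ t in 𝓝 (0 : ℝ), IsRegularPoint α n (x + t) := by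
  have key : ∀ c : ℝ, IsDoublyNonintegral (x + c) →
      ∀ᶠ t in 𝓝 (0 : ℝ), IsDoublyNonintegral (x + t + c) := by
    intro c hc
    have : Tendsto (fun t : ℝ => x + t + c) (𝓝 0) (𝓝 (x + c)) := by
      have : Continuous fun t : ℝ => x + t + c := by fun_prop
      simpa using this.tendsto 0
    exact this.eventually hc.eventually
  have h2 := key (-SkewFlow.lenJ α n + α) (by rw [← add_assoc, ← sub_eq_add_neg]; exact h.2.1)
  have h3 := key 0 (by rw [add_zero]; exact h.2.2)
  filter_upwards [key α h.1, h2, h3] with t t1 t2 t3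
  refine ⟨t1, ?_, by simpa using t3⟩
  rwa [← add_assoc, ← sub_eq_add_neg] at t2

theorem alongCircle_roof (x : ℝ) (j : ZMod 2) (t : ℝ) :
    SkewFlow.alongCircle (SkewFlow.roof α n) ((x : UnitAddCircle), j) t =
      1 + |Real.log ‖((x + t + α : ℝ) : UnitAddCircle)‖|
        + |Real.log ‖((x + t - SkewFlow.lenJ α n + α : ℝ) : UnitAddCircle)‖|
        + sheetWeight j * |Real.log ‖((x + t : ℝ) : UnitAddCircle)‖| := by
  simp only [SkewFlow.alongCircle, SkewFlow.roof, sheetWeight, dist_eq_norm]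
  rw [sub_zero, sub_neg_eq_add, ← sub_add, ← AddCircle.coe_add, ← AddCircle.coe_add,
    ← AddCircle.coe_sub, ← AddCircle.coe_add]

theorem hasDerivAt_roof {x : ℝ} (h : IsRegularPoint α n x) (j : ZMod 2) :
    HasDerivAt (SkewFlow.alongCircle (SkewFlow.roof α n) ((x : UnitAddCircle), j))
      (logDistDeriv (x + α) + logDistDeriv (x - SkewFlow.lenJ α n + α)
        + sheetWeight j * logDistDeriv x) 0 := by
  have shift : ∀ (c : ℝ), IsDoublyNonintegral (x + c) →
      HasDerivAt (fun t : ℝ => |Real.log ‖((x + t + c : ℝ) : UnitAddCircle)‖|)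
        (logDistDeriv (x + c)) 0 := by
    intro c hc
    have h1 : HasDerivAt (fun t : ℝ => x + t + c) 1 0 :=
      ((hasDerivAt_id (0 : ℝ)).const_add x).add_const c
    have h2 := (hc.hasDerivAt).comp_of_eq (0 : ℝ) h1 (by ring)
    simpa using! h2
  have h1 := shift α h.1
  have h2 := shift (-SkewFlow.lenJ α n + α) (by
    rw [← add_assoc, ← sub_eq_add_neg]; exact h.2.1)
  have h3 := shift 0 (by rw [add_zero]; exact h.2.2)
  have h4 := (((hasDerivAt_const (0 : ℝ) (1 : ℝ)).add h1).add h2).add (h3.const_mul (sheetWeight j))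
  refine (h4.congr_deriv ?_).congr_of_eventuallyEq (Eventually.of_forall fun t => ?_)
  · rw [add_zero, zero_add, ← add_assoc x, ← sub_eq_add_neg]
  · rw [alongCircle_roof]
    simp only [Pi.add_apply, add_zero]
    rw [← add_assoc (x + t), ← sub_eq_add_neg]

theorem circleDeriv_roof {x : ℝ} (h : IsRegularPoint α n x) (j : ZMod 2) :
    SkewFlow.circleDeriv (SkewFlow.roof α n) ((x : UnitAddCircle), j) =
      logDistDeriv (x + α) + logDistDeriv (x - SkewFlow.lenJ α n + α)
        + sheetWeight j * logDistDeriv x :=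
  (hasDerivAt_roof h j).deriv

theorem hasDerivAt_circleDeriv_roof {x : ℝ} (h : IsRegularPoint α n x) (j : ZMod 2) :
    HasDerivAt (SkewFlow.alongCircle (SkewFlow.circleDeriv (SkewFlow.roof α n))
        ((x : UnitAddCircle), j))
      (1 / ‖((x + α : ℝ) : UnitAddCircle)‖ ^ 2
        + 1 / ‖((x - SkewFlow.lenJ α n + α : ℝ) : UnitAddCircle)‖ ^ 2
        + sheetWeight j * (1 / ‖(x : UnitAddCircle)‖ ^ 2)) 0 := by
  have shift : ∀ (c : ℝ), IsDoublyNonintegral (x + c) →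
      HasDerivAt (fun t : ℝ => logDistDeriv (x + t + c))
        (1 / ‖((x + c : ℝ) : UnitAddCircle)‖ ^ 2) 0 := by
    intro c hc
    have h1 : HasDerivAt (fun t : ℝ => x + t + c) 1 0 :=
      ((hasDerivAt_id (0 : ℝ)).const_add x).add_const c
    have h2 := (hc.hasDerivAt_logDistDeriv).comp_of_eq (0 : ℝ) h1 (by ring)
    simpa using! h2
  have h1 := shift α h.1
  have h2 := shift (-SkewFlow.lenJ α n + α) (by
    rw [← add_assoc, ← sub_eq_add_neg]; exact h.2.1)
  have h3 := shift 0 (by rw [add_zero]; exact h.2.2)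
  have h4 := (h1.add h2).add (h3.const_mul (sheetWeight j))
  refine (h4.congr_deriv ?_).congr_of_eventuallyEq ?_
  · rw [add_zero, ← add_assoc x, ← sub_eq_add_neg]
  -- Regularity is an open condition, so the formula for the first derivative holds near the point
  -- and may be differentiated.
  · filter_upwards [h.eventually] with t ht
    have e : SkewFlow.alongCircle (SkewFlow.circleDeriv (SkewFlow.roof α n))
        ((x : UnitAddCircle), j) t =
        SkewFlow.circleDeriv (SkewFlow.roof α n) (((x + t : ℝ) : UnitAddCircle), j) := rfl
    rw [e, circleDeriv_roof ht]
    simp only [Pi.add_apply, add_zero]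
    rw [← add_assoc (x + t), ← sub_eq_add_neg]

theorem circleDeriv_circleDeriv_roof {x : ℝ} (h : IsRegularPoint α n x) (j : ZMod 2) :
    SkewFlow.circleDeriv (SkewFlow.circleDeriv (SkewFlow.roof α n)) ((x : UnitAddCircle), j) =
      1 / ‖((x + α : ℝ) : UnitAddCircle)‖ ^ 2
        + 1 / ‖((x - SkewFlow.lenJ α n + α : ℝ) : UnitAddCircle)‖ ^ 2
        + sheetWeight j * (1 / ‖(x : UnitAddCircle)‖ ^ 2) :=
  (hasDerivAt_circleDeriv_roof h j).deriv

end Roof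

/-! ### Visits to the support of the last transfer term -/

section Support

variable {α β : ℝ} {q b T : ℕ}

/-- Two visits within the same block of `q` consecutive times would give a return closer than `β` at
a time below `q`. -/
theorem card_hits_le (hq : 0 < q)
    (hsep : ∀ i : ℕ, 0 < i → i < q → β ≤ ‖((i * α : ℝ) : UnitAddCircle)‖) (y : ℝ) (N : ℕ) :
    ((Finset.range N).filter fun i : ℕ => Int.fract (y + i * α) < β).card ≤ N / q + 1 := by
  have key : ∀ i j : ℕ, Int.fract (y + i * α) < β → Int.fract (y + j * α) < β → i < j →
      i / q = j / q → False := by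
    intro i j hi hj hij hdiv
    have h1 : j - i < q := by
      have a1 := Nat.div_mul_le_self i q
      have a2 := Nat.lt_div_mul_add hq (a := j)
      rw [← hdiv] at a2
      omega
    have h2 := hsep (j - i) (by omega) h1
    have h3 := norm_coe_circle_le_abs_fract_sub (y + j * α) (y + i * α)
    have h4 : y + j * α - (y + i * α) = ((j - i : ℕ) : ℝ) * α := by
      rw [Nat.cast_sub hij.le]; ring
    rw [h4] at h3
    have h5 : |Int.fract (y + j * α) - Int.fract (y + i * α)| < β := by
      have := Int.fract_nonneg (y + i * α)
      have := Int.fract_nonneg (y + j * α)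
      rw [abs_lt]; constructor <;> linarith
    linarith
  have := Finset.card_le_card_of_injOn (s := (Finset.range N).filter fun i : ℕ =>
    Int.fract (y + i * α) < β) (t := Finset.range (N / q + 1)) (fun i => i / q) ?_ ?_
  · simpa using this
  · intro i hi
    simp only [Finset.coe_filter, Set.mem_ofPred_eq, Finset.mem_range] at hi
    simp only [Finset.coe_range, Set.mem_Iio]
    exact Nat.lt_succ_of_le (Nat.div_le_div_right hi.1.le)
  · intro i hi j hj hij
    simp only [Finset.coe_filter, Set.mem_ofPred_eq] at hi hj
    by_contra hne
    rcases lt_or_gt_of_ne hne with h | h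
    · exact key i j hi.2 hj.2 h hij
    · exact key j i hj.2 hi.2 h hij.symm

/-- Separation leaves at most one value below `ρ`, which costs `1 / β`; the others are at least `ρ`.
-/
theorem sum_inv_le_of_separated_of_le {ι : Type*} {s : Finset ι} {f : ι → ℝ} {ρ : ℝ} (hρ : 0 < ρ)
    (hβ : 0 < β) (hf : ∀ i ∈ s, β ≤ f i)
    (hsep : ∀ i ∈ s, ∀ j ∈ s, i ≠ j → ρ ≤ |f i - f j|) :
    ∑ i ∈ s, 1 / f i ≤ 1 / β + 1 / ρ * (1 + Real.log s.card) := by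
  classical
  rw [← Finset.sum_filter_add_sum_filter_not s (fun i => f i < ρ)]
  refine add_le_add ?_ ?_
  · have hcard : (s.filter fun i => f i < ρ).card ≤ 1 := by
      refine Finset.card_le_one.2 fun i hi j hj => ?_
      rw [Finset.mem_filter] at hi hj
      by_contra hne
      have h1 := hsep i hi.1 j hj.1 hne
      have h2 := hf i hi.1
      have h3 := hf j hj.1
      have : |f i - f j| < ρ := by rw [abs_lt]; constructor <;> linarith
      linarith
    calc ∑ i ∈ s.filter (fun i => f i < ρ), 1 / f i
        ≤ ∑ i ∈ s.filter (fun i => f i < ρ), 1 / β :=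
          Finset.sum_le_sum fun i hi =>
            one_div_le_one_div_of_le hβ (hf i (Finset.mem_filter.1 hi).1)
      _ = (s.filter fun i => f i < ρ).card * (1 / β) := by rw [Finset.sum_const, nsmul_eq_mul]
      _ ≤ 1 * (1 / β) := mul_le_mul_of_nonneg_right (by exact_mod_cast hcard) (by positivity)
      _ = 1 / β := one_mul _
  · refine (sum_inv_le_of_separated hρ (fun i hi => ?_) fun i hi j hj hij => ?_).trans ?_
    · simpa using (Finset.mem_filter.1 hi).2
    · exact hsep i (Finset.mem_filter.1 hi).1 j (Finset.mem_filter.1 hj).1 hij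
    · refine mul_le_mul_of_nonneg_left ?_ (by positivity)
      rcases Nat.eq_zero_or_pos (s.filter fun i => ¬ f i < ρ).card with h | h
      · rw [h]; simp [Real.log_natCast_nonneg]
      · have := Real.log_le_log (by exact_mod_cast h)
          (Nat.cast_le (α := ℝ).2 (Finset.card_filter_le s fun i => ¬ f i < ρ))
        linarith

/-- The contribution of the times at which an orbit visits the support of a transfer term. -/
theorem sum_support_le {ρ : ℝ} (hq : 0 < q) (hT : 0 < T) (hTq : T + 2 * b ≤ q)
    (hβ : 0 < β) (hβb : ∃ m : ℤ, b * α = β + m)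
    (hsep : ∀ i : ℕ, 0 < i → i < q → β ≤ ‖((i * α : ℝ) : UnitAddCircle)‖) (hρ : 0 < ρ)
    (hsepb : ∀ i : ℕ, 0 < i → i < b → ρ ≤ ‖((i * α : ℝ) : UnitAddCircle)‖) (x : ℝ) (N : ℕ)
    {V : Finset ℕ} (hVN : V ⊆ Finset.range N)
    (hV : ∀ i ∈ V, ∃ u < b, Int.fract (x + i * α - T * α - u * α) < β) :
    ∑ i ∈ V, (1 / Int.fract (x + i * α) + 1 / (1 - Int.fract (x + i * α))) ≤
      (N / q + 1) * (2 * (1 / β + 1 / ρ * (1 + Real.log b))) := by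
  classical
  -- `z u` and `z' u` are the left and right ends of the `u`-th arc of the support. As `0 < T` and
  -- `T + 2 * b ≤ q`, both are at distance at least `β` from `0`, so the arc does not contain `0`
  -- and its ends bound the reciprocals on the whole arc.
  set z : ℕ → ℝ := fun u => T * α + u * α with hz
  set z' : ℕ → ℝ := fun u => T * α + b * α + u * α with hz'
  have hz_norm : ∀ u < b, β ≤ ‖(z u : UnitAddCircle)‖ := by
    intro u hu
    have := hsep (T + u) (by omega) (by omega)
    push_cast at this
    rwa [add_mul] at this
  have hz'_norm : ∀ u < b, β ≤ ‖(z' u : UnitAddCircle)‖ := by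
    intro u hu
    have := hsep (T + b + u) (by omega) (by omega)
    push_cast at this
    rwa [add_mul, add_mul] at this
  have hzz : ∀ u < b, Int.fract (z' u) = Int.fract (z u) + β := by
    intro u hu
    obtain ⟨m, hm⟩ := hβb
    have e : z' u = z u + β + m := by simp only [hz, hz', hm]; ring
    have h1 := hz_norm u hu
    have h2 := hz'_norm u hu
    have h3 := norm_coe_circle_le_one_sub_fract (z u)
    have h4 := norm_coe_circle_le_fract (z' u)
    have h5 := Int.fract_nonneg (z u)
    rw [e, Int.fract_add_intCast] at h4 ⊢
    -- In the borderline case the right end of the arc would be `0` itself, against the lower bound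
    -- on its distance.
    have h6 : Int.fract (z u) + β ≠ 1 := by
      intro h
      have : Int.fract (z u + β) = 0 := by
        rw [Int.fract_eq_iff]
        refine ⟨le_rfl, one_pos, ⌊z u⌋ + 1, ?_⟩
        simp only [Int.fract] at h
        push_cast; linarith
      rw [e] at h2
      linarith
    rw [Int.fract_eq_iff]
    refine ⟨by linarith, lt_of_le_of_ne (by linarith) h6, ⌊z u⌋, ?_⟩
    simp only [Int.fract]; ring
  set F : ℕ → ℝ := fun u => 1 / Int.fract (z u) + 1 / (1 - Int.fract (z' u)) with hF
  have hFnn : ∀ u, 0 ≤ F u := fun u => by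
    have h1 := Int.fract_nonneg (z u)
    have h2 := (Int.fract_lt_one (z' u)).le
    have h3 : 0 ≤ 1 - Int.fract (z' u) := by linarith
    simp only [hF]; positivity
  have hterm : ∀ i u : ℕ, u < b → Int.fract (x + i * α - T * α - u * α) < β →
      1 / Int.fract (x + i * α) + 1 / (1 - Int.fract (x + i * α)) ≤ F u := by
    intro i u hu hi
    have h0 := Int.fract_nonneg (x + i * α - T * α - u * α)
    have h1 := hz_norm u hu
    have h2 := norm_coe_circle_le_fract (z u)
    have h3 := hzz u hu
    have h4 := Int.fract_lt_one (z' u)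
    have h5 : Int.fract (x + i * α) = Int.fract (z u) + Int.fract (x + i * α - T * α - u * α) := by
      rw [Int.fract_eq_iff]
      refine ⟨by linarith, by linarith, ⌊z u⌋ + ⌊x + i * α - T * α - u * α⌋, ?_⟩
      simp only [Int.fract, hz]; push_cast; ring
    refine add_le_add ?_ ?_
    · exact one_div_le_one_div_of_le (by linarith) (by linarith)
    · exact one_div_le_one_div_of_le (by linarith) (by linarith)
  have hsum1 : ∑ u ∈ Finset.range b, 1 / Int.fract (z u) ≤ 1 / β + 1 / ρ * (1 + Real.log b) := by
    have := sum_inv_le_of_separated_of_le (s := Finset.range b)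
      (f := fun u => Int.fract (z u)) hρ hβ
      (fun u hu => (hz_norm u (Finset.mem_range.1 hu)).trans (norm_coe_circle_le_fract _))
      (fun u hu v hv huv => separated_fract _ hsepb (Finset.mem_range.1 hu)
        (Finset.mem_range.1 hv) huv)
    simpa using this
  have hsum2 : ∑ u ∈ Finset.range b, 1 / (1 - Int.fract (z' u)) ≤
      1 / β + 1 / ρ * (1 + Real.log b) := by
    have := sum_inv_le_of_separated_of_le (s := Finset.range b)
      (f := fun u => 1 - Int.fract (z' u)) hρ hβ
      (fun u hu => (hz'_norm u (Finset.mem_range.1 hu)).trans (norm_coe_circle_le_one_sub_fract _))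
      (fun u hu v hv huv => by
        rw [sub_sub_sub_cancel_left, abs_sub_comm]
        exact separated_fract _ hsepb (Finset.mem_range.1 hu) (Finset.mem_range.1 hv) huv)
    simpa using this
  choose! c hc using hV
  calc ∑ i ∈ V, (1 / Int.fract (x + i * α) + 1 / (1 - Int.fract (x + i * α)))
      ≤ ∑ i ∈ V, F (c i) := Finset.sum_le_sum fun i hi => hterm i (c i) (hc i hi).1 (hc i hi).2
    _ = ∑ u ∈ Finset.range b, ∑ i ∈ V.filter (fun i => c i = u), F (c i) :=
        (Finset.sum_fiberwise_of_maps_to (fun i hi => Finset.mem_range.2 (hc i hi).1) _).symm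
    _ = ∑ u ∈ Finset.range b, ((V.filter (fun i => c i = u)).card : ℝ) * F u := by
        refine Finset.sum_congr rfl fun u _ => ?_
        rw [← nsmul_eq_mul, ← Finset.sum_const]
        exact Finset.sum_congr rfl fun i hi => by rw [(Finset.mem_filter.1 hi).2]
    -- Each single arc is visited at most `N / q + 1` times, whence the factor in front of a sum
    -- over the arcs.
    _ ≤ ∑ u ∈ Finset.range b, (N / q + 1 : ℝ) * F u := by
        refine Finset.sum_le_sum fun u _ => mul_le_mul_of_nonneg_right ?_ (hFnn u)
        have h1 := card_hits_le hq hsep (x - T * α - u * α) N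
        have h2 : V.filter (fun i => c i = u) ⊆ (Finset.range N).filter fun i : ℕ =>
            Int.fract (x - T * α - u * α + i * α) < β := by
          intro i hi
          obtain ⟨hi1, rfl⟩ := Finset.mem_filter.1 hi
          refine Finset.mem_filter.2 ⟨hVN hi1, ?_⟩
          have := (hc i hi1).2
          rwa [show x - T * α - c i * α + i * α = x + i * α - T * α - c i * α by ring]
        have h3 : (((V.filter fun i => c i = u).card : ℕ) : ℝ) ≤ (N / q + 1 : ℕ) := by
          exact_mod_cast (Finset.card_le_card h2).trans h1
        refine h3.trans ?_
        push_cast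
        have : ((N / q : ℕ) : ℝ) ≤ N / q := Nat.cast_div_le
        linarith
    _ = (N / q + 1 : ℝ) * ∑ u ∈ Finset.range b, F u := (Finset.mul_sum _ _ _).symm
    _ ≤ _ := by
        refine mul_le_mul_of_nonneg_left ?_ (by positivity)
        simp only [hF]
        rw [Finset.sum_add_distrib]
        linarith

end Support

/-! ### Cancellation and its failure, in abstract form -/

section OneSheet

/-- Think of `R` and `L` as the reciprocal distances from the right and the left, of `A` and `B` as
the times near `0` on either side, of `V` as exceptional times. Since `R` already sums to nearly `X`
over `A`, and `L` over `B`, the remaining times carry at most `2 * E` for each. The weights select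
`A` and kill `B`, which leaves `-∑ i ∈ A, R i`. The errors are `E + 2 * E + 2 * E + E`, and one more
`E` for replacing that sum by `-X`. -/
theorem abs_sum_add_le {ι : Type*} [DecidableEq ι] {s A B V : Finset ι} (hA : A ⊆ s) (hB : B ⊆ s)
    (hV : V ⊆ s) (hAB : Disjoint A B) {R L φ w : ι → ℝ} (hR : ∀ i ∈ s, 0 ≤ R i)
    (hL : ∀ i ∈ s, 0 ≤ L i) (hw : ∀ i, w i = 0 ∨ w i = 1)
    (hφ : ∀ i ∈ s, |φ i - (L i - R i)| ≤ 2) (hwA : ∀ i ∈ A, i ∉ V → w i = 1)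
    (hwB : ∀ i ∈ B, i ∉ V → w i = 0) {X E : ℝ} (hRX : ∑ i ∈ s, R i ≤ X + E)
    (hLX : ∑ i ∈ s, L i ≤ X + E) (hRA : X - E ≤ ∑ i ∈ A, R i) (hLB : X - E ≤ ∑ i ∈ B, L i)
    (hVE : ∑ i ∈ V, (R i + L i) ≤ E) (hsE : 2 * (s.card : ℝ) ≤ E) :
    |∑ i ∈ s, w i * φ i + X| ≤ 7 * E := by
  have hRA' : ∑ i ∈ A, R i ≤ X + E :=
    (Finset.sum_le_sum_of_subset_of_nonneg hA fun i hi _ => hR i hi).trans hRX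
  have key : |∑ i ∈ s, w i * φ i + ∑ i ∈ A, R i| ≤ 6 * E := by
    have e1 : ∑ i ∈ A, R i = ∑ i ∈ s, if i ∈ A then R i else 0 := by
      rw [← Finset.sum_filter, Finset.filter_mem_eq_inter, Finset.inter_eq_right.2 hA]
    have e2 : ∑ i ∈ B, L i = ∑ i ∈ s, if i ∈ B then L i else 0 := by
      rw [← Finset.sum_filter, Finset.filter_mem_eq_inter, Finset.inter_eq_right.2 hB]
    have e3 : ∑ i ∈ V, (R i + L i) = ∑ i ∈ s, if i ∈ V then R i + L i else 0 := by
      rw [← Finset.sum_filter, Finset.filter_mem_eq_inter, Finset.inter_eq_right.2 hV]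
    have hpt : ∀ i ∈ s, |w i * φ i + if i ∈ A then R i else 0| ≤
        2 + (R i - if i ∈ A then R i else 0) + (L i - if i ∈ B then L i else 0)
          + if i ∈ V then R i + L i else 0 := by
      intro i hi
      have hRi := hR i hi
      have hLi := hL i hi
      have hφi := abs_le.1 (hφ i hi)
      have hAB' : i ∈ A → i ∉ B := fun h1 h2 => Finset.disjoint_left.1 hAB h1 h2
      have hwAi := hwA i
      have hwBi := hwB i
      rw [abs_le]
      by_cases hiA : i ∈ A
      · have hiB := hAB' hiA
        by_cases hiV : i ∈ V
        · simp only [hiA, hiB, hiV, if_true, if_false]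
          rcases hw i with h | h <;> rw [h] <;> constructor <;> linarith [hφi.1, hφi.2]
        · simp only [hiA, hiB, hiV, if_true, if_false]
          rw [hwAi hiA hiV]
          constructor <;> linarith [hφi.1, hφi.2]
      · by_cases hiV : i ∈ V
        · by_cases hiB : i ∈ B <;> simp only [hiA, hiB, hiV, if_true, if_false] <;>
            rcases hw i with h | h <;> rw [h] <;> constructor <;> linarith [hφi.1, hφi.2]
        · by_cases hiB : i ∈ B
          · simp only [hiA, hiB, hiV, if_true, if_false]
            rw [hwBi hiB hiV]
            constructor <;> linarith [hφi.1, hφi.2]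
          · simp only [hiA, hiB, hiV, if_false]
            rcases hw i with h | h <;> rw [h] <;> constructor <;> linarith [hφi.1, hφi.2]
    rw [e1, ← Finset.sum_add_distrib]
    refine (Finset.abs_sum_le_sum_abs _ _).trans ((Finset.sum_le_sum hpt).trans ?_)
    rw [Finset.sum_add_distrib, Finset.sum_add_distrib, Finset.sum_add_distrib,
      Finset.sum_sub_distrib, Finset.sum_sub_distrib, ← e1, ← e2, ← e3, Finset.sum_const,
      nsmul_eq_mul]
    linarith
  rw [abs_le] at key ⊢
  constructor <;> linarith [key.1, key.2]

theorem abs_sum_le_of_balanced {ι : Type*} {s : Finset ι} {R L φ : ι → ℝ}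
    (hφ : ∀ i ∈ s, |φ i - (L i - R i)| ≤ 2) {X E : ℝ} (hRX : ∑ i ∈ s, R i ≤ X + E)
    (hLX : ∑ i ∈ s, L i ≤ X + E) (hRX' : X - E ≤ ∑ i ∈ s, R i) (hLX' : X - E ≤ ∑ i ∈ s, L i)
    (hsE : 2 * (s.card : ℝ) ≤ E) : |∑ i ∈ s, φ i| ≤ 3 * E := by
  have h1 : |∑ i ∈ s, φ i - (∑ i ∈ s, L i - ∑ i ∈ s, R i)| ≤ E := by
    rw [← Finset.sum_sub_distrib, ← Finset.sum_sub_distrib]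
    refine (Finset.abs_sum_le_sum_abs _ _).trans ((Finset.sum_le_sum hφ).trans ?_)
    rw [Finset.sum_const, nsmul_eq_mul]; linarith
  rw [abs_le] at h1 ⊢
  constructor <;> linarith [h1.1, h1.2]

end OneSheet

/-! ### Choice of the level according to the scale `M` -/

/-- The level is the last `k` with `thr k ≤ M`; it exists because `thr` tends to infinity, and
monotonicity is not needed. -/
theorem exists_level {thr : ℕ → ℝ} (hthr : Tendsto thr atTop atTop) :
    ∃ level : ℝ → ℕ, Tendsto level atTop atTop ∧
      ∀ᶠ M in atTop, thr (level M) ≤ M ∧ M < thr (level M + 1) := by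
  have hbdd : ∀ M : ℝ, BddAbove {k | thr k ≤ M} := by
    intro M
    obtain ⟨K, hK⟩ := eventually_atTop.1 (hthr.eventually_gt_atTop M)
    refine ⟨K, fun k hk => ?_⟩
    by_contra hc
    push Not at hc
    exact absurd (hK k hc.le) (not_lt.2 hk)
  refine ⟨fun M => sSup {k | thr k ≤ M}, ?_, ?_⟩
  · refine tendsto_atTop.2 fun K => ?_
    filter_upwards [eventually_ge_atTop (thr K)] with M hM
    exact le_csSup (hbdd M) hM
  · filter_upwards [eventually_ge_atTop (thr 0)] with M hM
    refine ⟨Nat.sSup_mem (s := {k | thr k ≤ M}) ⟨0, hM⟩ (hbdd M), ?_⟩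
    by_contra hc
    push Not at hc
    have : sSup {k | thr k ≤ M} + 1 ≤ sSup {k | thr k ≤ M} := le_csSup (hbdd M) hc
    omega

/-- With `q ≈ A b` and `b √A ≤ M`, the product expands into four kinds of terms. Those with `b L`
and `(N / q) b L` are `O(M L / √A)`, small since `A` is large. Those with `N` and `q` are `O(M log
L)`, because `√A ≤ log L`. -/
theorem support_error_le {b A q L M e N g : ℝ} (hb0 : 0 < b) (hA1 : 1 ≤ A) (hqlow : A * b ≤ q)
    (hqup : q ≤ (A + 1) * b) (hbM : b * √A ≤ M) (hb1 : 1 ≤ Real.log b) (hlogb : Real.log b ≤ L)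
    (hAL : A ≤ Real.log L) (hAe : 48 ≤ e * √A) (hLe : 16 * Real.log L ≤ e / 2 * L) (hN0 : 0 ≤ N)
    (hN : N ≤ 2 * M) (hg : g ≤ 2 * q) :
    (N / q + 1) * (2 * (g + 2 * b * (1 + Real.log b))) ≤ e * (M * L) := by
  have hq0 : 0 < q := by nlinarith
  have hsA1 : 1 ≤ √A := Real.one_le_sqrt.2 hA1
  have hsA0 : 0 < √A := by linarith
  have hss : √A * √A = A := Real.mul_self_sqrt (by linarith)
  have hsle : √A ≤ A := (le_mul_of_one_le_left hsA0.le hsA1).trans_eq hss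
  have hM0 : 0 < M := (mul_pos hb0 hsA0).trans_le hbM
  have hL1 : 1 ≤ L := hb1.trans hlogb
  have hNq : N / q * q = N := by field_simp
  have s1 : (N / q + 1) * (2 * (g + 2 * b * (1 + Real.log b))) ≤
      (N / q + 1) * (2 * (2 * q + 2 * b * (2 * L))) := by
    refine mul_le_mul_of_nonneg_left ?_ (by positivity)
    have : 2 * b * (1 + Real.log b) ≤ 2 * b * (2 * L) :=
      mul_le_mul_of_nonneg_left (by linarith) (by positivity)
    linarith
  refine s1.trans ?_
  have s2 : (N / q + 1) * (2 * (2 * q + 2 * b * (2 * L))) =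
      4 * N + 4 * q + 8 * (L * (N / q * b)) + 8 * (L * b) := by
    linear_combination 4 * hNq
  rw [s2]
  have s3 : b ≤ M / √A := by rwa [le_div_iff₀ hsA0]
  have s4 : N / q * b ≤ 2 * (M / √A) := by
    rw [div_mul_eq_mul_div, div_le_iff₀ hq0]
    have h1 : b ≤ q / √A := by
      rw [le_div_iff₀ hsA0]
      refine le_trans ?_ hqlow
      rw [mul_comm]
      exact mul_le_mul_of_nonneg_right hsle hb0.le
    calc N * b ≤ (2 * M) * (q / √A) := mul_le_mul hN h1 hb0.le (by positivity)
      _ = _ := by ring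
  have s5 : q ≤ 2 * (√A * M) := by
    have h1 : √A * (b * √A) ≤ √A * M := mul_le_mul_of_nonneg_left hbM hsA0.le
    have h2 : √A * (b * √A) = A * b := by linear_combination b * hss
    have h3 : b ≤ A * b := le_mul_of_one_le_left hb0.le hA1
    linarith
  have s6 : √A ≤ Real.log L := hsle.trans hAL
  have s7 : M / √A ≤ e / 48 * M := by
    rw [div_le_iff₀ hsA0]
    have := mul_le_mul_of_nonneg_right hAe hM0.le
    linarith
  have s9 : √A * M ≤ Real.log L * M := mul_le_mul_of_nonneg_right s6 hM0.le
  have s10 : M ≤ Real.log L * M := le_mul_of_one_le_left hM0.le (hA1.trans hAL)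
  have s11 : 16 * Real.log L * M ≤ e / 2 * L * M := mul_le_mul_of_nonneg_right hLe hM0.le
  have s12 : L * (N / q * b) ≤ L * (2 * (e / 48 * M)) :=
    mul_le_mul_of_nonneg_left (by linarith) (by linarith)
  have s13 : L * b ≤ L * (e / 48 * M) := mul_le_mul_of_nonneg_left (by linarith) (by linarith)
  linarith

/-! ### Consequences of the standing assumptions -/

section Admissible

variable {α : ℝ} {n : ℕ → ℕ} {Q : ℕ → ℕ} {P : ℕ → ℤ}

theorem two_le_index (h : SkewFlow.Admissible α n) (k : ℕ) : 2 ≤ n k := by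
  have h1 := h.n_pos k
  obtain ⟨r, hr⟩ := h.even k
  omega

theorem index_add_two_le (h : SkewFlow.Admissible α n) (k : ℕ) : n k + 2 ≤ n (k + 1) := by
  have h1 := h.strictMono (Nat.lt_succ_self k)
  obtain ⟨r, hr⟩ := h.even k
  obtain ⟨r', hr'⟩ := h.even (k + 1)
  simp only [Nat.succ_eq_add_one] at h1
  omega

/-- At even indices `Q * α - P` is positive, and it is at most `1 / 2`, so it is its own fractional
part. -/
theorem gap_eq_abs (h : SkewFlow.Admissible α n) (hc : IsConvergentSeq α (SkewFlow.cfTerm α) Q P)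
    (k : ℕ) : gap α (fun l => Q (n l)) k = |Q (n k) * α - P (n k)| := by
  have h1 := hc.abs_lt_one_half (two_le_index h k)
  have h2 := hc.abs_eq (n k)
  rw [(h.even k).neg_one_pow, one_mul] at h2
  have h3 := hc.abs_pos (n k)
  rw [gap, Int.fract_eq_iff]
  exact ⟨h3.le, by linarith, P (n k), by rw [h2]; ring⟩

theorem gap_le (h : SkewFlow.Admissible α n) (hc : IsConvergentSeq α (SkewFlow.cfTerm α) Q P)
    (k : ℕ) : gap α (fun l => Q (n l)) k ≤ 1 / Q (n k + 1) := by
  rw [gap_eq_abs h hc]; exact hc.abs_le _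

theorem le_gap (h : SkewFlow.Admissible α n) (hc : IsConvergentSeq α (SkewFlow.cfTerm α) Q P)
    (k : ℕ) : 1 / (2 * Q (n k + 1)) ≤ gap α (fun l => Q (n l)) k := by
  rw [gap_eq_abs h hc]; exact hc.le_abs _

theorem gap_pos (h : SkewFlow.Admissible α n) (hc : IsConvergentSeq α (SkewFlow.cfTerm α) Q P)
    (k : ℕ) : 0 < gap α (fun l => Q (n l)) k := by
  rw [gap_eq_abs h hc]; exact hc.abs_pos _

theorem gap_le_norm (h : SkewFlow.Admissible α n) (hc : IsConvergentSeq α (SkewFlow.cfTerm α) Q P)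
    (k : ℕ) {i : ℕ} (hi : 0 < i) (hiQ : i < Q (n k + 1)) :
    gap α (fun l => Q (n l)) k ≤ ‖((i * α : ℝ) : UnitAddCircle)‖ := by
  rw [gap_eq_abs h hc, UnitAddCircle.norm_eq]
  exact hc.best_approx _ hi hiQ _

theorem lenJ_eq (hQ : ∀ m, SkewFlow.cfDen α m = (Q m : ℝ)) : SkewFlow.lenJ α n = ∑' k, 2 * gap α
    (fun l => Q (n l)) k := by
  simp only [SkewFlow.lenJ, gap, hQ]

theorem summable_gap (h : SkewFlow.Admissible α n) (hQ : ∀ m, SkewFlow.cfDen α m =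
    (Q m : ℝ)) : Summable fun k => 2 * gap α (fun l => Q (n l)) k := by
  have := h.summable
  simpa only [gap, hQ] using this

theorem lenJ_lt_half (h : SkewFlow.Admissible α n) : SkewFlow.lenJ α n < 1 / 2 := by
  refine lt_of_lt_of_le h.tsum_lt ?_
  rcases le_total (α / 4) (1 / 2) with h1 | h1
  · exact (min_le_left _ _).trans h1
  · exact (min_le_right _ _).trans (by linarith)

theorem partialLen_le_lenJ (h : SkewFlow.Admissible α n) (hQ : ∀ m, SkewFlow.cfDen α m =
    (Q m : ℝ)) (k : ℕ) :
    partialLen α (fun l => Q (n l)) k ≤ SkewFlow.lenJ α n := by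
  rw [lenJ_eq hQ]
  refine (summable_gap h hQ).sum_le_tsum _ fun i _ => ?_
  have := gap_nonneg (α := α) (b := fun l => Q (n l)) i
  positivity

theorem partialTime_lt (h : SkewFlow.Admissible α n) (hQ : ∀ m, SkewFlow.cfDen α m = (Q m : ℝ))
    (k : ℕ) : partialTime (fun l => Q (n l)) (k + 1) + 1 < Q (n k + 1) := by
  have := h.sum_lt k
  simp only [hQ] at this
  have h2 : 1 + ∑ l ∈ Finset.range (k + 1), 2 * Q (n l) < Q (n k + 1) := by exact_mod_cast this
  simp only [partialTime]
  omega

theorem two_pow_mul_le (h : SkewFlow.Admissible α n) (hc : IsConvergentSeq α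
    (SkewFlow.cfTerm α) Q P) (k i : ℕ) : 2 ^ i * Q (n k + 1) ≤ Q (n (k + i) + 1) := by
  induction i with
  | zero => simp
  | succ i ih =>
    have h1 : n (k + i) + 1 + 2 ≤ n (k + i + 1) + 1 := by
      have := index_add_two_le h (k + i); omega
    have h2 := hc.monotone h1
    have h3 := hc.two_mul_le (n (k + i) + 1)
    rw [← add_assoc k, pow_succ]
    nlinarith

/-- The indices `n k` are even, hence at least two apart, so the denominators at least double with
each level and the tail is dominated by a geometric series. -/
theorem lenJ_sub_partialLen_le (h : SkewFlow.Admissible α n) (hc : IsConvergentSeq α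
    (SkewFlow.cfTerm α) Q P) (hQ : ∀ m, SkewFlow.cfDen α m = (Q m : ℝ)) (k : ℕ) :
    SkewFlow.lenJ α n - partialLen α (fun l => Q (n l)) k ≤ 4 / Q (n k + 1) := by
  have hs := summable_gap h hQ
  rw [lenJ_eq hQ, ← hs.sum_add_tsum_nat_add k, partialLen, add_sub_cancel_left]
  have hq := hc.cast_pos (n k + 1)
  have hgeo : HasSum (fun i : ℕ => 2 / Q (n k + 1) * ((1 : ℝ) / 2) ^ i) (2 / Q (n k + 1) * 2) :=
    hasSum_geometric_two.mul_left _
  have : (4 : ℝ) / Q (n k + 1) = 2 / Q (n k + 1) * 2 := by ring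
  rw [this, ← hgeo.tsum_eq]
  refine Summable.tsum_le_tsum (fun i => ?_) ((summable_nat_add_iff k).2 hs) hgeo.summable
  have h1 := gap_le h hc (i + k)
  have h2 : (2 ^ i * Q (n k + 1) : ℝ) ≤ Q (n (i + k) + 1) := by
    rw [add_comm i k]
    exact_mod_cast two_pow_mul_le h hc k i
  have h3 : (1 : ℝ) / Q (n (i + k) + 1) ≤ 1 / (2 ^ i * Q (n k + 1)) :=
    one_div_le_one_div_of_le (by positivity) h2
  calc 2 * gap α (fun l => Q (n l)) (i + k) ≤ 2 * (1 / (2 ^ i * Q (n k + 1))) := by linarith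
    _ = 2 / Q (n k + 1) * (1 / 2) ^ i := by rw [div_pow, one_pow]; field_simp

theorem tendsto_index
    (h : SkewFlow.Admissible α n) : Tendsto n atTop atTop := h.strictMono.tendsto_atTop

variable (α n Q) in
/-- At scale `M` and relative to the level `k`, the error terms are at most `e`. -/
def IsAdequateLevel (e M : ℝ) (k : ℕ) : Prop :=
  2 * M * Real.log (2 * Q (n k + 1)) ≤ e * (M * Real.log M) ∧
  (∀ N : ℕ, N ≤ 2 * M →
    (N / Q (n (k + 1) + 1) + 1) * (2 * (1 / gap α (fun l => Q (n l)) (k + 1) +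
      1 / (1 / (2 * Q (n (k + 1)))) * (1 + Real.log (Q (n (k + 1)))))) ≤
      e * (M * Real.log M)) ∧
  M * (SkewFlow.lenJ α n - partialLen α (fun l => Q (n l)) (k + 2)) ≤ e ∧
  partialTime (fun l => Q (n l)) (k + 2) ≤ 3 * M

/-- The thresholds `Q (n k) * √(a k)` split the large digit between two requirements. Lying above
the threshold of level `k + 1`, `M` exceeds `Q (n (k + 1))` by the factor `√a`, which makes the
visits to the last support negligible. Lying below the next threshold, `M` times the remaining
length of `J` is at most `4 / √a`, with the digit `a` of the next level. -/
theorem exists_isAdequateLevel (h : SkewFlow.Admissible α n)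
    (hc : IsConvergentSeq α (SkewFlow.cfTerm α) Q P) (hQ : ∀ m, SkewFlow.cfDen α m = (Q m : ℝ)) :
    ∃ level : ℝ → ℕ, ∀ e : ℝ, 0 < e → ∀ᶠ M : ℝ in atTop, ∃ k,
      level M = k + 1 ∧ IsAdequateLevel α n Q e M k := by
  set a : ℕ → ℝ := fun k => SkewFlow.cfTerm α (n k + 1) with ha
  have haone : ∀ k, 1 ≤ a k := fun k => hc.one_le (n k)
  have hsqrt : ∀ k, 1 ≤ √(a k) := fun k => Real.one_le_sqrt.2 (haone k)
  have hthr : Tendsto (fun k => Q (n k) * √(a k)) atTop atTop := by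
    refine tendsto_atTop_mono (fun k => ?_) (hc.tendsto.comp (tendsto_index h))
    exact le_mul_of_one_le_right (hc.cast_pos _).le (hsqrt k)
  obtain ⟨level, hlev, hlevM⟩ := exists_level hthr
  refine ⟨level, fun e he => ?_⟩
  have hsqa : Tendsto (fun k => √(a k)) atTop atTop := Real.tendsto_sqrt_atTop.comp h.tendsto
  have hpred : Tendsto (fun M => level M - 1) atTop atTop := (tendsto_sub_atTop_nat 1).comp hlev
  have v1 := hpred.eventually (h.log_isLittleO.bound (c := e / 4) (by positivity))
  have hlittle := (h.isLittleO_succ.bound (c := 1) one_pos)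
  have hloglog : ∀ᶠ m in atTop, 0 ≤ Real.log (Real.log (Q m)) :=
    hc.tendsto.eventually (tendsto_log_log.eventually_ge_atTop 0)
  have hlogone : ∀ᶠ m in atTop, 1 ≤ Real.log (Q m) :=
    hc.tendsto.eventually (Real.tendsto_log_atTop.eventually_ge_atTop 1)
  have v2 := ((tendsto_index h).comp hlev).eventually (hlittle.and (hloglog.and hlogone))
  have v3 := hlev.eventually (hsqa.eventually_ge_atTop (48 / e))
  have v4 := ((tendsto_add_atTop_nat 1).comp hlev).eventually (hsqa.eventually_ge_atTop (4 / e))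
  have v5 := Real.tendsto_log_atTop.eventually
    (eventually_log_le_rpow 16 0 (by norm_num : (0 : ℝ) < 1) (half_pos he))
  have v6 := Real.tendsto_log_atTop.eventually_ge_atTop (4 * Real.log 2 / e)
  filter_upwards [v1, v2, v3, v4, v5, v6, hlevM, hlev.eventually_ge_atTop 1,
    eventually_gt_atTop 0] with M w1 w2 w3 w4 w5 w6 hM hk1 hM0
  obtain ⟨k, hk⟩ : ∃ k, level M = k + 1 := ⟨level M - 1, by omega⟩
  refine ⟨k, hk, ?_⟩
  simp only [Function.comp_apply, hk, Nat.add_sub_cancel] at w1 w2 w3 w4 hM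
  obtain ⟨w2, w7, w8⟩ := w2
  set b : ℝ := (Q (n (k + 1)) : ℝ) with hb
  set A : ℝ := a (k + 1) with hA
  set q : ℝ := (Q (n (k + 1) + 1) : ℝ) with hq
  set L := Real.log M with hL
  have hb0 : 0 < b := hc.cast_pos _
  have hq0 : 0 < q := hc.cast_pos _
  have hA1 : 1 ≤ A := haone _
  have hA0 : 0 < A := by linarith
  have hsA1 : 1 ≤ √A := hsqrt _
  have hss : √A * √A = A := Real.mul_self_sqrt hA0.le
  have hbM : b * √A ≤ M := hM.1
  have hbM' : b ≤ M := by nlinarith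
  have hlogb : Real.log b ≤ L := Real.log_le_log hb0 hbM'
  have hL1 : 1 ≤ L := w8.trans hlogb
  have hAL : A ≤ Real.log L := by
    simp only [hQ] at w2
    rw [Real.norm_of_nonneg (zero_le_one.trans (hc.one_le _)), Real.norm_of_nonneg w7,
      one_mul] at w2
    exact w2.trans (Real.log_le_log (by linarith) hlogb)
  have hqlow : A * b ≤ q := hc.mul_le _
  have hqup : q ≤ (A + 1) * b := hc.le_mul _
  refine ⟨?_, ?_, ?_, ?_⟩
  · simp only [hQ] at w1
    have hq1 : (1 : ℝ) ≤ Q (n k + 1) := by exact_mod_cast hc.pos _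
    rw [Real.norm_of_nonneg (Real.log_nonneg hq1), Real.norm_of_nonneg (by linarith)] at w1
    rw [Real.log_mul (by norm_num) (by linarith)]
    rw [div_le_iff₀ he] at w6
    have : e / 4 * Real.log b ≤ e / 4 * L := mul_le_mul_of_nonneg_left hlogb (by positivity)
    have h3 : Real.log 2 + Real.log (Q (n k + 1)) ≤ e / 2 * L := by linarith
    nlinarith
  · intro N hN
    have hg : 1 / gap α (fun l => Q (n l)) (k + 1) ≤ 2 * q := by
      have h1 := le_gap h hc (k + 1)
      have h2 := one_div_le_one_div_of_le (by positivity) h1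
      rwa [one_div_one_div] at h2
    rw [one_div_one_div]
    refine support_error_le hb0 hA1 hqlow hqup hbM w8 hlogb hAL ?_ ?_ (Nat.cast_nonneg N) hN hg
    · rwa [div_le_iff₀ he, mul_comm] at w3
    · rw [Real.rpow_one] at w5; linarith
  · have h1 := lenJ_sub_partialLen_le h hc hQ (k + 2)
    set A' : ℝ := a (k + 2) with hA'
    set q' : ℝ := (Q (n (k + 2) + 1) : ℝ) with hq'
    have hq'0 : 0 < q' := hc.cast_pos _
    have hM2 : M < Q (n (k + 2)) * √A' := hM.2
    have hlow : A' * Q (n (k + 2)) ≤ q' := hc.mul_le _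
    have hA'1 : 1 ≤ A' := haone _
    have hs'1 : 1 ≤ √A' := hsqrt _
    have hss' : √A' * √A' = A' := Real.mul_self_sqrt (by linarith)
    have w4' : 4 / e ≤ √A' := w4
    rw [div_le_iff₀ he] at w4'
    calc M * (SkewFlow.lenJ α n - partialLen α (fun l => Q (n l)) (k + 2))
        ≤ M * (4 / q') := mul_le_mul_of_nonneg_left h1 hM0.le
      _ ≤ e := by
        rw [mul_div_assoc', div_le_iff₀ hq'0]
        have hb' := hc.cast_pos (n (k + 2))
        calc M * 4 ≤ (Q (n (k + 2)) * √A') * (√A' * e) :=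
              mul_le_mul hM2.le w4' (by norm_num) (by positivity)
          _ = e * (A' * Q (n (k + 2))) := by
            linear_combination e * Q (n (k + 2)) * hss'
          _ ≤ e * q' := mul_le_mul_of_nonneg_left hlow he.le
  · rw [partialTime_succ]
    have h1 := partialTime_lt h hQ k
    have h2 : Q (n k + 1) ≤ Q (n (k + 1)) := hc.monotone (by
      have := index_add_two_le h k; omega)
    have h3 : partialTime (fun l => Q (n l)) (k + 1) + 2 * Q (n (k + 1)) ≤
        3 * Q (n (k + 1)) := by omega
    have h4 : ((partialTime (fun l => Q (n l)) (k + 1) + 2 * Q (n (k + 1)) : ℕ) : ℝ) ≤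
        3 * b := by rw [hb]; exact_mod_cast h3
    linarith

end Admissible

/-! ### Orbits that avoid the singularities and the tail of the arc -/

section GoodPoint

/-- Up to time `3 * M`, the orbit of `x` stays away from the singularities of the roof function and
from the part of the arc beyond `s`, and avoids the antipodes of the singularities. -/
def IsGoodPoint (α : ℝ) (n : ℕ → ℕ) (s M x : ℝ) : Prop :=
  ∀ i : ℕ, (i : ℝ) ≤ 3 * M → ∀ c : ℝ, (c = 0 ∨ c = α ∨ c = α - SkewFlow.lenJ α n) →
    1 / (M * slow M) + (SkewFlow.lenJ α n - s) < ‖((x + i * α + c : ℝ) : UnitAddCircle)‖ ∧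
    0 < ‖((x + i * α + c - 1 / 2 : ℝ) : UnitAddCircle)‖

variable {α : ℝ} {n : ℕ → ℕ} {s M x : ℝ}

theorem slow_pos (hM : 1 < M) : 0 < slow M := Real.rpow_pos_of_pos (Real.log_pos hM) _

theorem IsGoodPoint.isDoublyNonintegral (hx : IsGoodPoint α n s M x) (hs : s ≤ SkewFlow.lenJ α n)
    (hM : 1 < M) {i : ℕ} (hi : (i : ℝ) ≤ 3 * M) {c : ℝ}
    (hc : c = 0 ∨ c = α ∨ c = α - SkewFlow.lenJ α n) : IsDoublyNonintegral (x + i * α + c) := by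
  obtain ⟨h1, h2⟩ := hx i hi c hc
  have : 0 < 1 / (M * slow M) := by have := slow_pos hM; positivity
  exact isDoublyNonintegral_of_norm_pos (by linarith) h2

theorem IsGoodPoint.isRegularPoint (hx : IsGoodPoint α n s M x) (hs : s ≤ SkewFlow.lenJ α n)
    (hM : 1 < M) {i : ℕ} (hi : (i : ℝ) ≤ 3 * M) : IsRegularPoint α n (x + i * α) := by
  refine ⟨hx.isDoublyNonintegral hs hM hi (Or.inr (Or.inl rfl)), ?_, ?_⟩
  · have := hx.isDoublyNonintegral hs hM hi (Or.inr (Or.inr rfl))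
    rwa [show x + i * α + (α - SkewFlow.lenJ α n) = x + i * α - SkewFlow.lenJ α n + α by ring]
      at this
  · simpa using hx.isDoublyNonintegral hs hM hi (Or.inl rfl)

theorem IsGoodPoint.le_norm (hx : IsGoodPoint α n s M x) (hs : s ≤ SkewFlow.lenJ α n)
    {i : ℕ} (hi : (i : ℝ) ≤ 3 * M) {c : ℝ} (hc : c = 0 ∨ c = α ∨ c = α - SkewFlow.lenJ α n) :
    1 / (M * slow M) ≤ ‖((x + c + i * α : ℝ) : UnitAddCircle)‖ := by
  obtain ⟨h1, -⟩ := hx i hi c hc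
  rw [add_right_comm]
  linarith

/-- A point of the tail `[s, |J|)` is within `|J| - s` of its right end, which is the singularity
`|J| - α` seen one step later. -/
theorem IsGoodPoint.not_mem_tail (hx : IsGoodPoint α n s M x) (hM : 1 < M) {l : ℕ} (hl : 1 ≤ l)
    (hlM : (l : ℝ) ≤ 3 * M) :
    ¬ (s ≤ Int.fract (x + l * α) ∧ Int.fract (x + l * α) < SkewFlow.lenJ α n) := by
  rintro ⟨h1, h2⟩
  -- The condition on `c = α - |J|` at time `l - 1` controls the distance from `x + l * α` to `|J|`,
  -- hence the assumption `1 ≤ l`.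
  obtain ⟨i, rfl⟩ : ∃ i, l = i + 1 := ⟨l - 1, by omega⟩
  push_cast at hlM h1 h2
  obtain ⟨h3, -⟩ := hx i (by linarith) _ (Or.inr (Or.inr rfl))
  have h4 := norm_coe_circle_le_abs_sub (x + i * α + (α - SkewFlow.lenJ α n)) ⌊x + (i + 1) * α⌋
  have h5 : x + i * α + (α - SkewFlow.lenJ α n) - ⌊x + (i + 1) * α⌋ =
      Int.fract (x + (i + 1) * α) - SkewFlow.lenJ α n := by
    simp only [Int.fract]; ring
  rw [h5, abs_of_neg (by linarith)] at h4
  have : 0 < 1 / (M * slow M) := by have := slow_pos hM; positivity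
  linarith

theorem skew_iterate_of_isGoodPoint {b : ℕ → ℕ} {k : ℕ}
    (hx : IsGoodPoint α n (partialLen α b k) M x) (hM : 1 < M) (hJ : SkewFlow.lenJ α n ≤ 1)
    (hs : partialLen α b k ≤ SkewFlow.lenJ α n) (j : ZMod 2) {i : ℕ} (hi : (i : ℝ) ≤ 3 * M) :
    (SkewFlow.skew α n)^[i] ((x : UnitAddCircle), j) = (((x + i * α : ℝ) : UnitAddCircle),
      j + transfer α b k x + transfer α b k (x + i * α)) := by
  rw [skew_iterate hJ, sum_arcInd_eq_transfer hs hJ fun l h1 h2 => hx.not_mem_tail hM h1 ?_]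
  · rw [add_comm (transfer α b k (x + i * α)), add_assoc]
  · have : (l : ℝ) ≤ i := by exact_mod_cast h2
    linarith

end GoodPoint

/-! ### Birkhoff sums over orbits of good points -/

section Estimates

variable {α : ℝ} {n : ℕ → ℕ} {Q : ℕ → ℕ} {P : ℕ → ℤ}

theorem mem_support_transferTerm {b : ℕ → ℕ} {l : ℕ} {y : ℝ} (hy : transferTerm α b l y ≠ 0) :
    ∃ u < b l, Int.fract (y - partialTime b l * α - u * α) < gap α b l := by
  obtain ⟨u, hu, hne⟩ := Finset.exists_ne_zero_of_sum_ne_zero hy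
  refine ⟨u, Finset.mem_range.1 hu, ?_⟩
  by_contra hc
  exact hne (by simp [arcInd, hc])

/-- The sum of the contributions of the singularity over `0` on the sheet `1`. -/
theorem exists_sign_sheet_sum (h : SkewFlow.Admissible α n)
    (hc : IsConvergentSeq α (SkewFlow.cfTerm α) Q P) (hQ : ∀ m, SkewFlow.cfDen α m = (Q m : ℝ))
    (k : ℕ) : ∃ τ : ZMod 2 → ℝ, (∀ c, τ c = 1 ∨ τ c = -1) ∧ ∀ (x : ℝ) (N : ℕ) (c : ZMod 2) (E : ℝ),
      (∀ i < N, IsDoublyNonintegral (x + i * α)) →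
      (N / Q (n (k + 1) + 1) + 1) * (2 * (1 / gap α (fun l => Q (n l)) (k + 1) +
        1 / (1 / (2 * Q (n (k + 1)))) * (1 + Real.log (Q (n (k + 1)))))) ≤ E →
      2 * (N : ℝ) ≤ E →
      ∑ i ∈ Finset.range N, 1 / Int.fract (x + i * α) ≤ N * Real.log N + E →
      ∑ i ∈ Finset.range N, 1 / (1 - Int.fract (x + i * α)) ≤ N * Real.log N + E →
      N * Real.log N - E ≤ ∑ i ∈ (Finset.range N).filter
        (fun i : ℕ => Int.fract (x + i * α) < 1 / (2 * Q (n k + 1))),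
          1 / Int.fract (x + i * α) →
      N * Real.log N - E ≤ ∑ i ∈ (Finset.range N).filter
        (fun i : ℕ => 1 - Int.fract (x + i * α) < 1 / (2 * Q (n k + 1))),
          1 / (1 - Int.fract (x + i * α)) →
      |∑ i ∈ Finset.range N,
          sheetWeight (c + transfer α (fun l => Q (n l)) (k + 2) (x + i * α)) *
            logDistDeriv (x + i * α) - τ c * (N * Real.log N)| ≤ 7 * E := by
  classical
  set b : ℕ → ℕ := fun l => Q (n l) with hb
  set δ : ℝ := 1 / (2 * Q (n k + 1)) with hδ
  have hQ1 : (1 : ℝ) ≤ Q (n k + 1) := by exact_mod_cast hc.pos _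
  have hδ_half : δ ≤ 1 / 2 := one_div_le_one_div_of_le (by norm_num) (by linarith)
  have hgap := le_gap h hc k
  have hlen : 2 * gap α b k ≤ partialLen α b (k + 1) := by
    rw [partialLen_succ]
    have := partialLen_nonneg (α := α) (b := b) k
    linarith
  have hlenJ := partialLen_le_lenJ h hQ (k + 1)
  have hJ := lenJ_lt_half h
  have hgap0 := gap_pos h hc k
  obtain ⟨γ, hγ⟩ := exists_transfer_near_zero (α := α) (b := b) (k := k + 1) (δ := δ)
    (by linarith) (by linarith) (fun t ht1 ht2 => hgap.trans (gap_le_norm h hc k ht1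
      (ht2.trans_lt (partialTime_lt h hQ k))))
  -- The sheet is `c + γ` on the left of `0` and `c + γ + 1` on the right. If `c + γ = 0`, only
  -- passages on the right count, where the derivative is about `-1 / {y}`; otherwise only those on
  -- the left count.
  refine ⟨fun c => if c + γ = 0 then -1 else 1, fun c => by by_cases hcγ : c + γ = 0 <;> simp [hcγ],
    fun x N c E hreg hsupp hNE hR hL hRA hLB => ?_⟩
  set s := Finset.range N with hs
  set R : ℕ → ℝ := fun i => 1 / Int.fract (x + i * α) with hRdef
  set L : ℕ → ℝ := fun i => 1 / (1 - Int.fract (x + i * α)) with hLdef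
  set A := s.filter fun i : ℕ => Int.fract (x + i * α) < δ with hA
  set B := s.filter fun i : ℕ => 1 - Int.fract (x + i * α) < δ with hB
  -- The transfer function is controlled near `0` only up to level `k`. At times outside `V` the
  -- term of level `k + 1` vanishes, so that control suffices.
  set V := s.filter fun i : ℕ => transferTerm α b (k + 1) (x + i * α) ≠ 0 with hV
  set w : ℕ → ℝ := fun i => sheetWeight (c + transfer α b (k + 2) (x + i * α)) with hw
  have hAB : Disjoint A B := by
    refine Finset.disjoint_left.2 fun i hi hi' => ?_
    have h1 := (Finset.mem_filter.1 hi).2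
    have h2 := (Finset.mem_filter.1 hi').2
    linarith
  have hRnn : ∀ i ∈ s, 0 ≤ R i := fun i _ => by
    have := Int.fract_nonneg (x + i * α); simp only [hRdef]; positivity
  have hLnn : ∀ i ∈ s, 0 ≤ L i := fun i _ => by
    have := sub_nonneg.2 (Int.fract_lt_one (x + i * α)).le; simp only [hLdef]; positivity
  have hφ : ∀ i ∈ s, |logDistDeriv (x + i * α) - (L i - R i)| ≤ 2 := fun i hi =>
    (hreg i (Finset.mem_range.1 hi)).abs_logDistDeriv_sub_le
  have hVE : ∑ i ∈ V, (R i + L i) ≤ E := by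
    have hT0 : 0 < partialTime b (k + 1) := by
      rw [partialTime_succ]
      have : 0 < b k := hc.pos _
      omega
    have hTq : partialTime b (k + 1) + 2 * b (k + 1) ≤ Q (n (k + 1) + 1) := by
      have := partialTime_lt h hQ (k + 1)
      rw [partialTime_succ] at this
      simp only [hb] at this ⊢
      omega
    have hb0 : (0 : ℝ) < Q (n (k + 1)) := hc.cast_pos _
    refine (sum_support_le (hc.pos (n (k + 1) + 1)) hT0 hTq (gap_pos h hc (k + 1))
      ⟨⌊b (k + 1) * α⌋, by simp [gap, hb]⟩ (fun i hi hiq => gap_le_norm h hc (k + 1) hi hiq)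
      (ρ := 1 / (2 * Q (n (k + 1)))) (by positivity) (fun i hi hib => ?_) x N
      (Finset.filter_subset _ _) fun i hi =>
        mem_support_transferTerm (Finset.mem_filter.1 hi).2).trans hsupp
    have h2 := two_le_index h (k + 1)
    have e : n (k + 1) - 1 + 1 = n (k + 1) := by omega
    have h3 := hc.le_abs (n (k + 1) - 1)
    rw [e] at h3
    refine h3.trans ?_
    rw [UnitAddCircle.norm_eq]
    exact hc.best_approx _ hi (by rw [e]; exact hib) _
  have hoff : ∀ i ∈ s, i ∉ V → c + transfer α b (k + 2) (x + i * α) =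
      c + transfer α b (k + 1) (x + i * α) := by
    intro i hi hiV
    have : transferTerm α b (k + 1) (x + i * α) = 0 := by
      by_contra hne
      exact hiV (Finset.mem_filter.2 ⟨hi, hne⟩)
    rw [transfer, Finset.sum_range_succ, this, add_zero]
    rfl
  have hfpos : ∀ i ∈ s, 0 < Int.fract (x + i * α) := by
    intro i hi
    obtain ⟨m, hm1, hm2⟩ := hreg i (Finset.mem_range.1 hi)
    refine lt_of_le_of_ne (Int.fract_nonneg _) fun h0 => hm1 ?_
    have h1 : x + i * α = ⌊x + i * α⌋ := by
      have := Int.fract_add_floor (x + i * α)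
      rw [← h0, zero_add] at this
      exact this.symm
    rw [h1] at hm2 ⊢
    have h2 : |⌊x + i * α⌋ - m| < 1 := by
      have : |((⌊x + i * α⌋ - m : ℤ) : ℝ)| < 1 := by push_cast; linarith
      exact_mod_cast this
    have h3 := Int.abs_lt_one_iff.1 h2
    have h4 : ⌊x + i * α⌋ = m := by omega
    rw [h4]
  have hAV : ∀ i ∈ A, i ∉ V → c + transfer α b (k + 2) (x + i * α) = c + γ + 1 := by
    intro i hi hiV
    obtain ⟨hi1, hi2⟩ := Finset.mem_filter.1 hi
    rw [hoff i hi1 hiV, (hγ _).1 hi2 (hfpos i hi1), add_assoc]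
  have hBV : ∀ i ∈ B, i ∉ V → c + transfer α b (k + 2) (x + i * α) = c + γ := by
    intro i hi hiV
    obtain ⟨hi1, hi2⟩ := Finset.mem_filter.1 hi
    rw [hoff i hi1 hiV, (hγ _).2 hi2]
  have hsE : 2 * (s.card : ℝ) ≤ E := by rwa [hs, Finset.card_range]
  by_cases hcγ : c + γ = 0
  · have := abs_sum_add_le (s := s) (Finset.filter_subset _ _) (Finset.filter_subset _ _)
      (Finset.filter_subset _ _) hAB hRnn hLnn (w := w) (fun i => sheetWeight_eq _) hφ
      (fun i hi hiV => by simp only [hw]; rw [hAV i hi hiV, hcγ, zero_add, sheetWeight_one])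
      (fun i hi hiV => by simp only [hw]; rw [hBV i hi hiV, hcγ, sheetWeight_zero])
      hR hL hRA hLB hVE hsE
    simp only [hcγ, if_true]
    rw [neg_one_mul, sub_neg_eq_add]
    exact this
  · have hone : c + γ = 1 := by
      generalize c + γ = d at hcγ
      fin_cases d
      · exact absurd rfl hcγ
      · rfl
    -- The mirror image of the previous case: left and right are exchanged and the derivative
    -- changes sign.
    have := abs_sum_add_le (s := s) (A := B) (B := A) (V := V) (Finset.filter_subset _ _)
      (Finset.filter_subset _ _)
      (Finset.filter_subset _ _) hAB.symm (R := L) (L := R) hLnn hRnn (w := w)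
      (φ := fun i => -logDistDeriv (x + i * α)) (fun i => sheetWeight_eq _)
      (fun i hi => by
        have := hφ i hi
        rwa [← abs_neg, show -(-logDistDeriv (x + i * α) - (R i - L i)) =
          logDistDeriv (x + i * α) - (L i - R i) by ring])
      (fun i hi hiV => by simp only [hw]; rw [hBV i hi hiV, hone, sheetWeight_one])
      (fun i hi hiV => by
        simp only [hw]; rw [hAV i hi hiV, hone, one_add_one_eq_two]
        exact sheetWeight_zero)
      hL hR hLB hRA (by simpa only [add_comm] using hVE) hsE
    simp only [hcγ, if_false, one_mul]
    rw [← abs_neg]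
    convert this using 2
    simp only [mul_neg, Finset.sum_neg_distrib, hw]
    ring

theorem eventually_rpow_le_rpow {r s : ℝ} (hrs : r < s) (C : ℝ) {e : ℝ} (he : 0 < e) :
    ∀ᶠ L : ℝ in atTop, C * L ^ r ≤ e * L ^ s := by
  filter_upwards [(tendsto_rpow_atTop (sub_pos.2 hrs)).eventually_ge_atTop (C / e),
    eventually_gt_atTop 0] with L hL hL0
  rw [div_le_iff₀ he, Real.rpow_sub hL0, div_mul_eq_mul_div,
    le_div_iff₀ (Real.rpow_pos_of_pos hL0 r)]
    at hL
  linarith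

theorem sum_circleDeriv_roof (h : SkewFlow.Admissible α n) {b : ℕ → ℕ} {k : ℕ} {M x : ℝ}
    (hx : IsGoodPoint α n (partialLen α b k) M x) (hM : 1 < M)
    (hs : partialLen α b k ≤ SkewFlow.lenJ α n) (j : ZMod 2) {N : ℕ} (hN : (N : ℝ) ≤ 2 * M) :
    ∑ i ∈ Finset.range N, SkewFlow.circleDeriv (SkewFlow.roof α n)
      ((SkewFlow.skew α n)^[i] ((x : UnitAddCircle), j)) =
    ∑ i ∈ Finset.range N, logDistDeriv (x + α + i * α) +
      ∑ i ∈ Finset.range N, logDistDeriv (x + (α - SkewFlow.lenJ α n) + i * α) +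
      ∑ i ∈ Finset.range N, sheetWeight (j + transfer α b k x + transfer α b k (x + i * α)) *
        logDistDeriv (x + i * α) := by
  rw [← Finset.sum_add_distrib, ← Finset.sum_add_distrib]
  refine Finset.sum_congr rfl fun i hi => ?_
  have hi1 : (i : ℝ) < N := by exact_mod_cast Finset.mem_range.1 hi
  have hi2 : (i : ℝ) ≤ 3 * M := by linarith
  have hJ := lenJ_lt_half h
  rw [skew_iterate_of_isGoodPoint hx hM (by linarith) hs j hi2,
    circleDeriv_roof (hx.isRegularPoint hs hM hi2)]
  congr 3 <;> ring

theorem eventually_sum_circleDeriv (h : SkewFlow.Admissible α n)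
    (hc : IsConvergentSeq α (SkewFlow.cfTerm α) Q P) (hQ : ∀ m, SkewFlow.cfDen α m = (Q m : ℝ))
    {level : ℝ → ℕ} (hlevel : ∀ e : ℝ, 0 < e → ∀ᶠ M : ℝ in atTop, ∃ k,
      level M = k + 1 ∧ IsAdequateLevel α n Q e M k) {e : ℝ} (he : 0 < e) :
    ∀ᶠ M : ℝ in atTop, ∃ τ : ZMod 2 → ℝ, (∀ c, τ c = 1 ∨ τ c = -1) ∧ ∀ x j,
      IsGoodPoint α n (partialLen α (fun l => Q (n l)) (level M + 1)) M x →
      ∀ N : ℕ, M / 2 ≤ N → (N : ℝ) ≤ 2 * M →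
        |∑ i ∈ Finset.range N, SkewFlow.circleDeriv (SkewFlow.roof α n)
            ((SkewFlow.skew α n)^[i] ((x : UnitAddCircle), j))
          - τ (j + transfer α (fun l => Q (n l)) (level M + 1) x) * (N * Real.log N)| ≤
          e * (N * Real.log N) := by
  -- The errors below are `3 * E + 3 * E + 7 * E` from the three singularities, with `E = 2 * e' * M
  -- * L`, and `N log N ≥ M * L / 4`; hence `104 = 13 * 2 * 4`.
  set e' := e / 104 with he'
  have he'0 : 0 < e' := by positivity
  have ha : (fun m => SkewFlow.cfTerm α (m + 1)) =o[atTop] fun m => Real.log (Real.log (Q m)) := by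
    simpa only [hQ] using h.isLittleO_succ
  filter_upwards [hlevel e' he'0, eventually_oneSided hc ha he'0, eventually_gt_atTop 4,
    Real.tendsto_log_atTop.eventually_ge_atTop (2 * Real.log 2),
    Real.tendsto_log_atTop.eventually_ge_atTop (4 / e')] with M ⟨k, hk, hk1, hk2, _, _⟩ hone hM
      hL2 hLe
  have hM0 : 0 < M := by linarith
  have hM1 : 1 < M := by linarith
  set b : ℕ → ℕ := fun l => Q (n l) with hb
  obtain ⟨τ, hτ, hsum⟩ := exists_sign_sheet_sum h hc hQ k
  refine ⟨τ, hτ, fun x j hx N hN1 hN2 => ?_⟩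
  rw [hk] at hx ⊢
  have hs := partialLen_le_lenJ h hQ (k + 2)
  set X := N * Real.log N with hX
  set L := Real.log M with hL
  have hlog2 : 0 < Real.log 2 := Real.log_pos (by norm_num)
  have hML : 4 * M ≤ e' * (M * L) := by
    rw [div_le_iff₀ he'0] at hLe
    nlinarith
  have hXlow : M * L / 4 ≤ X := by
    have h1 : L / 2 ≤ Real.log N := by
      have : Real.log (M / 2) ≤ Real.log N := Real.log_le_log (by linarith) hN1
      rw [Real.log_div hM0.ne' (by norm_num)] at this
      linarith
    have h2 : 0 ≤ L / 2 := by linarith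
    calc M * L / 4 = M / 2 * (L / 2) := by ring
      _ ≤ X := mul_le_mul hN1 h1 h2 (by linarith)
  have hi3 : ∀ i : ℕ, i < N → (i : ℝ) ≤ 3 * M := by
    intro i hi
    have : (i : ℝ) < N := by exact_mod_cast hi
    linarith
  set δ : ℝ := 1 / (2 * Q (n k + 1)) with hδ
  have hQ1 : (1 : ℝ) ≤ Q (n k + 1) := by exact_mod_cast hc.pos _
  have hδ0 : 0 < δ := by positivity
  have hδ1 : δ ≤ 1 := by
    rw [hδ, div_le_one (by positivity)]; linarith
  have hlogδ : Real.log (1 / δ) = Real.log (2 * Q (n k + 1)) := by rw [hδ, one_div_one_div]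
  -- One half of `E` covers the error of the one-sided sums, the other the loss `2 * M * log (1 /
  -- δ)` from restricting to the `δ`-neighbourhood.
  set E := 2 * (e' * (M * L)) with hE
  have hE0 : 0 ≤ e' * (M * L) := by linarith
  have hNE : 2 * ((Finset.range N).card : ℝ) ≤ E := by rw [Finset.card_range]; linarith
  have hbal : ∀ c : ℝ, (c = 0 ∨ c = α ∨ c = α - SkewFlow.lenJ α n) →
      |∑ i ∈ Finset.range N, logDistDeriv (x + c + i * α)| ≤ 3 * E := by
    intro c hcc
    obtain ⟨⟨o1, o2⟩, o3, o4⟩ := hone N hN1 hN2 (x + c) fun i hi => hx.le_norm hs (hi3 i hi) hcc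
    have p2 := (o2 δ hδ0 hδ1).trans (Finset.sum_le_sum_of_subset_of_nonneg
      (Finset.filter_subset _ _) fun i _ _ => one_div_nonneg.2 (Int.fract_nonneg _))
    have p4 := (o4 δ hδ0 hδ1).trans (Finset.sum_le_sum_of_subset_of_nonneg
      (Finset.filter_subset _ _) fun i _ _ =>
        one_div_nonneg.2 (sub_nonneg.2 (Int.fract_lt_one _).le))
    rw [hlogδ] at p2 p4
    refine abs_sum_le_of_balanced (X := X) (fun i hi => ?_) (o1.trans (by linarith))
      (o3.trans (by linarith)) (le_trans (by linarith) p2) (le_trans (by linarith) p4) hNE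
    have := hx.isDoublyNonintegral hs hM1 (hi3 i (Finset.mem_range.1 hi)) hcc
    rw [add_right_comm] at this
    exact this.abs_logDistDeriv_sub_le
  have h0 : ∀ i : ℕ, x + 0 + i * α = x + i * α := fun i => by ring
  obtain ⟨⟨o1, o2⟩, o3, o4⟩ := hone N hN1 hN2 x fun i hi => by
    have := hx.le_norm hs (hi3 i hi) (Or.inl rfl)
    rwa [h0] at this
  have p2 := o2 δ hδ0 hδ1
  have p4 := o4 δ hδ0 hδ1
  rw [hlogδ] at p2 p4
  have key := hsum x N (j + transfer α b (k + 2) x) E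
    (fun i hi => by
      have := hx.isDoublyNonintegral hs hM1 (hi3 i hi) (Or.inl rfl)
      rwa [add_zero] at this)
    ((hk2 N hN2).trans (by linarith)) (by rwa [Finset.card_range] at hNE)
    (o1.trans (by linarith)) (o3.trans (by linarith)) (le_trans (by linarith) p2)
    (le_trans (by linarith) p4)
  rw [sum_circleDeriv_roof h hx hM1 hs j hN2]
  have k1 := abs_le.1 (hbal α (Or.inr (Or.inl rfl)))
  have k2 := abs_le.1 (hbal _ (Or.inr (Or.inr rfl)))
  have k3 := abs_le.1 key
  have hfin : 13 * E ≤ e * X := by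
    have : 13 * E = e * (M * L / 4) := by rw [hE, he']; ring
    rw [this]
    exact mul_le_mul_of_nonneg_left hXlow he.le
  rw [abs_le]
  constructor <;> linarith [k1.1, k1.2, k2.1, k2.2, k3.1, k3.2]

theorem IsGoodPoint.sum_inv_norm_sq_le {s M x : ℝ} (hx : IsGoodPoint α n s M x)
    (hs : s ≤ SkewFlow.lenJ α n) (hM : 1 < M)
    (hsep : ∀ i : ℕ, 0 < i → (i : ℝ) ≤ 3 * M → 1 / (M * slow M) ≤ ‖((i * α : ℝ) : UnitAddCircle)‖)
    {c : ℝ} (hc : c = 0 ∨ c = α ∨ c = α - SkewFlow.lenJ α n) {N : ℕ} (hN : (N : ℝ) ≤ 2 * M) :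
    ∑ i ∈ Finset.range N, 1 / ‖((x + c + i * α : ℝ) : UnitAddCircle)‖ ^ 2 ≤
      4 * (M * slow M) ^ 2 := by
  have hw := slow_pos hM
  have hρ : 0 < 1 / (M * slow M) := by positivity
  have hi3 : ∀ i : ℕ, i < N → (i : ℝ) ≤ 3 * M := by
    intro i hi
    have : (i : ℝ) < N := by exact_mod_cast hi
    linarith
  have hsep' : ∀ i ∈ Finset.range N, ∀ j ∈ Finset.range N, i ≠ j → 1 / (M * slow M) ≤
      |Int.fract (x + c + i * α) - Int.fract (x + c + j * α)| := fun i hi j hj hij =>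
    separated_fract (x + c) (fun i h1 h2 => hsep i h1 (hi3 i h2)) (Finset.mem_range.1 hi)
      (Finset.mem_range.1 hj) hij
  have h1 := sum_inv_sq_le_of_separated hρ (s := Finset.range N)
    (f := fun i : ℕ => Int.fract (x + c + i * α))
    (fun i hi => (hx.le_norm hs (hi3 i (Finset.mem_range.1 hi)) hc).trans
      (norm_coe_circle_le_fract _)) hsep'
  have h2 := sum_inv_sq_le_of_separated hρ (s := Finset.range N)
    (f := fun i : ℕ => 1 - Int.fract (x + c + i * α))
    (fun i hi => (hx.le_norm hs (hi3 i (Finset.mem_range.1 hi)) hc).trans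
      (norm_coe_circle_le_one_sub_fract _))
    (fun i hi j hj hij => by
      rw [sub_sub_sub_cancel_left, abs_sub_comm]; exact hsep' i hi j hj hij)
  have h3 : 2 / (1 / (M * slow M)) ^ 2 = 2 * (M * slow M) ^ 2 := by field_simp
  rw [h3] at h1 h2
  refine (Finset.sum_le_sum fun (i : ℕ) _ => inv_norm_sq_le (x + c + i * α)).trans ?_
  rw [Finset.sum_add_distrib]
  linarith

/-- No cancellation is needed. Reciprocal squares of `ρ`-separated values sum to `O(ρ⁻²)`, that is,
to `O(M² * slow M ^ 2)`, and `slow M ^ 2 = (log M) ^ (1 / 4)` is `o((log M) ^ (1 / 3))`. -/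
theorem eventually_sum_circleDeriv_circleDeriv (h : SkewFlow.Admissible α n)
    (hc : IsConvergentSeq α (SkewFlow.cfTerm α) Q P) (hQ : ∀ m, SkewFlow.cfDen α m = (Q m : ℝ))
    {e : ℝ} (he : 0 < e) :
    ∀ᶠ M : ℝ in atTop, ∀ k x j, IsGoodPoint α n (partialLen α (fun l => Q (n l)) k) M x →
      ∀ N : ℕ, M / 2 ≤ N → (N : ℝ) ≤ 2 * M →
        |∑ i ∈ Finset.range N, SkewFlow.circleDeriv (SkewFlow.circleDeriv (SkewFlow.roof α n))
            ((SkewFlow.skew α n)^[i] ((x : UnitAddCircle), j))| ≤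
          e * (Real.log N ^ ((1 : ℝ) / 3) * (N : ℝ) ^ 2) := by
  have ha : (fun m => SkewFlow.cfTerm α (m + 1)) =o[atTop] fun m => Real.log (Real.log (Q m)) := by
    simpa only [hQ] using h.isLittleO_succ
  have hpow : ∀ᶠ L : ℝ in atTop, 96 * L ^ (1 / 4 : ℝ) ≤ e * L ^ (1 / 3 : ℝ) :=
    eventually_rpow_le_rpow (by norm_num) _ he
  filter_upwards [eventually_separated hc ha, Real.tendsto_log_atTop.eventually hpow,
    eventually_gt_atTop 4, Real.tendsto_log_atTop.eventually_ge_atTop (2 * Real.log 2)] with M hsep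
    hpow hM hL2 k x j hx N hN1 hN2
  have hM0 : 0 < M := by linarith
  have hM1 : 1 < M := by linarith
  set b : ℕ → ℕ := fun l => Q (n l) with hb
  set L := Real.log M with hL
  have hlog2 : 0 < Real.log 2 := Real.log_pos (by norm_num)
  have hL0 : 0 < L := by linarith
  have hs := partialLen_le_lenJ h hQ k
  have hJ := lenJ_lt_half h
  set S : ℝ → ℝ := fun c => ∑ i ∈ Finset.range N, 1 / ‖((x + c + i * α : ℝ) : UnitAddCircle)‖ ^ 2
    with hS
  have hle : |∑ i ∈ Finset.range N, SkewFlow.circleDeriv (SkewFlow.circleDeriv (SkewFlow.roof α n))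
      ((SkewFlow.skew α n)^[i] ((x : UnitAddCircle), j))| ≤
      S α + S (α - SkewFlow.lenJ α n) + S 0 := by
    simp only [hS]
    rw [← Finset.sum_add_distrib, ← Finset.sum_add_distrib]
    refine (Finset.abs_sum_le_sum_abs _ _).trans (Finset.sum_le_sum fun i hi => ?_)
    have hi1 : (i : ℝ) < N := by exact_mod_cast Finset.mem_range.1 hi
    have hi2 : (i : ℝ) ≤ 3 * M := by linarith
    rw [skew_iterate_of_isGoodPoint hx hM1 (by linarith) hs j hi2,
      circleDeriv_circleDeriv_roof (hx.isRegularPoint hs hM1 hi2)]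
    rw [show x + i * α + α = x + α + i * α by ring,
      show x + i * α - SkewFlow.lenJ α n + α = x + (α - SkewFlow.lenJ α n) + i * α by ring,
      show x + 0 + i * α = x + i * α by ring]
    refine (abs_add_le _ _).trans (add_le_add ((abs_add_le _ _).trans (add_le_add ?_ ?_)) ?_)
    · rw [abs_of_nonneg (by positivity)]
    · rw [abs_of_nonneg (by positivity)]
    · rw [abs_mul, abs_of_nonneg (by positivity : 0 ≤ 1 / ‖((x + i * α : ℝ) : UnitAddCircle)‖ ^ 2)]
      exact mul_le_of_le_one_left (by positivity) (abs_sheetWeight_le _)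
  have b1 := hx.sum_inv_norm_sq_le hs hM1 hsep (Or.inr (Or.inl rfl)) hN2
  have b2 := hx.sum_inv_norm_sq_le hs hM1 hsep (Or.inr (Or.inr rfl)) hN2
  have b3 := hx.sum_inv_norm_sq_le hs hM1 hsep (Or.inl rfl) hN2
  have hw : slow M ^ 2 = L ^ (1 / 4 : ℝ) := by
    rw [slow, ← Real.rpow_natCast, ← Real.rpow_mul hL0.le]; norm_num
  have hlogN : L / 2 ≤ Real.log N := by
    have : Real.log (M / 2) ≤ Real.log N := Real.log_le_log (by linarith) hN1
    rw [Real.log_div hM0.ne' (by norm_num)] at this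
    linarith
  have hroot : L ^ (1 / 3 : ℝ) / 2 ≤ Real.log N ^ ((1 : ℝ) / 3) := by
    refine le_trans ?_ (Real.rpow_le_rpow (by positivity) hlogN (by norm_num))
    rw [Real.div_rpow hL0.le (by norm_num)]
    refine div_le_div_of_nonneg_left (by positivity) (by positivity) ?_
    calc (2 : ℝ) ^ (1 / 3 : ℝ) ≤ 2 ^ (1 : ℝ) :=
          Real.rpow_le_rpow_of_exponent_le (by norm_num) (by norm_num)
      _ = 2 := Real.rpow_one 2
  calc _ ≤ S α + S (α - SkewFlow.lenJ α n) + S 0 := hle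
    _ ≤ 12 * (M * slow M) ^ 2 := by linarith
    _ = M ^ 2 / 8 * (96 * L ^ (1 / 4 : ℝ)) := by rw [mul_pow, hw]; ring
    _ ≤ M ^ 2 / 8 * (e * L ^ (1 / 3 : ℝ)) := mul_le_mul_of_nonneg_left hpow (by positivity)
    _ = e * (L ^ (1 / 3 : ℝ) / 2 * (M / 2) ^ 2) := by ring
    _ ≤ e * (Real.log N ^ ((1 : ℝ) / 3) * (N : ℝ) ^ 2) := by
        refine mul_le_mul_of_nonneg_left (mul_le_mul hroot ?_ (by positivity) ?_) he.le
        · exact pow_le_pow_left₀ (by linarith) hN1 2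
        · exact Real.rpow_nonneg (by linarith) _

/-- Two points within `r / 2` of `0` would be closer than `r` to each other, so at most one term is
as large as `1 / ρ` and the others are at most `2 / r`. -/
theorem sum_inv_norm_le_of_separated {W : Finset ℕ} {y ρ r : ℝ} (hρ : 0 < ρ) (hr : 0 < r)
    (hW : ∀ i ∈ W, ρ ≤ ‖((y + i * α : ℝ) : UnitAddCircle)‖)
    (hsep : ∀ i ∈ W, ∀ j ∈ W, i < j → r ≤ ‖(((j - i : ℕ) * α : ℝ) : UnitAddCircle)‖) :
    ∑ i ∈ W, 1 / ‖((y + i * α : ℝ) : UnitAddCircle)‖ ≤ 1 / ρ + W.card * (2 / r) := by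
  classical
  have key : ∀ i ∈ W, ∀ j ∈ W, i < j → ‖((y + i * α : ℝ) : UnitAddCircle)‖ < r / 2 →
      ‖((y + j * α : ℝ) : UnitAddCircle)‖ < r / 2 → False := by
    intro i hi j hj hij h1 h2
    have h3 := hsep i hi j hj hij
    have h4 : (((j - i : ℕ) * α : ℝ) : UnitAddCircle) =
        ((y + j * α : ℝ) : UnitAddCircle) - ((y + i * α : ℝ) : UnitAddCircle) := by
      rw [← AddCircle.coe_sub, Nat.cast_sub hij.le]; congr 1; ring
    rw [h4] at h3
    have := norm_sub_le ((y + j * α : ℝ) : UnitAddCircle) ((y + i * α : ℝ) : UnitAddCircle)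
    linarith
  rw [← Finset.sum_filter_add_sum_filter_not W
    (fun i : ℕ => ‖((y + i * α : ℝ) : UnitAddCircle)‖ < r / 2)]
  refine add_le_add ?_ ?_
  · have hcard : (W.filter fun i : ℕ => ‖((y + i * α : ℝ) : UnitAddCircle)‖ < r / 2).card ≤ 1 := by
      refine Finset.card_le_one.2 fun i hi j hj => ?_
      rw [Finset.mem_filter] at hi hj
      by_contra hne
      rcases lt_or_gt_of_ne hne with hlt | hlt
      · exact key i hi.1 j hj.1 hlt hi.2 hj.2
      · exact key j hj.1 i hi.1 hlt hj.2 hi.2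
    refine (Finset.sum_le_card_nsmul _ _ (1 / ρ) fun i hi =>
      one_div_le_one_div_of_le hρ (hW i (Finset.mem_filter.1 hi).1)).trans ?_
    rw [nsmul_eq_mul]
    exact mul_le_of_le_one_left (by positivity) (by exact_mod_cast hcard)
  · refine (Finset.sum_le_card_nsmul _ _ (2 / r) fun i hi => ?_).trans ?_
    · have h1 := not_lt.1 (Finset.mem_filter.1 hi).2
      have h2 := one_div_le_one_div_of_le (by positivity) h1
      rwa [one_div_div] at h2
    · rw [nsmul_eq_mul]
      exact mul_le_mul_of_nonneg_right (by exact_mod_cast Finset.card_filter_le _ _)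
        (by positivity)

/-- This is `eventually_separated` at the scale `y = 2 * √(log M)` in place of `M`, where `5 * √(log
M) ≤ 3 * y` and `y * slow y ≤ y ^ 2 / 4 = log M`. -/
theorem eventually_separated_window (hc : IsConvergentSeq α (SkewFlow.cfTerm α) Q P)
    (ha : (fun m => SkewFlow.cfTerm α (m + 1)) =o[atTop] fun m => Real.log (Real.log (Q m))) :
    ∀ᶠ M : ℝ in atTop, ∀ i : ℕ, 0 < i → (i : ℝ) ≤ 5 * √(Real.log M) →
      1 / Real.log M ≤ ‖((i * α : ℝ) : UnitAddCircle)‖ := by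
  have ht : Tendsto (fun M => 2 * √(Real.log M)) atTop atTop :=
    (Real.tendsto_sqrt_atTop.comp Real.tendsto_log_atTop).const_mul_atTop (by norm_num)
  have hslow : ∀ᶠ y : ℝ in atTop, 1 < y ∧ slow y ≤ y / 4 := by
    filter_upwards [eventually_log_le_rpow 1 0 one_pos (by norm_num : (0 : ℝ) < 1 / 4),
      Real.tendsto_log_atTop.eventually_ge_atTop 1, eventually_gt_atTop 1] with y h1 h2 h3
    refine ⟨h3, ?_⟩
    have : slow y ≤ Real.log y ^ (1 : ℝ) :=
      Real.rpow_le_rpow_of_exponent_le h2 (by norm_num)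
    rw [Real.rpow_one] at this h1
    linarith
  filter_upwards [ht.eventually (eventually_separated hc ha), ht.eventually hslow,
    Real.tendsto_log_atTop.eventually_gt_atTop 0] with M h1 h2 h3 i hi hi5
  refine le_trans ?_ (h1 i hi (hi5.trans ?_))
  · have h4 := slow_pos h2.1
    refine one_div_le_one_div_of_le (by positivity) ?_
    have h5 := Real.mul_self_sqrt h3.le
    nlinarith [Real.sqrt_nonneg (Real.log M)]
  · have := Real.sqrt_nonneg (Real.log M)
    linarith

/-- In a window of length `O(√(log M))` each singularity is approached closely at most once, at a
cost of `M * slow M`. The other terms are `O(log M)` each, which is negligible against `M`. -/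
theorem eventually_sum_window (h : SkewFlow.Admissible α n)
    (hc : IsConvergentSeq α (SkewFlow.cfTerm α) Q P) (hQ : ∀ m, SkewFlow.cfDen α m = (Q m : ℝ))
    {e : ℝ} (he : 0 < e) :
    ∀ᶠ M : ℝ in atTop, ∀ l x j, IsGoodPoint α n (partialLen α (fun l => Q (n l)) l) M x →
      ∀ k : ℕ, (k : ℝ) < 2 * M →
        ∑ i ∈ Finset.Icc k ⌊(k : ℝ) + 5 * √(Real.log M)⌋₊,
          |SkewFlow.circleDeriv (SkewFlow.roof α n)
            ((SkewFlow.skew α n)^[i] ((x : UnitAddCircle), j))| ≤ e * (M * √(Real.log M)) := by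
  have ha : (fun m => SkewFlow.cfTerm α (m + 1)) =o[atTop] fun m => Real.log (Real.log (Q m)) := by
    simpa only [hQ] using h.isLittleO_succ
  have hpow : ∀ᶠ L : ℝ in atTop, 6 * L ^ (1 / 8 : ℝ) ≤ e * L ^ (1 / 2 : ℝ) :=
    eventually_rpow_le_rpow (by norm_num) _ he
  have hsq := (Real.isLittleO_pow_log_id_atTop (n := 2)).bound (c := min 1 (e / 72)) (by positivity)
  filter_upwards [eventually_separated_window hc ha, Real.tendsto_log_atTop.eventually hpow, hsq,
    eventually_gt_atTop 1, Real.tendsto_log_atTop.eventually_ge_atTop 25] with M hsep hpow hsq hM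
    hL1 m x j hx k hk
  have hM0 : 0 < M := by linarith
  set L := Real.log M with hL
  have hL0 : 0 < L := by linarith
  have hsqrt : 1 ≤ √L := Real.one_le_sqrt.2 (by linarith)
  have hss : √L * √L = L := Real.mul_self_sqrt hL0.le
  rw [Real.norm_of_nonneg (by positivity), id, Real.norm_of_nonneg hM0.le] at hsq
  have hsq1 : L ^ 2 ≤ M := hsq.trans (by
    exact mul_le_of_le_one_left hM0.le (min_le_left _ _))
  have hsq2 : L ^ 2 ≤ e / 72 * M := hsq.trans (mul_le_mul_of_nonneg_right (min_le_right _ _) hM0.le)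
  have hLL : √L ≤ L := by nlinarith
  have hfive : 5 * √L ≤ M := by nlinarith
  have hs := partialLen_le_lenJ h hQ m
  have hJ := lenJ_lt_half h
  set W := Finset.Icc k ⌊(k : ℝ) + 5 * √L⌋₊ with hW
  have hWle : ∀ i ∈ W, (i : ℝ) ≤ k + 5 * √L := by
    intro i hi
    exact (Nat.le_floor_iff (by positivity)).1 (Finset.mem_Icc.1 hi).2
  have hi3 : ∀ i ∈ W, (i : ℝ) ≤ 3 * M := by
    intro i hi
    have := hWle i hi
    linarith
  have hcard : (W.card : ℝ) ≤ 6 * √L := by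
    have h1 := Nat.floor_le (by positivity : 0 ≤ (k : ℝ) + 5 * √L)
    have h2 : k ≤ ⌊(k : ℝ) + 5 * √L⌋₊ := Nat.le_floor (by linarith)
    rw [hW, Nat.card_Icc, Nat.cast_sub (by omega)]
    push_cast
    linarith
  set S : ℝ → ℝ := fun c => ∑ i ∈ W, 1 / ‖((x + c + i * α : ℝ) : UnitAddCircle)‖ with hS
  have hSle : ∀ c : ℝ, (c = 0 ∨ c = α ∨ c = α - SkewFlow.lenJ α n) →
      S c ≤ M * slow M + 6 * √L * (2 * L) := by
    intro c hcc
    have hw := slow_pos hM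
    have := sum_inv_norm_le_of_separated (α := α) (W := W) (y := x + c) (ρ := 1 / (M * slow M))
      (r := 1 / L) (by positivity) (by positivity)
      (fun i hi => hx.le_norm hs (hi3 i hi) hcc)
      (fun i hi j hj hij => hsep (j - i) (by omega) (by
        have h1 := hWle j hj
        have h2 : (k : ℝ) ≤ i := by exact_mod_cast (Finset.mem_Icc.1 hi).1
        rw [Nat.cast_sub hij.le]
        linarith))
    rw [one_div_one_div, div_div_eq_mul_div, div_one] at this
    refine this.trans ?_
    have := mul_le_mul_of_nonneg_right hcard (by positivity : 0 ≤ 2 * L)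
    linarith
  have hle : ∑ i ∈ W, |SkewFlow.circleDeriv (SkewFlow.roof α n)
      ((SkewFlow.skew α n)^[i] ((x : UnitAddCircle), j))| ≤
      S α + S (α - SkewFlow.lenJ α n) + S 0 := by
    simp only [hS]
    rw [← Finset.sum_add_distrib, ← Finset.sum_add_distrib]
    refine Finset.sum_le_sum fun i hi => ?_
    have hi2 := hi3 i hi
    rw [skew_iterate_of_isGoodPoint hx hM (by linarith) hs j hi2,
      circleDeriv_roof (hx.isRegularPoint hs hM hi2)]
    rw [show x + i * α + α = x + α + i * α by ring,
      show x + i * α - SkewFlow.lenJ α n + α = x + (α - SkewFlow.lenJ α n) + i * α by ring,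
      show x + 0 + i * α = x + i * α by ring]
    refine (abs_add_le _ _).trans (add_le_add ((abs_add_le _ _).trans (add_le_add ?_ ?_)) ?_)
    · rw [abs_logDistDeriv]
    · rw [abs_logDistDeriv]
    · rw [abs_mul, abs_logDistDeriv]
      exact mul_le_of_le_one_left (by positivity) (abs_sheetWeight_le _)
  refine hle.trans ?_
  have b1 := hSle α (Or.inr (Or.inl rfl))
  have b2 := hSle _ (Or.inr (Or.inr rfl))
  have b3 := hSle 0 (Or.inl rfl)
  have hw : 6 * slow M ≤ e * √L := by
    rw [Real.sqrt_eq_rpow]; exact hpow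
  have c1 : M * (6 * slow M) ≤ M * (e * √L) := mul_le_mul_of_nonneg_left hw hM0.le
  have c2 : √L * L ≤ √L * (e / 72 * M) := by
    refine mul_le_mul_of_nonneg_left (le_trans ?_ hsq2) (by linarith)
    nlinarith
  linarith

end Estimates

/-! ### A single error function -/

section ErrorFunction

/-- Turns estimates valid for every fixed `e > 0` into one with an error `ε M → 0`: take the infimum
of the admissible `e`, increased by `1 / M` since the infimum need not be attained. -/
theorem exists_tendsto_zero_of_eventually {p : ℝ → ℝ → Prop}
    (hmono : ∀ᶠ M in atTop, ∀ e e', p M e → e ≤ e' → p M e')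
    (hp : ∀ e : ℝ, 0 < e → ∀ᶠ M in atTop, p M e) :
    ∃ ε : ℝ → ℝ, Tendsto ε atTop (𝓝 0) ∧ ∀ᶠ M in atTop, p M (ε M) := by
  set S : ℝ → Set ℝ := fun M => {e | 0 < e ∧ p M e} with hS
  have hbdd : ∀ M, BddBelow (S M) := fun M => ⟨0, fun e he => he.1.le⟩
  have hnn : ∀ M, 0 ≤ sInf (S M) := fun M => Real.sInf_nonneg fun e he => he.1.le
  have hlim : Tendsto (fun M => sInf (S M)) atTop (𝓝 0) := by
    refine Metric.tendsto_nhds.2 fun e he => ?_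
    filter_upwards [hp (e / 2) (half_pos he)] with M hM
    rw [Real.dist_eq, sub_zero, abs_of_nonneg (hnn M)]
    exact (csInf_le (hbdd M) ⟨half_pos he, hM⟩).trans_lt (half_lt_self he)
  refine ⟨fun M => sInf (S M) + M⁻¹, by simpa using hlim.add tendsto_inv_atTop_zero, ?_⟩
  filter_upwards [hmono, hp 1 one_pos, eventually_gt_atTop 0] with M hm h1 hM
  obtain ⟨e, he, hlt⟩ := exists_lt_of_csInf_lt (s := S M) ⟨1, one_pos, h1⟩
    (lt_add_of_pos_right (sInf (S M)) (inv_pos.2 hM))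
  exact hm e _ he.2 hlt.le

end ErrorFunction

/-! ### Partition of the circle into cells -/

section Cells

/-- The `u`-th of `U` consecutive intervals of equal length that make up `[0, 1)`. -/
def cell (U u : ℕ) : Set ℝ := Set.Ico (u / U : ℝ) ((u + 1) / U)

theorem mem_cell_iff {U u : ℕ} (hU : 0 < U) {x : ℝ} : x ∈ cell U u ↔ u ≤ x * U ∧ x * U < u + 1 := by
  have : (0 : ℝ) < U := by exact_mod_cast hU
  rw [cell, Set.mem_Ico, div_le_iff₀ this, lt_div_iff₀ this]

theorem cell_subset {U u : ℕ} (hu : u < U) : cell U u ⊆ Set.Ico 0 1 := by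
  intro x hx
  have hU : (0 : ℝ) < U := by exact_mod_cast (Nat.zero_le u).trans_lt hu
  have h1 : (u + 1 : ℝ) ≤ U := by exact_mod_cast hu
  refine ⟨(by positivity : (0 : ℝ) ≤ u / U).trans hx.1, hx.2.trans_le ?_⟩
  rwa [div_le_one hU]

theorem floor_mul_of_mem_cell {U u : ℕ} (hU : 0 < U) {x : ℝ} (hx : x ∈ cell U u) :
    ⌊x * U⌋₊ = u := by
  obtain ⟨h1, h2⟩ := (mem_cell_iff hU).1 hx
  rw [Nat.floor_eq_iff ((Nat.cast_nonneg u).trans h1)]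
  exact ⟨h1, h2⟩

theorem eq_of_coe_circle_eq {x y : ℝ} (hx : x ∈ Set.Ico (0 : ℝ) 1) (hy : y ∈ Set.Ico (0 : ℝ) 1)
    (h : (x : UnitAddCircle) = y) : x = y := by
  obtain ⟨m, rfl⟩ := coe_circle_eq_iff.1 h
  have h1 := hx.1
  have h2 := hx.2
  have h3 := hy.1
  have h4 := hy.2
  have : m = 0 := by
    have a1 : (-1 : ℝ) < m := by linarith
    have a2 : (m : ℝ) < 1 := by linarith
    have a3 : (-1 : ℤ) < m := by exact_mod_cast a1
    have a4 : m < 1 := by exact_mod_cast a2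
    omega
  simp [this]

/-- The `j`-th copy of a set of real numbers in the space. -/
def lift (s : Set ℝ) (j : ZMod 2) : Set SkewFlow.Space :=
  (fun t : ℝ => ((t : UnitAddCircle), j)) '' s

theorem isIntervalOfLengthGE_lift_cell {U u : ℕ} (hu : u < U) {ℓ : ℝ} (hℓ : ℓ ≤ 1 / U)
    (j : ZMod 2) : SkewFlow.IsIntervalOfLengthGE ℓ (lift (cell U u) j) := by
  refine ⟨cell U u, j, Set.ordConnected_Ico, fun x hx y hy hxy =>
    eq_of_coe_circle_eq (cell_subset hu hx) (cell_subset hu hy) hxy, ?_, rfl⟩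
  rw [cell, Real.volume_Ico]
  refine ENNReal.ofReal_le_ofReal (hℓ.trans (le_of_eq ?_))
  ring

theorem lift_cell_eq_of_mem {U u u' : ℕ} (hu : u < U) (hu' : u' < U) {j j' : ZMod 2}
    {p : SkewFlow.Space} (hp : p ∈ lift (cell U u) j) (hp' : p ∈ lift (cell U u') j') :
    lift (cell U u) j = lift (cell U u') j' := by
  obtain ⟨x, hx, rfl⟩ := hp
  obtain ⟨y, hy, hxy⟩ := hp'
  obtain ⟨h1, rfl⟩ := Prod.mk_inj.1 hxy
  have hU : 0 < U := (Nat.zero_le u).trans_lt hu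
  have h2 := eq_of_coe_circle_eq (cell_subset hu' hy) (cell_subset hu hx) h1
  rw [← floor_mul_of_mem_cell hU hx, ← floor_mul_of_mem_cell hU hy, h2]

/-- The points that the good cells keep away from. -/
noncomputable def center (α : ℝ) (n : ℕ → ℕ) (i : ℕ) : Fin 7 → ℝ :=
  -- Entry `0` is a jump of the transfer functions, entries `1` to `3` are the points that reach a
  -- singularity at time `i`, and entries `4` to `6` those that reach the antipode of one. The
  -- discontinuities of the iterates are among the entries `1` and `3`.
  ![i * α, -(i * α), -(i * α) - α, -(i * α) - (α - SkewFlow.lenJ α n), 1 / 2 - i * α,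
    1 / 2 - i * α - α, 1 / 2 - i * α - (α - SkewFlow.lenJ α n)]

/-- All points of the cell are at distance more than `ρ` from the centers. -/
def IsGoodCell (α : ℝ) (n : ℕ → ℕ) (ρ M : ℝ) (U u : ℕ) : Prop :=
  ∀ x ∈ cell U u, ∀ i : ℕ, (i : ℝ) ≤ 3 * M → ∀ c : Fin 7,
    ρ < ‖((x - center α n i c : ℝ) : UnitAddCircle)‖

variable {α ρ M : ℝ} {n : ℕ → ℕ} {U u : ℕ}

theorem IsGoodCell.isGoodPoint {s : ℝ}
    (hu : IsGoodCell α n (1 / (M * slow M) + (SkewFlow.lenJ α n - s)) M U u) (hM : 1 < M)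
    (hs : s ≤ SkewFlow.lenJ α n) {x : ℝ} (hx : x ∈ cell U u) : IsGoodPoint α n s M x := by
  have hρ : 0 < 1 / (M * slow M) := by have := slow_pos hM; positivity
  intro i hi c hc
  rcases hc with rfl | rfl | rfl
  · have h1 := hu x hx i hi 1
    have h2 := hu x hx i hi 4
    simp only [center, Matrix.cons_val] at h1 h2
    rw [show x - -(i * α) = x + i * α + 0 by ring] at h1
    rw [show x - (1 / 2 - i * α) = x + i * α + 0 - 1 / 2 by ring] at h2
    exact ⟨h1, by linarith⟩
  · have h1 := hu x hx i hi 2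
    have h2 := hu x hx i hi 5
    simp only [center, Matrix.cons_val] at h1 h2
    rw [show x - (-(i * c) - c) = x + i * c + c by ring] at h1
    rw [show x - (1 / 2 - i * c - c) = x + i * c + c - 1 / 2 by ring] at h2
    exact ⟨h1, by linarith⟩
  · have h1 := hu x hx i hi 3
    have h2 := hu x hx i hi 6
    simp only [center, Matrix.cons_val] at h1 h2
    rw [show x - (-(i * α) - (α - SkewFlow.lenJ α n)) = x + i * α + (α - SkewFlow.lenJ α n) by ring]
      at h1
    rw [show x - (1 / 2 - i * α - (α - SkewFlow.lenJ α n)) =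
      x + i * α + (α - SkewFlow.lenJ α n) - 1 / 2 by ring] at h2
    exact ⟨h1, by linarith⟩

/-- A center between two points of the cell would itself lie in the cell, at distance `0` from a
center. -/
theorem IsGoodCell.not_mem_Ioc (hu : IsGoodCell α n ρ M U u) (hρ : 0 ≤ ρ) {x y : ℝ}
    (hx : x ∈ cell U u) (hy : y ∈ cell U u) {i : ℕ} (hi : (i : ℝ) ≤ 3 * M) (c : Fin 7) (m : ℤ) :
    ¬ (x < center α n i c + m ∧ center α n i c + m ≤ y) := by
  rintro ⟨h1, h2⟩
  have h3 : center α n i c + m ∈ cell U u := ⟨hx.1.trans h1.le, h2.trans_lt hy.2⟩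
  have h4 := hu _ h3 i hi c
  have h5 := norm_coe_circle_le_abs_sub (center α n i c + m - center α n i c) m
  rw [show center α n i c + m - center α n i c - m = 0 by ring, abs_zero] at h5
  linarith

theorem IsGoodCell.transfer_eq (hu : IsGoodCell α n ρ M U u) (hρ : 0 ≤ ρ) {b : ℕ → ℕ} {k : ℕ}
    (hk : partialTime b k ≤ 3 * M) {x y : ℝ} (hx : x ∈ cell U u) (hy : y ∈ cell U u) :
    transfer α b k x = transfer α b k y := by
  have key : ∀ x ∈ cell U u, ∀ y ∈ cell U u, x ≤ y → transfer α b k x = transfer α b k y :=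
    fun x hx y hy hxy => transfer_eq_of_no_jump hxy fun t ht m => by
      have htM : (t : ℝ) ≤ 3 * M := le_trans (by exact_mod_cast ht) hk
      have := hu.not_mem_Ioc hρ hx hy htM 0 m
      simpa only [center, Matrix.cons_val] using this
  rcases le_total x y with hxy | hxy
  · exact key x hx y hy hxy
  · exact (key y hy x hx hxy).symm

theorem IsGoodCell.arcInd_eq (hu : IsGoodCell α n ρ M U u) (hρ : 0 ≤ ρ) {l : ℕ}
    (hl : (l + 1 : ℕ) ≤ 3 * M) {x y : ℝ} (hx : x ∈ cell U u) (hy : y ∈ cell U u) :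
    arcInd (SkewFlow.lenJ α n) (x + (l + 1 : ℕ) * α) =
      arcInd (SkewFlow.lenJ α n) (y + (l + 1 : ℕ) * α) := by
  have hl' : (l : ℝ) ≤ 3 * M := by push_cast at hl; linarith
  have key : ∀ x ∈ cell U u, ∀ y ∈ cell U u, x ≤ y →
      arcInd (SkewFlow.lenJ α n) (x - -((l + 1 : ℕ) * α)) =
        arcInd (SkewFlow.lenJ α n) (y - -((l + 1 : ℕ) * α)) := by
    intro x hx y hy hxy
    refine arcInd_eq_of_no_jump hxy (fun m => ?_) fun m => ?_
    · have := hu.not_mem_Ioc hρ hx hy hl 1 m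
      simpa only [center, Matrix.cons_val] using this
    · have := hu.not_mem_Ioc hρ hx hy hl' 3 m
      simp only [center, Matrix.cons_val] at this
      rwa [show -(l * α) - (α - SkewFlow.lenJ α n) = -((l + 1 : ℕ) * α) + SkewFlow.lenJ α n by
        push_cast; ring] at this
  simp only [sub_neg_eq_add] at key
  rcases le_total x y with hxy | hxy
  · exact key x hx y hy hxy
  · exact (key y hy x hx hxy).symm

theorem IsGoodCell.continuousOn_skew_iterate (hu : IsGoodCell α n ρ M U u) (hρ : 0 ≤ ρ)
    (hJ : SkewFlow.lenJ α n ≤ 1) {i : ℕ} (hi : (i : ℝ) ≤ 3 * M) (j : ZMod 2) :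
    ContinuousOn (SkewFlow.skew α n)^[i] (lift (cell U u) j) := by
  rcases (cell U u).eq_empty_or_nonempty with h | ⟨y, hy⟩
  · simp [lift, h]
  · have hc : Continuous fun p : SkewFlow.Space => (p.1 + ((i * α : ℝ) : UnitAddCircle),
        j + ∑ l ∈ Finset.range i, arcInd (SkewFlow.lenJ α n) (y + (l + 1 : ℕ) * α)) := by
      fun_prop
    refine hc.continuousOn.congr ?_
    rintro _ ⟨x, hx, rfl⟩
    rw [skew_iterate hJ, AddCircle.coe_add]
    simp only
    congr 2
    refine Finset.sum_congr rfl fun l hl => hu.arcInd_eq hρ ?_ hx hy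
    refine le_trans ?_ hi
    exact_mod_cast Finset.mem_range.1 hl

end Cells

/-! ### Measure of the discarded cells -/

section Measure

theorem lebesgue_preimage_fst {B : Set UnitAddCircle} (hB : MeasurableSet B) :
    SkewFlow.lebesgue (Prod.fst ⁻¹' B) = volume B := by
  have hm : ∀ j : ZMod 2, (volume : Measure UnitAddCircle).map (fun x => (x, j))
      (Prod.fst ⁻¹' B : Set SkewFlow.Space) = volume B := by
    intro j
    rw [Measure.map_apply (by fun_prop) (measurable_fst hB)]
    rfl
  rw [SkewFlow.lebesgue, Measure.smul_apply, Measure.finsetSum_apply]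
  simp only [hm, Finset.sum_const, Finset.card_univ, ZMod.card, smul_eq_mul, nsmul_eq_mul]
  rw [← mul_assoc]
  norm_num
  rw [ENNReal.inv_mul_cancel (by norm_num) (by norm_num), one_mul]

theorem lebesgue_univ : SkewFlow.lebesgue Set.univ = 1 := by
  have := lebesgue_preimage_fst MeasurableSet.univ
  rwa [Set.preimage_univ, UnitAddCircle.measure_univ] at this

variable {α ρ M : ℝ} {n : ℕ → ℕ} {U : ℕ}

/-- A discarded cell has a point within `ρ` of a center, so all of it is within `ρ + 1 / U`. There
are at most `4 * M` times and `7` centers for each, with balls of measure at most `2 * (ρ + 1 / U)`;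
this gives the constant `56`. -/
theorem lebesgue_compl_le (hU : 0 < U) (hM : 1 ≤ M) {G : Set SkewFlow.Space}
    (hG : ∀ u < U, IsGoodCell α n ρ M U u → ∀ j, lift (cell U u) j ⊆ G) (hρ : 0 ≤ ρ) :
    SkewFlow.lebesgue Gᶜ ≤ ENNReal.ofReal (56 * (M * (ρ + 1 / U))) := by
  have hU0 : (0 : ℝ) < U := by exact_mod_cast hU
  set B : Set UnitAddCircle := ⋃ i ∈ Finset.range (⌊3 * M⌋₊ + 1), ⋃ c : Fin 7,
    Metric.closedBall ((center α n i c : ℝ) : UnitAddCircle) (ρ + 1 / U) with hB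
  have hBm : MeasurableSet B := by
    refine Finset.measurableSet_biUnion _ fun i _ => MeasurableSet.iUnion fun c => ?_
    exact Metric.isClosed_closedBall.measurableSet
  have hsub : Gᶜ ⊆ Prod.fst ⁻¹' B := by
    rintro ⟨y, j⟩ hy
    obtain ⟨t, ht, rfl⟩ : ∃ t ∈ Set.Ico (0 : ℝ) 1, (t : UnitAddCircle) = y := by
      obtain ⟨t, rfl⟩ := QuotientAddGroup.mk_surjective y
      exact ⟨Int.fract t, ⟨Int.fract_nonneg t, Int.fract_lt_one t⟩,
        coe_circle_eq_iff.2 ⟨-⌊t⌋, by simp only [Int.fract]; push_cast; ring⟩⟩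
    have htU : 0 ≤ t * U := mul_nonneg ht.1 hU0.le
    have hcell : t ∈ cell U ⌊t * U⌋₊ :=
      (mem_cell_iff hU).2 ⟨Nat.floor_le htU, Nat.lt_floor_add_one _⟩
    have hlt : ⌊t * U⌋₊ < U := (Nat.floor_lt htU).2 (by nlinarith [ht.2])
    have hbad : ¬ IsGoodCell α n ρ M U ⌊t * U⌋₊ := fun hgood =>
      hy (hG _ hlt hgood j ⟨t, hcell, rfl⟩)
    simp only [IsGoodCell, not_forall, not_lt] at hbad
    obtain ⟨x, hx, i, hi, c, hxc⟩ := hbad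
    simp only [hB, Set.mem_preimage, Set.mem_iUnion]
    refine ⟨i, Finset.mem_range.2 (Nat.lt_succ_of_le (Nat.le_floor hi)), c, ?_⟩
    rw [Metric.mem_closedBall, dist_eq_norm, ← AddCircle.coe_sub,
      show t - center α n i c = (x - center α n i c) + (t - x) by ring, AddCircle.coe_add]
    refine (norm_add_le _ _).trans (add_le_add hxc ?_)
    have h1 := norm_coe_circle_le_abs_sub (t - x) 0
    rw [Int.cast_zero, sub_zero] at h1
    refine h1.trans ?_
    have h2 : ((⌊t * U⌋₊ : ℝ) + 1) / U = ⌊t * U⌋₊ / U + 1 / U := by ring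
    have h3 := hcell.1
    have h4 := hcell.2
    have h5 := hx.1
    have h6 := hx.2
    rw [h2] at h4 h6
    rw [abs_le]
    constructor <;> linarith
  calc SkewFlow.lebesgue Gᶜ ≤ SkewFlow.lebesgue (Prod.fst ⁻¹' B) := measure_mono hsub
    _ = volume B := lebesgue_preimage_fst hBm
    _ ≤ ∑ i ∈ Finset.range (⌊3 * M⌋₊ + 1), volume (⋃ c : Fin 7,
          Metric.closedBall ((center α n i c : ℝ) : UnitAddCircle) (ρ + 1 / U)) :=
        measure_biUnion_finset_le _ _
    _ ≤ ∑ i ∈ Finset.range (⌊3 * M⌋₊ + 1), ∑ c : Fin 7, volume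
          (Metric.closedBall ((center α n i c : ℝ) : UnitAddCircle) (ρ + 1 / U)) :=
        Finset.sum_le_sum fun i _ => measure_iUnion_fintype_le _ _
    _ ≤ ∑ i ∈ Finset.range (⌊3 * M⌋₊ + 1), ∑ c : Fin 7, ENNReal.ofReal (2 * (ρ + 1 / U)) := by
        refine Finset.sum_le_sum fun i _ => Finset.sum_le_sum fun c _ => ?_
        rw [AddCircle.volume_closedBall]
        exact ENNReal.ofReal_le_ofReal (min_le_right _ _)
    _ = ENNReal.ofReal ((⌊3 * M⌋₊ + 1) * (7 * (2 * (ρ + 1 / U)))) := by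
        rw [Finset.sum_const, Finset.sum_const, Finset.card_range, Finset.card_univ,
          Fintype.card_fin, nsmul_eq_mul, nsmul_eq_mul,
          ENNReal.ofReal_mul (by positivity : (0 : ℝ) ≤ (⌊3 * M⌋₊ : ℝ) + 1),
          ENNReal.ofReal_mul (by norm_num)]
        congr 1
        · rw [← Nat.cast_succ, ENNReal.ofReal_natCast]
        · norm_num
    _ ≤ ENNReal.ofReal (56 * (M * (ρ + 1 / U))) := by
        refine ENNReal.ofReal_le_ofReal ?_
        have h1 := Nat.floor_le (by positivity : 0 ≤ 3 * M)
        have h2 : (⌊3 * M⌋₊ : ℝ) + 1 ≤ 4 * M := by linarith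
        have h3 : 0 ≤ 7 * (2 * (ρ + 1 / U)) := by positivity
        calc _ ≤ 4 * M * (7 * (2 * (ρ + 1 / U))) := mul_le_mul_of_nonneg_right h2 h3
          _ = _ := by ring

end Measure

/-! ### The good set -/

section GoodSet

/-- The good cells among `U` cells, lifted to both sheets. -/
def goodCells (α : ℝ) (n : ℕ → ℕ) (ρ M : ℝ) (U : ℕ) : Set (Set SkewFlow.Space) :=
  {I | ∃ u < U, ∃ j, IsGoodCell α n ρ M U u ∧ I = lift (cell U u) j}

theorem pairwiseDisjoint_goodCells (α : ℝ) (n : ℕ → ℕ) (ρ M : ℝ) (U : ℕ) :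
    (goodCells α n ρ M U).PairwiseDisjoint id := by
  rintro _ ⟨u, hu, j, -, rfl⟩ _ ⟨u', hu', j', -, rfl⟩ hne
  refine Set.disjoint_left.2 fun p hp hp' => hne ?_
  exact lift_cell_eq_of_mem hu hu' hp hp'

theorem tendsto_lebesgue_one {G : ℝ → Set SkewFlow.Space} {r : ℝ → ℝ} (hr : Tendsto r atTop (𝓝 0))
    (hG : ∀ᶠ M in atTop, SkewFlow.lebesgue (G M)ᶜ ≤ ENNReal.ofReal (r M)) :
    Tendsto (fun M => SkewFlow.lebesgue (G M)) atTop (𝓝 1) := by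
  have h1 : Tendsto (fun M => 1 - ENNReal.ofReal (r M)) atTop (𝓝 1) := by
    have := ENNReal.Tendsto.sub (tendsto_const_nhds (x := (1 : ENNReal)))
      (ENNReal.tendsto_ofReal hr) (Or.inl ENNReal.one_ne_top)
    simpa using this
  refine tendsto_of_tendsto_of_tendsto_of_le_of_le' h1 tendsto_const_nhds ?_
    (Eventually.of_forall fun M => (measure_mono (Set.subset_univ _)).trans_eq lebesgue_univ)
  filter_upwards [hG] with M hM
  have h2 : (1 : ENNReal) ≤ SkewFlow.lebesgue (G M) + SkewFlow.lebesgue (G M)ᶜ := by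
    rw [← lebesgue_univ, ← Set.union_compl_self (G M)]
    exact measure_union_le _ _
  exact tsub_le_iff_right.2 (h2.trans (add_le_add le_rfl hM))

theorem tendsto_slow : Tendsto slow atTop atTop :=
  (tendsto_rpow_atTop (by norm_num)).comp Real.tendsto_log_atTop

/-- The number of cells at scale `M`. -/
noncomputable def cellCount (M : ℝ) : ℕ := ⌊M * √(Real.log M) / 2⌋₊

/-- Rounding down makes the cells long enough, while `M / U = O(1 / √(log M))` keeps the measure of
the discarded part small. -/
theorem eventually_cellCount : ∀ᶠ M : ℝ in atTop, 0 < cellCount M ∧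
    2 / (M * √(Real.log M)) ≤ 1 / cellCount M ∧ M * (1 / cellCount M) ≤ 4 / √(Real.log M) := by
  filter_upwards [Real.tendsto_log_atTop.eventually_ge_atTop 1, eventually_ge_atTop 4]
    with M hL hM
  have hs : 1 ≤ √(Real.log M) := Real.one_le_sqrt.2 hL
  have h1 : 2 ≤ M * √(Real.log M) / 2 := by nlinarith
  have h2 : (cellCount M : ℝ) ≤ M * √(Real.log M) / 2 := Nat.floor_le (by linarith)
  have h3 : M * √(Real.log M) / 2 < cellCount M + 1 := Nat.lt_floor_add_one _
  have h4 : (0 : ℝ) < cellCount M := by linarith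
  refine ⟨by exact_mod_cast h4, ?_, ?_⟩
  · rw [div_le_div_iff₀ (by positivity) h4]
    linarith
  · rw [mul_one_div, div_le_div_iff₀ h4 (by positivity)]
    linarith

theorem IsRegularPoint.circleDifferentiableAt {α : ℝ} {n : ℕ → ℕ} {x : ℝ}
    (h : IsRegularPoint α n x) (j : ZMod 2) :
    SkewFlow.CircleDifferentiableAt (SkewFlow.roof α n) ((x : UnitAddCircle), j) ∧
      SkewFlow.CircleDifferentiableAt (SkewFlow.circleDeriv (SkewFlow.roof α n))
        ((x : UnitAddCircle), j) :=
  ⟨(hasDerivAt_roof h j).differentiableAt, (hasDerivAt_circleDeriv_roof h j).differentiableAt⟩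

end GoodSet

/-! ### Assembly of the theorem -/

theorem theorem6p1 (α : ℝ) (n : ℕ → ℕ) (h : SkewFlow.Admissible α n) :
    -- `G M` is the good set, `𝓘 M` the family of intervals that it consists of,
    -- and `ε M` a bound, uniform in everything else, for all the error terms
    ∃ (G : ℝ → Set SkewFlow.Space) (𝓘 : ℝ → Set (Set SkewFlow.Space)) (ε : ℝ → ℝ),
      Tendsto ε atTop (𝓝 0) ∧
      Tendsto (fun M => SkewFlow.lebesgue (G M)) atTop (𝓝 1) ∧
      ∀ᶠ M : ℝ in atTop,
        (G M = ⋃₀ 𝓘 M ∧ (𝓘 M).PairwiseDisjoint id ∧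
          ∀ I ∈ 𝓘 M, SkewFlow.IsIntervalOfLengthGE (2 / (M * √(Real.log M))) I) ∧
        -- the derivatives of the roof function below exist
        (∀ p ∈ G M, ∀ i : ℕ, (i : ℝ) ≤ 2 * M + 5 * √(Real.log M) →
          SkewFlow.CircleDifferentiableAt (SkewFlow.roof α n) ((SkewFlow.skew α n)^[i] p) ∧
          SkewFlow.CircleDifferentiableAt (SkewFlow.circleDeriv (SkewFlow.roof α n))
            ((SkewFlow.skew α n)^[i] p)) ∧
        (∀ I ∈ 𝓘 M, ∃ σ : ℝ, (σ = 1 ∨ σ = -1) ∧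
          ∀ p ∈ I, ∀ N : ℕ, M / 2 ≤ N → (N : ℝ) ≤ 2 * M →
            |∑ i ∈ Finset.range N,
                SkewFlow.circleDeriv (SkewFlow.roof α n) ((SkewFlow.skew α n)^[i] p)
              - σ * (N * Real.log N)| ≤ ε M * (N * Real.log N)) ∧
        (∀ p ∈ G M, ∀ N : ℕ, M / 2 ≤ N → (N : ℝ) ≤ 2 * M →
          |∑ i ∈ Finset.range N,
              SkewFlow.circleDeriv (SkewFlow.circleDeriv (SkewFlow.roof α n))
                ((SkewFlow.skew α n)^[i] p)|
            ≤ ε M * (Real.log N ^ ((1 : ℝ) / 3) * (N : ℝ) ^ 2)) ∧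
        (∀ p ∈ G M, ∀ k : ℕ, (k : ℝ) < 2 * M →
          ∑ i ∈ Finset.Icc k ⌊(k : ℝ) + 5 * √(Real.log M)⌋₊,
              |SkewFlow.circleDeriv (SkewFlow.roof α n) ((SkewFlow.skew α n)^[i] p)|
            ≤ ε M * (M * √(Real.log M))) ∧
        (∀ I ∈ 𝓘 M, ∀ i : ℕ, (i : ℝ) ≤ 2 * M + 5 * √(Real.log M) →
          ContinuousOn (SkewFlow.skew α n)^[i] I) := by
  obtain ⟨Q, P, hc, hQ⟩ := exists_isConvergentSeq h.irrational
  obtain ⟨level, hlevel⟩ := exists_isAdequateLevel h hc hQ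
  set b : ℕ → ℕ := fun l => Q (n l) with hb
  have hJ : SkewFlow.lenJ α n ≤ 1 := by linarith [lenJ_lt_half h]
  set s : ℝ → ℝ := fun M => partialLen α b (level M + 1) with hs
  have hsJ : ∀ k, partialLen α b k ≤ SkewFlow.lenJ α n := partialLen_le_lenJ h hQ
  set ρ : ℝ → ℝ := fun M => 1 / (M * slow M) + (SkewFlow.lenJ α n - s M) with hρ
  set 𝓘 : ℝ → Set (Set SkewFlow.Space) := fun M => goodCells α n (ρ M) M (cellCount M) with h𝓘
  have hρ0 : ∀ M, 1 < M → 0 ≤ ρ M := fun M hM => by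
    have h1 := slow_pos hM
    have h2 := hsJ (level M + 1)
    have h3 : 0 ≤ 1 / (M * slow M) := by positivity
    simp only [hρ, hs]
    linarith
  have hgood : ∀ M, 1 < M → ∀ u, IsGoodCell α n (ρ M) M (cellCount M) u →
      ∀ x ∈ cell (cellCount M) u, IsGoodPoint α n (partialLen α b (level M + 1)) M x :=
    fun M hM u hu x hx => hu.isGoodPoint hM (hsJ _) hx
  have herr : ∃ ε : ℝ → ℝ, Tendsto ε atTop (𝓝 0) ∧ ∀ᶠ M in atTop,
      (∀ I ∈ 𝓘 M, ∃ σ : ℝ, (σ = 1 ∨ σ = -1) ∧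
        ∀ p ∈ I, ∀ N : ℕ, M / 2 ≤ N → (N : ℝ) ≤ 2 * M →
          |∑ i ∈ Finset.range N,
              SkewFlow.circleDeriv (SkewFlow.roof α n) ((SkewFlow.skew α n)^[i] p)
            - σ * (N * Real.log N)| ≤ ε M * (N * Real.log N)) ∧
      (∀ p ∈ ⋃₀ 𝓘 M, ∀ N : ℕ, M / 2 ≤ N → (N : ℝ) ≤ 2 * M →
        |∑ i ∈ Finset.range N,
            SkewFlow.circleDeriv (SkewFlow.circleDeriv (SkewFlow.roof α n))
              ((SkewFlow.skew α n)^[i] p)|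
          ≤ ε M * (Real.log N ^ ((1 : ℝ) / 3) * (N : ℝ) ^ 2)) ∧
      (∀ p ∈ ⋃₀ 𝓘 M, ∀ k : ℕ, (k : ℝ) < 2 * M →
        ∑ i ∈ Finset.Icc k ⌊(k : ℝ) + 5 * √(Real.log M)⌋₊,
            |SkewFlow.circleDeriv (SkewFlow.roof α n) ((SkewFlow.skew α n)^[i] p)|
          ≤ ε M * (M * √(Real.log M))) := by
    refine exists_tendsto_zero_of_eventually (p := fun M e => (∀ I ∈ 𝓘 M, ∃ σ : ℝ,
        (σ = 1 ∨ σ = -1) ∧ ∀ p ∈ I, ∀ N : ℕ, M / 2 ≤ N → (N : ℝ) ≤ 2 * M →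
          |∑ i ∈ Finset.range N,
              SkewFlow.circleDeriv (SkewFlow.roof α n) ((SkewFlow.skew α n)^[i] p)
            - σ * (N * Real.log N)| ≤ e * (N * Real.log N)) ∧
      (∀ p ∈ ⋃₀ 𝓘 M, ∀ N : ℕ, M / 2 ≤ N → (N : ℝ) ≤ 2 * M →
        |∑ i ∈ Finset.range N,
            SkewFlow.circleDeriv (SkewFlow.circleDeriv (SkewFlow.roof α n))
              ((SkewFlow.skew α n)^[i] p)|
          ≤ e * (Real.log N ^ ((1 : ℝ) / 3) * (N : ℝ) ^ 2)) ∧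
      (∀ p ∈ ⋃₀ 𝓘 M, ∀ k : ℕ, (k : ℝ) < 2 * M →
        ∑ i ∈ Finset.Icc k ⌊(k : ℝ) + 5 * √(Real.log M)⌋₊,
            |SkewFlow.circleDeriv (SkewFlow.roof α n) ((SkewFlow.skew α n)^[i] p)|
          ≤ e * (M * √(Real.log M)))) ?_ fun e he => ?_
    · filter_upwards [eventually_gt_atTop 0] with M hM e e' ⟨h1, h2, h3⟩ hle
      refine ⟨fun I hI => ?_, fun p hp N hN hN' => (h2 p hp N hN hN').trans ?_,
        fun p hp k hk => (h3 p hp k hk).trans ?_⟩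
      · obtain ⟨σ, hσ, h4⟩ := h1 I hI
        exact ⟨σ, hσ, fun p hp N hN hN' => (h4 p hp N hN hN').trans
          (mul_le_mul_of_nonneg_right hle (by positivity))⟩
      · exact mul_le_mul_of_nonneg_right hle (by positivity)
      · exact mul_le_mul_of_nonneg_right hle (by positivity)
    · filter_upwards [eventually_sum_circleDeriv h hc hQ hlevel he,
        eventually_sum_circleDeriv_circleDeriv h hc hQ he, eventually_sum_window h hc hQ he,
        hlevel 1 one_pos, eventually_gt_atTop 1] with M h1 h2 h3 hk hM
      refine ⟨?_, ?_, ?_⟩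
      · rintro _ ⟨u, hu, j, hcell, rfl⟩
        obtain ⟨τ, hτ, h1⟩ := h1
        obtain ⟨k, hk, -, -, -, htime⟩ := hk
        have hU : (0 : ℝ) < cellCount M := by exact_mod_cast (Nat.zero_le u).trans_lt hu
        have hmem : (u / cellCount M : ℝ) ∈ cell (cellCount M) u :=
          ⟨le_rfl, (div_lt_div_iff_of_pos_right hU).2 (lt_add_one _)⟩
        -- The sign is read off at the left end of the cell; the transfer function has no jump
        -- inside a good cell, so the choice of the point is immaterial.
        refine ⟨τ (j + transfer α b (level M + 1) (u / cellCount M : ℝ)), hτ _, ?_⟩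
        rintro _ ⟨x, hx, rfl⟩ N hN hN'
        rw [hcell.transfer_eq (hρ0 M hM) (by rw [hk]; exact htime) hmem hx]
        exact h1 x j (hgood M hM u hcell x hx) N hN hN'
      · rintro _ ⟨_, ⟨u, hu, j, hcell, rfl⟩, x, hx, rfl⟩ N hN hN'
        exact h2 _ x j (hgood M hM u hcell x hx) N hN hN'
      · rintro _ ⟨_, ⟨u, hu, j, hcell, rfl⟩, x, hx, rfl⟩ k hk
        exact h3 _ x j (hgood M hM u hcell x hx) k hk
  obtain ⟨ε, hε, herr⟩ := herr
  have hwindow : ∀ᶠ M : ℝ in atTop, 2 * M + 5 * √(Real.log M) ≤ 3 * M := by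
    filter_upwards [eventually_ge_atTop 25, Real.tendsto_log_atTop.eventually_ge_atTop 0]
      with M hM hL
    have h1 : Real.log M ≤ M := (Real.log_le_sub_one_of_pos (by linarith)).trans (by linarith)
    have h2 : √(Real.log M) ≤ √M := Real.sqrt_le_sqrt h1
    have h3 : 5 ≤ √M := Real.le_sqrt_of_sq_le (by linarith)
    have h4 : √M * √M = M := Real.mul_self_sqrt (by linarith)
    nlinarith
  -- The good cells keep away from the tail of `J` as well, so its length must be `o(1 / M)` for the
  -- measure of the discarded cells to vanish.
  have htail : Tendsto (fun M => M * (SkewFlow.lenJ α n - s M)) atTop (𝓝 0) := by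
    refine Metric.tendsto_nhds.2 fun e he => ?_
    filter_upwards [hlevel (e / 2) (half_pos he), eventually_gt_atTop 0] with M hk hM
    obtain ⟨k, hk, -, -, h1, -⟩ := hk
    have h2 : 0 ≤ M * (SkewFlow.lenJ α n - s M) :=
      mul_nonneg hM.le (sub_nonneg.2 (hsJ _))
    rw [Real.dist_eq, sub_zero, abs_of_nonneg h2]
    simp only [hs, hk]
    exact h1.trans_lt (half_lt_self he)
  refine ⟨fun M => ⋃₀ 𝓘 M, 𝓘, ε, hε, ?_, ?_⟩
  · have hr : Tendsto (fun M => 56 * ((slow M)⁻¹ + M * (SkewFlow.lenJ α n - s M)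
        + 4 / √(Real.log M))) atTop (𝓝 0) := by
      have h1 : Tendsto (fun M => 4 / √(Real.log M)) atTop (𝓝 0) :=
        tendsto_const_nhds.div_atTop (Real.tendsto_sqrt_atTop.comp Real.tendsto_log_atTop)
      simpa using (((tendsto_inv_atTop_zero.comp tendsto_slow).add htail).add h1).const_mul 56
    refine tendsto_lebesgue_one hr ?_
    filter_upwards [eventually_cellCount, eventually_gt_atTop 1] with M hcount hM
    obtain ⟨hU, -, hU'⟩ := hcount
    refine (lebesgue_compl_le (G := ⋃₀ 𝓘 M) hU hM.le (fun u hu hcell j =>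
      Set.subset_sUnion_of_mem (show _ ∈ goodCells _ _ _ _ _ from ⟨u, hu, j, hcell, rfl⟩))
      (hρ0 M hM)).trans
      (ENNReal.ofReal_le_ofReal ?_)
    have hM0 : M ≠ 0 := by linarith
    have h1 : M * ρ M = (slow M)⁻¹ + M * (SkewFlow.lenJ α n - s M) := by
      have := (slow_pos hM).ne'
      simp only [hρ]
      field_simp
    rw [mul_add, h1]
    linarith
  · filter_upwards [herr, hwindow, eventually_cellCount, eventually_gt_atTop 1]
      with M herr hwin hcount hM
    obtain ⟨e1, e2, e3⟩ := herr
    obtain ⟨hU, hlen, -⟩ := hcount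
    refine ⟨⟨rfl, pairwiseDisjoint_goodCells _ _ _ _ _, ?_⟩, ?_, e1, e2, e3, ?_⟩
    · rintro _ ⟨u, hu, j, -, rfl⟩
      exact isIntervalOfLengthGE_lift_cell hu hlen j
    · rintro _ ⟨_, ⟨u, hu, j, hcell, rfl⟩, x, hx, rfl⟩ i hi
      have hx' := hgood M hM u hcell x hx
      simp only
      rw [skew_iterate_of_isGoodPoint hx' hM hJ (hsJ _) j (hi.trans hwin)]
      exact (hx'.isRegularPoint (hsJ _) hM (hi.trans hwin)).circleDifferentiableAt _
    · rintro _ ⟨u, hu, j, hcell, rfl⟩ i hi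
      exact hcell.continuousOn_skew_iterate (hρ0 M hM) hJ (hi.trans hwin) j
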